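/- Let $k$ be a field. All complexes are cohomological, unbounded, over $k$; dg algebras are associative and unital, and are regarded as dg categories with one object. All elements below are homogeneous, and $s(a)=|a|-1$ denotes the shifted degree. **Twisted tensor product.** For dg algebras $C,D$ let $C\widetilde\otimes D$ be the dg algebra generated by symbols $\mathrm{id}\otimes g$ ($g\in D$), of degree $|g|$, and $\varepsilon(f;g_1,\dots,g_n)$ ($f\in C$, $g_i\in D$, $n\ge 0$), of degree $|f|+\sum_i s(g_i)$, where $\varepsilon(f;)$ is also written $f\otimes\mathrm{id}$, with the following relations and differential: the symbols are linear in each argument; $g\mapsto \mathrm{id}\otimes g$ is a morphism of unital dg algebras; $1\otimes\mathrm{id}=1$; $\varepsilon(1;g_1,\dots,g_n)=0$ for $n\ge1$; $\varepsilon(f;g_1,\dots,g_n)=0$ if some $g_i=1$; $$\varepsilon(ff';g_1,\dots,g_n)=\sum_{m=0}^n(-1)^{|f'|\sum_{j\le m}s(g_j)}\,\varepsilon(f;g_1,\dots,g_m)\,\varepsilon(f';g_{m+1},\dots,g_n);$$ $d(f\otimes\mathrm{id})=df\otimes\mathrm{id}$; and for $n\ge1$ $$\begin{aligned} d\,\varepsilon(f;g_1,\dots,g_n)={}&\varepsilon(df;g_1,\dots,g_n)-\sum_{i=1}^n(-1)^{|f|+\sum_{j<i}s(g_j)}\varepsilon(f;\dots,dg_i,\dots)+(-1)^{|f|s(g_1)}(\mathrm{id}\otimes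 g_1)\,\varepsilon(f;g_2,\dots,g_n)\\&+\sum_{i=1}^{n-1}(-1)^{|f|+\sum_{j\le i}s(g_j)}\varepsilon(f;\dots,g_ig_{i+1},\dots)-(-1)^{|f|+\sum_{j<n}s(g_j)}\varepsilon(f;g_1,\dots,g_{n-1})\,(\mathrm{id}\otimes g_n).\end{aligned}$$ For dg algebra maps $\varphi,\psi$, the dg algebra map $\varphi\widetilde\otimes\psi$ sends $\varepsilon(f;g_1,\dots,g_n)$ to $\varepsilon(\varphi f;\psi g_1,\dots,\psi g_n)$ and $\mathrm{id}\otimes g$ to $\mathrm{id}\otimes\psi g$. **Monoids.** An associator is a dg algebra map $\alpha\colon(C\widetilde\otimes D)\widetilde\otimes E\to C\widetilde\otimes(D\widetilde\otimes E)$ with $\alpha(\mathrm{id}\otimes h)=\mathrm{id}\otimes(\mathrm{id}\otimes h)$, $\alpha(\varepsilon(\mathrm{id}\otimes g;h_1,\dots,h_n))=\mathrm{id}\otimes\varepsilon(g;h_1,\dots,h_n)$ and, for all $m,n\ge0$, $$\alpha\big(\varepsilon(\varepsilon(f;g_1,\dots,g_m);h_1,\dots,h_n)\big)=\sum(-1)^{\epsilon}\,\varepsilon\big(f;h_1,\dots,h_{i_1},\varepsilon(g_1;h_{i_1+1},\dots,h_{j_1}),h_{j_1+1},\dots,h_{i_m},\varepsilon(g_m;h_{i_m+1},\dots,h_{j_m}),h_{j_m+1},\dots,h_n\big),$$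 summed over $0\le i_1\le j_1\le i_2\le\dots\le i_m\le j_m\le n$, with $\epsilon=\sum_p s(g_p)\sum_{q\le i_p}s(h_q)$; here on the right-hand side an $h_q$ outside the inner $\varepsilon$'s stands for $\mathrm{id}\otimes h_q$. A dg algebra $B$ with a dg algebra map $m\colon B\widetilde\otimes B\to B$ is a *$\widetilde\otimes$-monoid sharing the dg algebra unit* if $m\circ(m\widetilde\otimes\mathrm{id})=m\circ(\mathrm{id}\,\widetilde\otimes\, m)\circ\alpha$ for the associator $\alpha$ with $C=D=E=B$, and $m(b\otimes\mathrm{id})=m(\mathrm{id}\otimes b)=b$ for all $b\in B$. **Brace algebras.** A *unital brace algebra structure* on a dg algebra $B$ (an algebra structure over the Getzler–Jones operad $\mathbf{Br}$ whose differential on the tensor coalgebra of $B[1]$ is the bar differential of $B$, unital with unit $1_B$) is a family of multilinear operations $x\{y_1,\dots,y_n\}=\{x;y_1,\dots,y_n\}$ on $B$, $n\ge0$, of degree $-n$, such that $x\{\}=x$; $$(xx')\{y_1,\dots,y_n\}=\sum_{m=0}^n(-1)^{|x'|\sum_{j\le m}s(y_j)}\,x\{y_1,\dots,y_m\}\,x'\{y_{m+1},\dots,y_n\};$$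 $$x\{y_1,\dots,y_m\}\{z_1,\dots,z_n\}=\sum(-1)^{\epsilon}\,x\{z_1,\dots,z_{i_1},y_1\{z_{i_1+1},\dots,z_{j_1}\},\dots,y_m\{z_{i_m+1},\dots,z_{j_m}\},z_{j_m+1},\dots,z_n\},$$ summed over $0\le i_1\le j_1\le\dots\le i_m\le j_m\le n$, with $\epsilon=\sum_p s(y_p)\sum_{q\le i_p}s(z_q)$; for $n\ge1$, $$\begin{aligned} d(x\{y_1,\dots,y_n\})={}&(dx)\{y_1,\dots,y_n\}-\sum_{i=1}^n(-1)^{|x|+\sum_{j<i}s(y_j)}x\{\dots,dy_i,\dots\}+(-1)^{|x|s(y_1)}y_1\cdot x\{y_2,\dots,y_n\}\\&+\sum_{i=1}^{n-1}(-1)^{|x|+\sum_{j\le i}s(y_j)}x\{\dots,y_iy_{i+1},\dots\}-(-1)^{|x|+\sum_{j<n}s(y_j)}x\{y_1,\dots,y_{n-1}\}\cdot y_n;\end{aligned}$$ and, for $n\ge1$, $x\{y_1,\dots,y_n\}=0$ if $x=1$ or some $y_i=1$. The cup product is the product of $B$. **Lemma.** Let $B$ be a dg algebra over $k$. There is exactly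 one associator $\alpha\colon(B\widetilde\otimes B)\widetilde\otimes B\to B\widetilde\otimes(B\widetilde\otimes B)$. $B$ is a $\widetilde\otimes$-monoid sharing the dg algebra unit if and only if it is a unital brace algebra. More precisely, the formula $$\{b;b_1,\dots,b_n\}=m(\varepsilon(b;b_1,\dots,b_n))$$ gives a bijection: for each $\widetilde\otimes$-monoid structure $m$ on $B$ sharing the unit there is exactly one unital brace algebra structure on $B$ satisfying it, and for each unital brace algebra structure on $B$ there is exactly one $\widetilde\otimes$-monoid structure $m$ sharing the unit that satisfies it. -/

import Mathlib

/-! Differential graded algebras over a field, the (one-object case of the) twisted tensor product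
of dg categories, and brace algebras. Complexes are cohomological and unbounded. -/

universe u v w v' w' x

noncomputable section

/-- A (unital, associative) dg algebra over `k`: a `ℤ`-graded `k`-algebra `⨁ i, gr i` with a
differential of degree `+1` satisfying the graded Leibniz rule. Equivalently, a dg category with a
single object. -/
structure DGAlg (k : Type u) [Field k] where
  carrier : Type v
  [ring : Ring carrier]
  [algebra : Algebra k carrier]
  gr : ℤ → Submodule k carrier
  [graded : GradedAlgebra gr]
  d : carrier →ₗ[k] carrier
  d_mem : ∀ {i : ℤ} {a : carrier}, a ∈ gr i → d a ∈ gr (i + 1)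
  d_d : ∀ a : carrier, d (d a) = 0
  leibniz : ∀ {i : ℤ} {a : carrier}, a ∈ gr i → ∀ b : carrier,
    d (a * b) = d a * b + (-1 : k) ^ i • (a * d b)

namespace DGAlg

attribute [instance] DGAlg.ring DGAlg.algebra DGAlg.graded

variable {k : Type u} [Field k]

/-- Homogeneous elements, each with a chosen degree. -/
abbrev H (A : DGAlg.{u, v} k) : Type v := Σ i : ℤ, A.gr i

namespace H

variable {A : DGAlg.{u, v} k}

/-- The underlying element. -/
def val (a : A.H) : A.carrier := a.2.1

/-- The shifted degree, i.e. the degree in `A[1]`. -/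
def sdeg (a : A.H) : ℤ := a.1 - 1

/-- The unit, in degree `0`. -/
def one (A : DGAlg.{u, v} k) : A.H := ⟨0, 1, SetLike.GradedOne.one_mem⟩

/-- The product of homogeneous elements. -/
def mul (a b : A.H) : A.H := ⟨a.1 + b.1, a.2.1 * b.2.1, SetLike.GradedMul.mul_mem a.2.2 b.2.2⟩

/-- The differential of a homogeneous element. -/
def d (a : A.H) : A.H := ⟨a.1 + 1, A.d a.2.1, A.d_mem a.2.2⟩

/-- The total shifted degree of a list of homogeneous elements. -/
def sdegs (l : List A.H) : ℤ := (l.map sdeg).sum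

@[simp] lemma sdegs_nil : sdegs ([] : List A.H) = 0 := rfl

@[simp] lemma sdegs_cons (a : A.H) (l : List A.H) : sdegs (a :: l) = (a.1 - 1) + sdegs l := by
  simp [sdegs, sdeg]

@[simp] lemma sdegs_append (l m : List A.H) : sdegs (l ++ m) = sdegs l + sdegs m := by
  simp [sdegs]

end H

/-- A morphism of dg algebras: a unital algebra map preserving degrees and commuting with the
differentials. -/
@[ext] structure DGHom (A : DGAlg.{u, v} k) (B : DGAlg.{u, w} k) where
  toAlgHom : A.carrier →ₐ[k] B.carrier
  map_mem : ∀ {i : ℤ} {a : A.carrier}, a ∈ A.gr i → toAlgHom a ∈ B.gr i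
  map_d : ∀ a : A.carrier, toAlgHom (A.d a) = B.d (toAlgHom a)

namespace DGHom

variable {A : DGAlg.{u, v} k} {B : DGAlg.{u, w} k} {C : DGAlg.{u, x} k}

instance : CoeFun (DGHom A B) (fun _ => A.carrier → B.carrier) := ⟨fun f => f.toAlgHom⟩

/-- The identity morphism. -/
def id (A : DGAlg.{u, v} k) : DGHom A A where
  toAlgHom := AlgHom.id k A.carrier
  map_mem h := h
  map_d _ := rfl

/-- Composition `g ∘ f`. -/
def comp (g : DGHom B C) (f : DGHom A B) : DGHom A C where
  toAlgHom := g.toAlgHom.comp f.toAlgHom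
  map_mem h := g.map_mem (f.map_mem h)
  map_d a := by simp [f.map_d, g.map_d]

/-- The component in degree `i`. -/
def mapGr (f : DGHom A B) (i : ℤ) : A.gr i →ₗ[k] B.gr i :=
  f.toAlgHom.toLinearMap.restrict fun _ h => f.map_mem h

/-- The effect on homogeneous elements. -/
def mapH (f : DGHom A B) (a : A.H) : B.H := ⟨a.1, f.mapGr a.1 a.2⟩

lemma mapH_mk (f : DGHom A B) (i : ℤ) (a : A.gr i) : f.mapH ⟨i, a⟩ = ⟨i, f.mapGr i a⟩ := rfl

lemma mapH_d (f : DGHom A B) (a : A.H) : f.mapH a.d = (f.mapH a).d := by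
  simp only [mapH, H.d]
  refine congrArg (Sigma.mk _) (Subtype.ext ?_)
  exact f.map_d _

lemma mapH_mul (f : DGHom A B) (a b : A.H) : f.mapH (a.mul b) = (f.mapH a).mul (f.mapH b) := by
  simp only [mapH, H.mul]
  refine congrArg (Sigma.mk _) (Subtype.ext ?_)
  exact map_mul f.toAlgHom _ _

lemma mapH_one (f : DGHom A B) : f.mapH (H.one A) = H.one B := by
  simp only [mapH, H.one]
  refine congrArg (Sigma.mk _) (Subtype.ext ?_)
  exact map_one f.toAlgHom

lemma sdegs_mapH (f : DGHom A B) (l : List A.H) : H.sdegs (l.map f.mapH) = H.sdegs l := by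
  induction l with
  | nil => rfl
  | cons a l ih => simp [ih, mapH]

end DGHom

/-! ### dg algebras given by generators and relations -/

section Present

variable (k)

/-- The free graded algebra on symbols `inl x` (standing for a generator `x` of degree `deg x`)
and `inr x` (standing for `d x`). -/
abbrev FreeDG (X : Type w) : Type (max u w) := FreeAlgebra k (X ⊕ X)

namespace FreeDG

variable {X : Type w}

/-- The generator `x`. -/
def gen (x : X) : FreeDG k X := FreeAlgebra.ι k (Sum.inl x)

/-- The differential `d x` of the generator `x`. -/
def dgen (x : X) : FreeDG k X := FreeAlgebra.ι k (Sum.inr x)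

/-- The degree of a symbol. -/
def wt (deg : X → ℤ) : X ⊕ X → ℤ
  | Sum.inl x => deg x
  | Sum.inr x => deg x + 1

variable {k}

/-- The homogeneous component of degree `n` of the free algebra: the span of the words of total
degree `n`. -/
def piece (deg : X → ℤ) (n : ℤ) : Submodule k (FreeDG k X) :=
  Submodule.span k {a | ∃ l : List (X ⊕ X), (l.map (wt deg)).sum = n ∧
    a = (l.map (FreeAlgebra.ι k)).prod}

variable (deg : X → ℤ)

lemma one_mem_piece : (1 : FreeDG k X) ∈ piece deg 0 :=
  Submodule.subset_span ⟨[], rfl, rfl⟩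

lemma ι_mem_piece (y : X ⊕ X) : FreeAlgebra.ι k y ∈ piece (k := k) deg (wt deg y) :=
  Submodule.subset_span ⟨[y], by simp, by simp⟩

lemma gen_mem (x : X) : gen k x ∈ piece deg (deg x) := ι_mem_piece deg (Sum.inl x)

lemma dgen_mem (x : X) : dgen k x ∈ piece deg (deg x + 1) := ι_mem_piece deg (Sum.inr x)

lemma mul_mem_piece {m n : ℤ} {a b : FreeDG k X} (ha : a ∈ piece deg m) (hb : b ∈ piece deg n) :
    a * b ∈ piece deg (m + n) := by
  have h := Submodule.mul_mem_mul ha hb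
  unfold piece at h
  rw [Submodule.span_mul_span] at h
  refine Submodule.span_mono ?_ h
  rintro _ ⟨_, ⟨l, hl, rfl⟩, _, ⟨l', hl', rfl⟩, rfl⟩
  exact ⟨l ++ l', by simp [hl, hl'], by simp⟩

/-- The parity automorphism `a ↦ (-1)^{|a|} a`. -/
def par : FreeDG k X →ₐ[k] FreeDG k X :=
  FreeAlgebra.lift k fun y => (-1 : k) ^ wt deg y • FreeAlgebra.ι k y

/-- Auxiliary algebra map `a ↦ (par a, D a; 0, a)` into matrices encoding the derivation `D`. -/
def derMat : FreeDG k X →ₐ[k] Matrix (Fin 2) (Fin 2) (FreeDG k X) :=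
  FreeAlgebra.lift k fun y => !![par deg (FreeAlgebra.ι k y),
    Sum.elim (fun x => dgen k x) (fun _ => 0) y; 0, FreeAlgebra.ι k y]

/-- The differential of the free dg algebra: the graded derivation with `x ↦ d x`, `d x ↦ 0`. -/
def D : FreeDG k X →ₗ[k] FreeDG k X where
  toFun a := derMat deg a 0 1
  map_add' := by simp
  map_smul' := by simp

lemma derMat_apply (a : FreeDG k X) : derMat deg a = !![par deg a, D deg a; 0, a] := by
  have key : derMat deg a 0 0 = par deg a ∧ derMat deg a 1 0 = 0 ∧ derMat deg a 1 1 = a := by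
    induction a using FreeAlgebra.induction with
    | grade0 r =>
      simp only [AlgHom.commutes]
      simp [Matrix.algebraMap_matrix_apply]
    | grade1 y => simp [derMat]
    | mul a b ha hb =>
      simp [Matrix.mul_apply, Fin.sum_univ_two, ha, hb]
    | add a b ha hb => simp [ha, hb]
  ext i j
  fin_cases i <;> fin_cases j <;> simp [key, D]

lemma D_mul (a b : FreeDG k X) : D deg (a * b) = D deg a * b + par deg a * D deg b := by
  have h : D deg (a * b) = (derMat deg a * derMat deg b) 0 1 := by
    rw [← map_mul]; rfl
  rw [h, derMat_apply, derMat_apply]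
  simp [Matrix.mul_apply, Fin.sum_univ_two, add_comm]

lemma D_ι (y : X ⊕ X) :
    D (k := k) deg (FreeAlgebra.ι k y) = Sum.elim (fun x => dgen k x) (fun _ => 0) y := by
  simp [D, derMat]

@[simp] lemma D_gen (x : X) : D deg (gen k x) = dgen k x := by
  exact D_ι deg (Sum.inl x)

@[simp] lemma D_dgen (x : X) : D deg (dgen k x) = 0 := by
  exact D_ι (k := k) deg (Sum.inr x)

lemma D_one : D (k := k) deg 1 = 0 := by
  have h := D_mul (k := k) deg 1 1
  simpa using h

lemma D_algebraMap (r : k) : D deg (algebraMap k (FreeDG k X) r) = 0 := by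
  rw [Algebra.algebraMap_eq_smul_one, map_smul, D_one, smul_zero]

lemma neg_one_zpow_mul_self (n : ℤ) : (-1 : k) ^ n * (-1 : k) ^ n = 1 := by
  rw [← mul_zpow]; simp

lemma par_ι (y : X ⊕ X) :
    par (k := k) deg (FreeAlgebra.ι k y) = (-1 : k) ^ wt deg y • FreeAlgebra.ι k y := by
  simp [par]

lemma par_of_mem {n : ℤ} {a : FreeDG k X} (ha : a ∈ piece deg n) :
    par deg a = (-1 : k) ^ n • a := by
  induction ha using Submodule.span_induction with
  | mem a h =>
    obtain ⟨l, rfl, rfl⟩ := h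
    induction l with
    | nil => simp
    | cons y l ih =>
      simp only [List.map_cons, List.prod_cons, map_mul, ih, par_ι, List.sum_cons]
      rw [zpow_add₀ (by simp), smul_mul_smul_comm]
  | zero => simp
  | add a b _ _ ha hb => simp [ha, hb]
  | smul c a _ ha => simp [ha, smul_comm c]

lemma par_par (a : FreeDG k X) : par deg (par deg a) = a := by
  induction a using FreeAlgebra.induction with
  | grade0 r => simp only [AlgHom.commutes]
  | grade1 y => rw [par_ι, map_smul, par_ι, smul_smul, neg_one_zpow_mul_self, one_smul]
  | mul a b ha hb => simp [ha, hb]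
  | add a b ha hb => simp [ha, hb]

lemma D_par (a : FreeDG k X) : D deg (par deg a) = - par deg (D deg a) := by
  induction a using FreeAlgebra.induction with
  | grade0 r => simp only [AlgHom.commutes, D_algebraMap]; simp
  | grade1 y =>
    rw [par_ι, map_smul]
    rcases y with x | x
    · rw [D_ι]
      simp only [Sum.elim_inl, dgen, par_ι, wt]
      rw [zpow_add₀ (by simp)]; simp
    · simp [D_ι]
  | mul a b ha hb =>
    simp only [map_mul, D_mul, ha, hb, map_add, par_par]
    simp [add_comm]
  | add a b ha hb => simp [ha, hb, add_comm]

lemma D_D (a : FreeDG k X) : D deg (D deg a) = 0 := by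
  induction a using FreeAlgebra.induction with
  | grade0 r => simp [D_algebraMap]
  | grade1 y => rcases y with x | x <;> simp [D_ι]
  | mul a b ha hb => simp [D_mul, ha, hb, D_par]
  | add a b ha hb => simp [ha, hb]

lemma D_mem {n : ℤ} {a : FreeDG k X} (ha : a ∈ piece deg n) : D deg a ∈ piece deg (n + 1) := by
  induction ha using Submodule.span_induction with
  | mem a h =>
    obtain ⟨l, rfl, rfl⟩ := h
    induction l with
    | nil => simp [D_one]
    | cons y l ih =>
      simp only [List.map_cons, List.prod_cons, D_mul, List.sum_cons]
      have hl : (l.map (FreeAlgebra.ι k)).prod ∈ piece (k := k) deg (l.map (wt deg)).sum :=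
        Submodule.subset_span ⟨l, rfl, rfl⟩
      refine Submodule.add_mem _ ?_ ?_
      · rcases y with x | x
        · have h := mul_mem_piece deg (dgen_mem (k := k) deg x) hl
          simp only [D_ι, Sum.elim_inl, wt]
          convert h using 2
          ring
        · simp [D_ι]
      · rw [par_ι, smul_mul_assoc]
        refine Submodule.smul_mem _ _ ?_
        have h := mul_mem_piece deg (ι_mem_piece (k := k) deg y) ih
        convert h using 2
        ring
  | zero => simp
  | add a b _ _ ha hb => rw [map_add]; exact Submodule.add_mem _ ha hb
  | smul c a _ ha => rw [map_smul]; exact Submodule.smul_mem _ _ ha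

end FreeDG

open FreeDG

variable {k} {X : Type w} (deg : X → ℤ) (r : FreeDG k X → FreeDG k X → Prop)

/-- The relations `r` together with their differentials. -/
inductive dgRel : FreeDG k X → FreeDG k X → Prop
  | base {a b : FreeDG k X} (h : r a b) : dgRel a b
  | diff {a b : FreeDG k X} (h : r a b) : dgRel (D deg a) (D deg b)

/-- The underlying algebra of the dg algebra with generators `X` and relations `r`: the quotient of
the free dg algebra on `X` by the two-sided dg ideal generated by `r`. -/
abbrev PresentCarrier : Type (max u w) := RingQuot (dgRel deg r)

/-- The quotient map. -/
def presentMk : FreeDG k X →ₐ[k] PresentCarrier deg r := RingQuot.mkAlgHom k (dgRel deg r)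

lemma presentMk_surjective : Function.Surjective (presentMk deg r) :=
  RingQuot.mkAlgHom_surjective k _

/-- The homogeneous components of the quotient. -/
def presentGr (n : ℤ) : Submodule k (PresentCarrier deg r) :=
  (piece deg n).map (presentMk deg r).toLinearMap

lemma presentMk_mem {n : ℤ} {a : FreeDG k X} (ha : a ∈ piece deg n) :
    presentMk deg r a ∈ presentGr deg r n := ⟨a, ha, rfl⟩

lemma presentMk_rel {a b : FreeDG k X} (h : dgRel deg r a b) :
    presentMk deg r a = presentMk deg r b := RingQuot.mkAlgHom_rel k h

instance presentGr_gradedMonoid : SetLike.GradedMonoid (presentGr deg r) where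
  one_mem := ⟨1, one_mem_piece deg, by simp⟩
  mul_mem := by
    rintro m n _ _ ⟨a, ha, rfl⟩ ⟨b, hb, rfl⟩
    exact ⟨a * b, mul_mem_piece deg ha hb, by simp⟩

/-- Auxiliary map for the decomposition into homogeneous components. -/
def presentDecFree : FreeDG k X →ₐ[k] DirectSum ℤ (fun n => presentGr deg r n) :=
  FreeAlgebra.lift k fun y => DirectSum.of (fun n => presentGr deg r n) (wt deg y)
    ⟨presentMk deg r (FreeAlgebra.ι k y), presentMk_mem deg r (ι_mem_piece deg y)⟩

lemma presentDecFree_of_mem {n : ℤ} {a : FreeDG k X} (ha : a ∈ piece deg n) :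
    presentDecFree deg r a = DirectSum.of (fun n => presentGr deg r n) n
      ⟨presentMk deg r a, presentMk_mem deg r ha⟩ := by
  induction ha using Submodule.span_induction with
  | mem a h =>
    obtain ⟨l, rfl, rfl⟩ := h
    induction l with
    | nil =>
      simp only [List.map_nil, List.prod_nil, map_one]
      rfl
    | cons y l ih =>
      simp only [List.map_cons, List.prod_cons, map_mul]
      rw [ih]
      simp only [presentDecFree, FreeAlgebra.lift_ι_apply]
      rw [DirectSum.of_mul_of]
      rfl
  | zero =>
    rw [map_zero]
    symm
    convert map_zero (DirectSum.of (fun n => presentGr deg r n) n)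
    simp
  | add a b ha' hb' ha hb =>
    rw [map_add, ha, hb, ← map_add]
    congr 1
    ext
    simp
  | smul c a ha' ha =>
    rw [map_smul, ha, ← DirectSum.lof_eq_of k, ← map_smul]
    refine congrArg _ (Subtype.ext ?_)
    simp

/-- All relations are homogeneous. -/
def HomogRel : Prop := ∀ a b, r a b → ∃ n, a ∈ piece deg n ∧ b ∈ piece deg n

variable {deg r}

lemma HomogRel.dg (hr : HomogRel deg r) {a b : FreeDG k X} (h : dgRel deg r a b) :
    ∃ n, a ∈ piece deg n ∧ b ∈ piece deg n := by
  rcases h with h | h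
  · exact hr _ _ h
  · obtain ⟨n, ha, hb⟩ := hr _ _ h
    exact ⟨n + 1, D_mem deg ha, D_mem deg hb⟩

/-- The grading of the quotient. -/
abbrev presentGraded (hr : HomogRel deg r) : GradedAlgebra (presentGr deg r) :=
  GradedAlgebra.ofAlgHom _
    (RingQuot.liftAlgHom k ⟨presentDecFree deg r, by
      intro a b h
      obtain ⟨n, ha, hb⟩ := hr.dg h
      rw [presentDecFree_of_mem deg r ha, presentDecFree_of_mem deg r hb]
      congr 1
      ext
      exact presentMk_rel deg r h⟩)
    (by
      apply RingQuot.ringQuot_ext'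
      apply FreeAlgebra.hom_ext
      funext y
      simp [presentDecFree]
      rfl)
    (by
      rintro n ⟨_, a, ha, rfl⟩
      have h1 : RingQuot.liftAlgHom k ⟨presentDecFree deg r, by
          intro a b h
          obtain ⟨n, ha, hb⟩ := hr.dg h
          rw [presentDecFree_of_mem deg r ha, presentDecFree_of_mem deg r hb]
          congr 1
          ext
          exact presentMk_rel deg r h⟩ (presentMk deg r a) = presentDecFree deg r a := by
        simp [presentMk]
      exact h1.trans (presentDecFree_of_mem deg r ha))

/-- Auxiliary algebra map encoding the differential of the quotient. -/
def presentDerMat (hr : HomogRel deg r) :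
    PresentCarrier deg r →ₐ[k] Matrix (Fin 2) (Fin 2) (PresentCarrier deg r) :=
  RingQuot.liftAlgHom k ⟨(presentMk deg r).mapMatrix.comp (derMat deg), by
    intro a b h
    have e1 : presentMk deg r a = presentMk deg r b := presentMk_rel deg r h
    have e2 : presentMk deg r (par deg a) = presentMk deg r (par deg b) := by
      obtain ⟨n, ha, hb⟩ := hr.dg h
      rw [par_of_mem deg ha, par_of_mem deg hb, map_smul, map_smul, e1]
    have e3 : presentMk deg r (D deg a) = presentMk deg r (D deg b) := by
      rcases h with h | h
      · exact presentMk_rel deg r (dgRel.diff h)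
      · rw [D_D, D_D]
    simp only [AlgHom.comp_apply, derMat_apply]
    ext i j
    fin_cases i <;> fin_cases j <;> simp [e1, e2, e3]⟩

/-- The differential of the quotient. -/
def presentD (hr : HomogRel deg r) : PresentCarrier deg r →ₗ[k] PresentCarrier deg r where
  toFun a := presentDerMat hr a 0 1
  map_add' := by simp
  map_smul' := by simp

lemma presentD_mk (hr : HomogRel deg r) (a : FreeDG k X) :
    presentD hr (presentMk deg r a) = presentMk deg r (D deg a) := by
  have h : presentDerMat hr (presentMk deg r a)
      = (presentMk deg r).mapMatrix (derMat deg a) := by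
    simp [presentDerMat, presentMk]
  change presentDerMat hr (presentMk deg r a) 0 1 = _
  rw [h, derMat_apply]
  simp

/-- The dg algebra generated by the symbols `x : X` (of degree `deg x`) and their differentials,
subject to the homogeneous relations `r` (and the consequences forced by the dg structure). -/
def present (hr : HomogRel deg r) : DGAlg.{u, max u w} k where
  carrier := PresentCarrier deg r
  gr := presentGr deg r
  graded := presentGraded hr
  d := presentD hr
  d_mem := by
    rintro n _ ⟨a, ha, rfl⟩
    exact ⟨D deg a, D_mem deg ha, (presentD_mk hr a).symm⟩
  d_d := by
    intro a
    obtain ⟨a, rfl⟩ := presentMk_surjective deg r a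
    rw [presentD_mk, presentD_mk, D_D, map_zero]
  leibniz := by
    rintro n _ ⟨a, ha, rfl⟩ b
    obtain ⟨b, rfl⟩ := presentMk_surjective deg r b
    simp only [AlgHom.toLinearMap_apply]
    rw [← map_mul, presentD_mk, presentD_mk, presentD_mk, D_mul, map_add, par_of_mem deg ha]
    simp

/-- The evaluation of formal expressions determined by an assignment of the generators. -/
def evalFree (A : DGAlg.{u, v} k) (φ : X → A.carrier) : FreeDG k X →ₐ[k] A.carrier :=
  FreeAlgebra.lift k (Sum.elim φ fun x => A.d (φ x))

lemma evalFree_gen (A : DGAlg.{u, v} k) (φ : X → A.carrier) (x : X) :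
    evalFree A φ (gen k x) = φ x := by simp [evalFree, gen]

lemma evalFree_dgen (A : DGAlg.{u, v} k) (φ : X → A.carrier) (x : X) :
    evalFree A φ (dgen k x) = A.d (φ x) := by simp [evalFree, dgen]

lemma d_one (A : DGAlg.{u, v} k) : A.d 1 = 0 := by
  have h := A.leibniz (SetLike.GradedOne.one_mem : (1 : A.carrier) ∈ A.gr 0) 1
  simpa using h

lemma evalFree_mem (A : DGAlg.{u, v} k) (φ : X → A.carrier) (hφ : ∀ x, φ x ∈ A.gr (deg x))
    {n : ℤ} {a : FreeDG k X} (ha : a ∈ piece deg n) : evalFree A φ a ∈ A.gr n := by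
  induction ha using Submodule.span_induction with
  | mem a h =>
    obtain ⟨l, rfl, rfl⟩ := h
    induction l with
    | nil =>
      simp only [List.map_nil, List.prod_nil, map_one, List.sum_nil]
      exact SetLike.GradedOne.one_mem
    | cons y l ih =>
      simp only [List.map_cons, List.prod_cons, map_mul, List.sum_cons]
      refine SetLike.GradedMul.mul_mem ?_ ih
      rcases y with x | x
      · exact (evalFree_gen A φ x).symm ▸ hφ x
      · exact (evalFree_dgen A φ x).symm ▸ A.d_mem (hφ x)
  | zero => simp
  | add a b _ _ ha hb => rw [map_add]; exact Submodule.add_mem _ ha hb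
  | smul c a _ ha => rw [map_smul]; exact Submodule.smul_mem _ _ ha

lemma evalFree_D (A : DGAlg.{u, v} k) (φ : X → A.carrier) (hφ : ∀ x, φ x ∈ A.gr (deg x))
    (a : FreeDG k X) : evalFree A φ (D deg a) = A.d (evalFree A φ a) := by
  have word : ∀ l : List (X ⊕ X), evalFree A φ (D deg (l.map (FreeAlgebra.ι k)).prod)
      = A.d (evalFree A φ (l.map (FreeAlgebra.ι k)).prod) := by
    intro l
    induction l with
    | nil => simp [D_one, d_one]
    | cons y l ih =>
      simp only [List.map_cons, List.prod_cons, map_mul, D_mul, map_add, ih]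
      rw [A.leibniz (evalFree_mem A φ hφ (ι_mem_piece deg y)), par_ι]
      rcases y with x | x
      · rw [D_ι]
        simp [evalFree, dgen]
      · rw [D_ι]
        simp [evalFree, A.d_d]
  have hspan : a ∈ Submodule.span k
      {a : FreeDG k X | ∃ l : List (X ⊕ X), a = (l.map (FreeAlgebra.ι k)).prod} := by
    induction a using FreeAlgebra.induction with
    | grade0 c =>
      rw [Algebra.algebraMap_eq_smul_one]
      exact Submodule.smul_mem _ _ (Submodule.subset_span ⟨[], rfl⟩)
    | grade1 y => exact Submodule.subset_span ⟨[y], by simp⟩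
    | mul a b ha hb =>
      have h := Submodule.mul_mem_mul ha hb
      rw [Submodule.span_mul_span] at h
      refine Submodule.span_mono ?_ h
      rintro _ ⟨_, ⟨l, rfl⟩, _, ⟨l', rfl⟩, rfl⟩
      exact ⟨l ++ l', by simp⟩
    | add a b ha hb => exact Submodule.add_mem _ ha hb
  induction hspan using Submodule.span_induction with
  | mem a h => obtain ⟨l, rfl⟩ := h; exact word l
  | zero => simp
  | add a b _ _ ha hb => simp [ha, hb]
  | smul c a _ ha => simp [ha]

/-- The universal property: an assignment of the generators respecting degrees and relations
extends to a morphism of dg algebras. -/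
def presentLift (hr : HomogRel deg r) (A : DGAlg.{u, v} k) (φ : X → A.carrier)
    (hφ : ∀ x, φ x ∈ A.gr (deg x))
    (hrel : ∀ a b, r a b → evalFree A φ a = evalFree A φ b) : DGHom (present hr) A :=
  have hrel' : ∀ ⦃a b⦄, dgRel deg r a b → evalFree A φ a = evalFree A φ b := by
    intro a b h
    rcases h with h | h
    · exact hrel _ _ h
    · rw [evalFree_D A φ hφ, evalFree_D A φ hφ, hrel _ _ h]
  have hmk : ∀ a, RingQuot.liftAlgHom k ⟨evalFree A φ, hrel'⟩ (presentMk deg r a)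
      = evalFree A φ a := by
    intro a
    simp [presentMk]
  { toAlgHom := RingQuot.liftAlgHom k ⟨evalFree A φ, hrel'⟩
    map_mem := by
      rintro n _ ⟨a, ha, rfl⟩
      exact (hmk a).symm ▸ evalFree_mem A φ hφ ha
    map_d := by
      intro a
      obtain ⟨a, rfl⟩ := presentMk_surjective deg r a
      change RingQuot.liftAlgHom k ⟨evalFree A φ, hrel'⟩ (presentD hr (presentMk deg r a)) = _
      rw [presentD_mk]
      exact (hmk _).trans ((evalFree_D A φ hφ a).trans (congrArg A.d (hmk a)).symm) }

lemma presentLift_mk (hr : HomogRel deg r) (A : DGAlg.{u, v} k) (φ : X → A.carrier)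
    (hφ : ∀ x, φ x ∈ A.gr (deg x))
    (hrel : ∀ a b, r a b → evalFree A φ a = evalFree A φ b) (a : FreeDG k X) :
    presentLift hr A φ hφ hrel (presentMk deg r a) = evalFree A φ a := by
  change RingQuot.liftAlgHom k _ (presentMk deg r a) = _
  simp [presentMk]

end Present

/-! ### Signed sums over lists -/

section Sums

variable {A : DGAlg.{u, v} k} {M : Type x} [AddCommGroup M] [Module k M]

/-- `∑ i, (-1)^{s_1 + ⋯ + s_{i-1}} F(a_1, …, d a_i, …, a_n)`, where `s_j = |a_j| - 1`. -/
def dSum : (List A.H → M) → List A.H → M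
  | _, [] => 0
  | F, a :: l => F (a.d :: l) + (-1 : k) ^ a.sdeg • dSum (fun t => F (a :: t)) l

/-- `∑ i < n, (-1)^{s_1 + ⋯ + s_i} F(a_1, …, a_i a_{i+1}, …, a_n)`, where `s_j = |a_j| - 1`. -/
def mulSum : (List A.H → M) → List A.H → M
  | _, [] => 0
  | _, [_] => 0
  | F, a :: b :: l => (-1 : k) ^ a.sdeg • F (a.mul b :: l)
      + (-1 : k) ^ a.sdeg • mulSum (fun t => F (a :: t)) (b :: l)

/-- The right-hand side of the formula for the differential of an operation `F (a_1, …, a_n)`,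
`n ≥ 1`, whose further argument `f` has degree `p`. Here `F₀` stands for the same operation applied
to `d f; a_1, …, a_n`, and `I a` for the element `a` itself:
`F₀ - ∑ i, (-1)^{p + s_1 + ⋯ + s_{i-1}} F(…, d a_i, …) + (-1)^{p s_1} a_1 F(a_2, …, a_n)
  + ∑ i < n, (-1)^{p + s_1 + ⋯ + s_i} F(…, a_i a_{i+1}, …)
  - (-1)^{p + s_1 + ⋯ + s_{n-1}} F(a_1, …, a_{n-1}) a_n`. -/
def diffFormula [Mul M] (p : ℤ) (F₀ : M) (F : List A.H → M) (I : A.H → M)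
    (l : List A.H) (hl : l ≠ []) : M :=
  F₀ - (-1 : k) ^ p • dSum F l
    + (-1 : k) ^ (p * (l.head hl).sdeg) • (I (l.head hl) * F l.tail)
    + (-1 : k) ^ p • mulSum F l
    - (-1 : k) ^ (p + H.sdegs l.dropLast) • (F l.dropLast * I (l.getLast hl))

/-- `∑ m ≤ n, (-1)^{q (s_1 + ⋯ + s_m)} F(a_1, …, a_m) G(a_{m+1}, …, a_n)`,
where `s_j = |a_j| - 1`. -/
def splitSum [Mul M] (q : ℤ) (F G : List A.H → M) (l : List A.H) : M :=
  ∑ m ∈ Finset.range (l.length + 1),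
    (-1 : k) ^ (q * H.sdegs (l.take m)) • (F (l.take m) * G (l.drop m))

/-- The sum, over all `0 ≤ i_1 ≤ j_1 ≤ i_2 ≤ j_2 ≤ ⋯ ≤ i_m ≤ j_m ≤ n`, of
`(-1)^ε F(z_1, …, z_{i_1}, y_1{z_{i_1+1}, …, z_{j_1}}, z_{j_1+1}, …, z_{i_m},
  y_m{z_{i_m+1}, …, z_{j_m}}, z_{j_m+1}, …, z_n)`
with `ε = ∑ p, (|y_p| - 1) ∑ q ≤ i_p, (|z_q| - 1)`. The arguments of `F` lie in `P`; `act y l`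
stands for `y{l}` and `inj z` for `z`. The outer sum below is over `i = i_1` and
`l = j_1 - i_1`. -/
def insertSum {D : DGAlg.{u, v} k} {E : DGAlg.{u, w} k} {P : DGAlg.{u, v'} k}
    (act : D.H → List E.H → P.H) (inj : E.H → P.H) :
    (List P.H → M) → List D.H → List E.H → M
  | F, [], zs => F (zs.map inj)
  | F, y :: ys, zs =>
      ∑ i ∈ Finset.range (zs.length + 1), ∑ l ∈ Finset.range (zs.length - i + 1),
        (-1 : k) ^ (y.sdeg * H.sdegs (zs.take i) + H.sdegs ys * H.sdegs (zs.take (i + l))) •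
          insertSum act inj
            (fun t => F ((zs.take i).map inj ++ act y ((zs.drop i).take l) :: t))
            ys (zs.drop (i + l))

lemma dSum_mem (p : ℤ → Submodule k M) (F : List A.H → M) (n : ℤ)
    (hF : ∀ l, F l ∈ p (n + H.sdegs l)) (l : List A.H) :
    dSum F l ∈ p (n + H.sdegs l + 1) := by
  induction l generalizing F n with
  | nil => simp [dSum]
  | cons a l ih =>
    refine Submodule.add_mem _ ?_ (Submodule.smul_mem _ _ ?_)
    · convert hF (a.d :: l) using 2
      simp [H.d]; ring
    · convert ih (fun t => F (a :: t)) (n + (a.1 - 1)) (fun t => ?_) using 2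
      · simp; ring
      · convert hF (a :: t) using 2
        simp; ring

lemma mulSum_mem (p : ℤ → Submodule k M) (F : List A.H → M) (n : ℤ)
    (hF : ∀ l, F l ∈ p (n + H.sdegs l)) (l : List A.H) :
    mulSum F l ∈ p (n + H.sdegs l + 1) := by
  induction l generalizing F n with
  | nil => simp [mulSum]
  | cons a l ih =>
    cases l with
    | nil => simp [mulSum]
    | cons b l =>
      refine Submodule.add_mem _ (Submodule.smul_mem _ _ ?_) (Submodule.smul_mem _ _ ?_)
      · convert hF (a.mul b :: l) using 2
        simp [H.mul]; ring
      · convert ih (fun t => F (a :: t)) (n + (a.1 - 1)) (fun t => ?_) using 2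
        · simp; ring
        · convert hF (a :: t) using 2
          simp; ring

variable {B : DGAlg.{u, v'} k} {N : Type w'} [AddCommGroup N] [Module k N]

lemma map_dSum (ψ : DGHom A B) (φ : M →ₗ[k] N) (F : List A.H → M) (G : List B.H → N)
    (h : ∀ l, φ (F l) = G (l.map ψ.mapH)) (l : List A.H) :
    φ (dSum F l) = dSum G (l.map ψ.mapH) := by
  induction l generalizing F G with
  | nil => simp [dSum]
  | cons a l ih =>
    simp only [dSum, List.map_cons, map_add, map_smul, h, DGHom.mapH_d]
    rw [ih (fun t => F (a :: t)) (fun t => G (ψ.mapH a :: t)) (fun t => by simp [h])]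
    rfl

lemma map_mulSum (ψ : DGHom A B) (φ : M →ₗ[k] N) (F : List A.H → M) (G : List B.H → N)
    (h : ∀ l, φ (F l) = G (l.map ψ.mapH)) (l : List A.H) :
    φ (mulSum F l) = mulSum G (l.map ψ.mapH) := by
  induction l generalizing F G with
  | nil => simp [mulSum]
  | cons a l ih =>
    cases l with
    | nil => simp [mulSum]
    | cons b l =>
      simp only [mulSum, List.map_cons, map_add, map_smul, h, DGHom.mapH_mul]
      rw [ih (fun t => F (a :: t)) (fun t => G (ψ.mapH a :: t)) (fun t => by simp [h])]
      rfl

end Sums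

/-! ### The twisted tensor product -/

section Twist

/-- The generators of the twisted tensor product of `C` and `D`: `right g` is `id ⊗ g`, and
`eps f [g_1, …, g_n]` is `ε(f; g_1, …, g_n)`, the `g`'s being listed in the order in which they are
written in a composition `g_1 g_2 ⋯ g_n`. For `n = 0` it is `f ⊗ id`. -/
inductive TwistGen (C : DGAlg.{u, v} k) (D : DGAlg.{u, w} k) : Type (max v w)
  | right (g : D.H) : TwistGen C D
  | eps (f : C.H) (gs : List D.H) : TwistGen C D

namespace TwistGen

variable {C : DGAlg.{u, v} k} {D : DGAlg.{u, w} k}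

/-- `|id ⊗ g| = |g|` and `|ε(f; g_1, …, g_n)| = -n + |f| + ∑ |g_j|`. -/
def deg : TwistGen C D → ℤ
  | right g => g.1
  | eps f gs => f.1 + H.sdegs gs

/-- `id ⊗ g` as a formal expression. -/
abbrev R (C : DGAlg.{u, v} k) (g : D.H) : FreeDG k (TwistGen C D) := FreeDG.gen k (right g)

/-- `ε(f; g_1, …, g_n)` as a formal expression. -/
abbrev E (f : C.H) (gs : List D.H) : FreeDG k (TwistGen C D) := FreeDG.gen k (eps f gs)

/-- `d (id ⊗ g)` as a formal expression. -/
abbrev dR (C : DGAlg.{u, v} k) (g : D.H) : FreeDG k (TwistGen C D) := FreeDG.dgen k (right g)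

/-- `d ε(f; g_1, …, g_n)` as a formal expression. -/
abbrev dE (f : C.H) (gs : List D.H) : FreeDG k (TwistGen C D) := FreeDG.dgen k (eps f gs)

end TwistGen

open TwistGen

/-- The relations of the twisted tensor product, including the formula for the differential. -/
inductive TwistRel (C : DGAlg.{u, v} k) (D : DGAlg.{u, w} k) :
    FreeDG k (TwistGen C D) → FreeDG k (TwistGen C D) → Prop
  | right_add (i : ℤ) (a b : D.gr i) : TwistRel C D (R C ⟨i, a + b⟩) (R C ⟨i, a⟩ + R C ⟨i, b⟩)
  | right_smul (c : k) (i : ℤ) (a : D.gr i) : TwistRel C D (R C ⟨i, c • a⟩) (c • R C ⟨i, a⟩)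
  | right_one : TwistRel C D (R C (H.one D)) 1
  | right_mul (g g' : D.H) : TwistRel C D (R C (g.mul g')) (R C g * R C g')
  | eps_add (i : ℤ) (a b : C.gr i) (gs : List D.H) :
      TwistRel C D (E ⟨i, a + b⟩ gs) (E ⟨i, a⟩ gs + E ⟨i, b⟩ gs)
  | eps_smul (c : k) (i : ℤ) (a : C.gr i) (gs : List D.H) :
      TwistRel C D (E ⟨i, c • a⟩ gs) (c • E ⟨i, a⟩ gs)
  | eps_arg_add (f : C.H) (l r : List D.H) (i : ℤ) (a b : D.gr i) :
      TwistRel C D (E f (l ++ ⟨i, a + b⟩ :: r)) (E f (l ++ ⟨i, a⟩ :: r) + E f (l ++ ⟨i, b⟩ :: r))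
  | eps_arg_smul (f : C.H) (l r : List D.H) (c : k) (i : ℤ) (a : D.gr i) :
      TwistRel C D (E f (l ++ ⟨i, c • a⟩ :: r)) (c • E f (l ++ ⟨i, a⟩ :: r))
  | eps_one : TwistRel C D (E (H.one C) []) 1
  | eps_one_left (gs : List D.H) (h : gs ≠ []) : TwistRel C D (E (H.one C) gs) 0
  | eps_one_arg (f : C.H) (l r : List D.H) : TwistRel C D (E f (l ++ H.one D :: r)) 0
  | eps_mul (f f' : C.H) (gs : List D.H) :
      TwistRel C D (E (f.mul f') gs) (splitSum f'.1 (E f) (E f') gs)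
  | d_right (g : D.H) : TwistRel C D (dR C g) (R C g.d)
  | d_eps_nil (f : C.H) : TwistRel C D (dE f []) (E f.d [])
  | d_eps (f : C.H) (gs : List D.H) (h : gs ≠ []) :
      TwistRel C D (dE f gs) (diffFormula f.1 (E f.d gs) (E f) (R C) gs h)

lemma E_mem {C : DGAlg.{u, v} k} {D : DGAlg.{u, w} k} (f : C.H) (gs : List D.H) {n : ℤ}
    (h : f.1 + H.sdegs gs = n) : E f gs ∈ FreeDG.piece TwistGen.deg n :=
  h ▸ FreeDG.gen_mem TwistGen.deg (eps f gs)

lemma R_mem {C : DGAlg.{u, v} k} {D : DGAlg.{u, w} k} (g : D.H) {n : ℤ}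
    (h : g.1 = n) : R C g ∈ FreeDG.piece TwistGen.deg n :=
  h ▸ FreeDG.gen_mem TwistGen.deg (right g)

lemma twistRel_homog (C : DGAlg.{u, v} k) (D : DGAlg.{u, w} k) :
    HomogRel TwistGen.deg (TwistRel C D) := by
  intro a b h
  cases h with
  | right_add i a b => exact ⟨i, R_mem _ rfl, add_mem (R_mem _ rfl) (R_mem _ rfl)⟩
  | right_smul c i a => exact ⟨i, R_mem _ rfl, Submodule.smul_mem _ _ (R_mem _ rfl)⟩
  | right_one => exact ⟨0, R_mem _ rfl, FreeDG.one_mem_piece _⟩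
  | right_mul g g' =>
    exact ⟨g.1 + g'.1, R_mem _ rfl, FreeDG.mul_mem_piece _ (R_mem _ rfl) (R_mem _ rfl)⟩
  | eps_add i a b gs => exact ⟨i + H.sdegs gs, E_mem _ _ rfl, add_mem (E_mem _ _ rfl) (E_mem _ _ rfl)⟩
  | eps_smul c i a gs =>
    exact ⟨i + H.sdegs gs, E_mem _ _ rfl, Submodule.smul_mem _ _ (E_mem _ _ rfl)⟩
  | eps_arg_add f l r i a b =>
    refine ⟨f.1 + (H.sdegs l + (i - 1 + H.sdegs r)), E_mem _ _ ?_,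
      add_mem (E_mem _ _ ?_) (E_mem _ _ ?_)⟩ <;> simp
  | eps_arg_smul f l r c i a =>
    refine ⟨f.1 + (H.sdegs l + (i - 1 + H.sdegs r)), E_mem _ _ ?_,
      Submodule.smul_mem _ _ (E_mem _ _ ?_)⟩ <;> simp
  | eps_one => exact ⟨0, E_mem _ _ rfl, FreeDG.one_mem_piece _⟩
  | eps_one_left gs h => exact ⟨_, E_mem _ _ rfl, zero_mem _⟩
  | eps_one_arg f l r => exact ⟨_, E_mem _ _ rfl, zero_mem _⟩
  | eps_mul f f' gs =>
    refine ⟨f.1 + f'.1 + H.sdegs gs, E_mem _ _ rfl, Submodule.sum_mem _ fun m _ =>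
      Submodule.smul_mem _ _ ?_⟩
    convert FreeDG.mul_mem_piece _ (E_mem f (gs.take m) rfl) (E_mem f' (gs.drop m) rfl) using 2
    have h := H.sdegs_append (gs.take m) (gs.drop m)
    rw [List.take_append_drop] at h
    rw [h]; ring
  | d_right g => exact ⟨g.1 + 1, FreeDG.dgen_mem TwistGen.deg (right g), R_mem _ rfl⟩
  | d_eps_nil f =>
    exact ⟨f.1 + 0 + 1, FreeDG.dgen_mem TwistGen.deg (eps f []), E_mem _ _ (by simp [H.d])⟩
  | d_eps f gs h =>
    refine ⟨f.1 + H.sdegs gs + 1, FreeDG.dgen_mem TwistGen.deg (eps f gs), ?_⟩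
    refine sub_mem (add_mem (add_mem (sub_mem (E_mem _ _ ?_) (Submodule.smul_mem _ _ ?_))
      (Submodule.smul_mem _ _ ?_)) (Submodule.smul_mem _ _ ?_)) (Submodule.smul_mem _ _ ?_)
    · simp [H.d]; ring
    · exact dSum_mem _ _ _ (fun l => E_mem _ _ rfl) gs
    · convert FreeDG.mul_mem_piece _ (R_mem (gs.head h) rfl) (E_mem f gs.tail rfl) using 2
      have e := congrArg H.sdegs (List.cons_head_tail h)
      rw [H.sdegs_cons] at e
      rw [← e]; ring
    · exact mulSum_mem _ _ _ (fun l => E_mem _ _ rfl) gs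
    · convert FreeDG.mul_mem_piece _ (E_mem f gs.dropLast rfl) (R_mem (gs.getLast h) rfl) using 2
      have e := congrArg H.sdegs (List.dropLast_append_getLast h)
      simp only [H.sdegs_append, H.sdegs_cons, H.sdegs_nil] at e
      rw [← e]; ring

/-- The twisted tensor product of the dg algebras (one-object dg categories) `C` and `D`. -/
def twist (C : DGAlg.{u, v} k) (D : DGAlg.{u, w} k) : DGAlg.{u, max u v w} k :=
  present (twistRel_homog C D)

variable {C : DGAlg.{u, v} k} {D : DGAlg.{u, w} k}

/-- A formal expression as an element of the twisted tensor product. -/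
def twistMk : FreeDG k (TwistGen C D) →ₐ[k] (twist C D).carrier :=
  presentMk TwistGen.deg (TwistRel C D)

/-- The homogeneous element `ε(f; g_1, …, g_n)` (`f ⊗ id` for `n = 0`) of the twisted tensor
product. -/
def eps (f : C.H) (gs : List D.H) : (twist C D).H :=
  ⟨f.1 + H.sdegs gs, twistMk (E f gs), presentMk_mem _ _ (E_mem f gs rfl)⟩

/-- The homogeneous element `id ⊗ g` of the twisted tensor product of `C` and `D`. -/
def idTensor (C : DGAlg.{u, v} k) (g : D.H) : (twist C D).H :=
  ⟨g.1, twistMk (R C g), presentMk_mem _ _ (R_mem g rfl)⟩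

lemma twistMk_rel {a b : FreeDG k (TwistGen C D)} (h : TwistRel C D a b) :
    twistMk a = twistMk b := presentMk_rel _ _ (dgRel.base h)

lemma twistMk_D (a : FreeDG k (TwistGen C D)) :
    (twist C D).d (twistMk a) = twistMk (FreeDG.D TwistGen.deg a) :=
  presentD_mk (twistRel_homog C D) a

variable {C' : DGAlg.{u, v'} k} {D' : DGAlg.{u, w'} k}

/-- The images of the generators under `φ ⊗ ψ`. -/
def twistMapGen (φ : DGHom C C') (ψ : DGHom D D') : TwistGen C D → (twist C' D').carrier
  | right g => (idTensor C' (ψ.mapH g)).val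
  | TwistGen.eps f gs => (eps (φ.mapH f) (gs.map ψ.mapH)).val

lemma evalFree_R (φ : DGHom C C') (ψ : DGHom D D') (g : D.H) :
    evalFree (twist C' D') (twistMapGen φ ψ) (R C g) = twistMk (R C' (ψ.mapH g)) :=
  evalFree_gen _ _ _

lemma evalFree_E (φ : DGHom C C') (ψ : DGHom D D') (f : C.H) (gs : List D.H) :
    evalFree (twist C' D') (twistMapGen φ ψ) (E f gs)
      = twistMk (E (φ.mapH f) (gs.map ψ.mapH)) :=
  evalFree_gen _ _ _

lemma evalFree_dR (φ : DGHom C C') (ψ : DGHom D D') (g : D.H) :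
    evalFree (twist C' D') (twistMapGen φ ψ) (dR C g) = twistMk (dR C' (ψ.mapH g)) :=
  (evalFree_dgen _ _ _).trans ((twistMk_D _).trans (by rw [FreeDG.D_gen]))

lemma evalFree_dE (φ : DGHom C C') (ψ : DGHom D D') (f : C.H) (gs : List D.H) :
    evalFree (twist C' D') (twistMapGen φ ψ) (dE f gs)
      = twistMk (dE (φ.mapH f) (gs.map ψ.mapH)) :=
  (evalFree_dgen _ _ _).trans ((twistMk_D _).trans (by rw [FreeDG.D_gen]))

lemma twistMap_rel (φ : DGHom C C') (ψ : DGHom D D') (a b : FreeDG k (TwistGen C D))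
    (h : TwistRel C D a b) :
    evalFree (twist C' D') (twistMapGen φ ψ) a = evalFree (twist C' D') (twistMapGen φ ψ) b := by
  cases h with
  | right_add i a b =>
    simp only [map_add, evalFree_R, DGHom.mapH_mk]
    rw [twistMk_rel (TwistRel.right_add _ _ _), map_add]
  | right_smul c i a =>
    simp only [map_smul, evalFree_R, DGHom.mapH_mk]
    rw [twistMk_rel (TwistRel.right_smul _ _ _), map_smul]
  | right_one =>
    rw [evalFree_R, DGHom.mapH_one, twistMk_rel TwistRel.right_one, map_one, map_one]
  | right_mul g g' =>
    rw [map_mul, evalFree_R, evalFree_R, evalFree_R, DGHom.mapH_mul,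
      twistMk_rel (TwistRel.right_mul _ _), map_mul]
  | eps_add i a b gs =>
    simp only [map_add, evalFree_E, DGHom.mapH_mk]
    rw [twistMk_rel (TwistRel.eps_add _ _ _ _), map_add]
  | eps_smul c i a gs =>
    simp only [map_smul, evalFree_E, DGHom.mapH_mk]
    rw [twistMk_rel (TwistRel.eps_smul _ _ _ _), map_smul]
  | eps_arg_add f l r i a b =>
    simp only [map_add, evalFree_E, List.map_append, List.map_cons, DGHom.mapH_mk]
    rw [twistMk_rel (TwistRel.eps_arg_add _ _ _ _ _ _), map_add]
  | eps_arg_smul f l r c i a =>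
    simp only [map_smul, evalFree_E, List.map_append, List.map_cons, DGHom.mapH_mk]
    rw [twistMk_rel (TwistRel.eps_arg_smul _ _ _ _ _ _), map_smul]
  | eps_one =>
    rw [evalFree_E, DGHom.mapH_one, List.map_nil, twistMk_rel TwistRel.eps_one, map_one, map_one]
  | eps_one_left gs h =>
    rw [evalFree_E, DGHom.mapH_one, twistMk_rel (TwistRel.eps_one_left _ (by simpa using h)),
      map_zero, map_zero]
  | eps_one_arg f l r =>
    rw [evalFree_E, List.map_append, List.map_cons, DGHom.mapH_one,
      twistMk_rel (TwistRel.eps_one_arg _ _ _), map_zero, map_zero]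
  | eps_mul f f' gs =>
    rw [evalFree_E, DGHom.mapH_mul, twistMk_rel (TwistRel.eps_mul _ _ _)]
    simp only [splitSum, map_sum, map_smul, map_mul, evalFree_E, List.length_map, List.map_take,
      List.map_drop]
    refine Finset.sum_congr rfl fun m _ => ?_
    rw [← List.map_take, DGHom.sdegs_mapH]
    rfl
  | d_right g =>
    rw [evalFree_dR, evalFree_R, twistMk_rel (TwistRel.d_right _), DGHom.mapH_d]
  | d_eps_nil f =>
    rw [evalFree_dE, evalFree_E, List.map_nil, twistMk_rel (TwistRel.d_eps_nil _), DGHom.mapH_d]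
  | d_eps f gs h =>
    have h' : gs.map ψ.mapH ≠ [] := by simpa using h
    have hF : ∀ l, (evalFree (twist C' D') (twistMapGen φ ψ)).toLinearMap (E f l)
        = (twistMk (E (φ.mapH f) (l.map ψ.mapH)) : (twist C' D').carrier) :=
      fun l => evalFree_E φ ψ f l
    have h1 := map_dSum ψ _ (E f) (fun l => twistMk (E (φ.mapH f) l)) hF gs
    have h2 := map_mulSum ψ _ (E f) (fun l => twistMk (E (φ.mapH f) l)) hF gs
    have hidl : ∀ l : List D'.H, (twistMk (C := C') (D := D')).toLinearMap (E (φ.mapH f) l)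
        = twistMk (E (φ.mapH f) (l.map (DGHom.id D').mapH)) := by
      intro l
      rw [show l.map (DGHom.id D').mapH = l from List.map_id l]
      rfl
    have h3 := map_dSum (DGHom.id D') (twistMk (C := C') (D := D')).toLinearMap
      (E (φ.mapH f)) (fun l => twistMk (E (φ.mapH f) l))
      hidl (gs.map ψ.mapH)
    have h4 := map_mulSum (DGHom.id D') (twistMk (C := C') (D := D')).toLinearMap
      (E (φ.mapH f)) (fun l => twistMk (E (φ.mapH f) l))
      hidl (gs.map ψ.mapH)
    have hid : (gs.map ψ.mapH).map (DGHom.id D').mapH = gs.map ψ.mapH := List.map_id _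
    rw [hid] at h3 h4
    simp only [AlgHom.toLinearMap_apply] at h1 h2 h3 h4
    rw [evalFree_dE, twistMk_rel (TwistRel.d_eps _ _ h')]
    simp only [diffFormula, map_add, map_sub, map_smul, map_mul, h1, h2, h3, h4, evalFree_E,
      evalFree_R, DGHom.mapH_d, List.head_map, List.getLast_map, List.map_tail,
      List.map_dropLast]
    rw [← List.map_dropLast, DGHom.sdegs_mapH]
    rfl

/-- Functoriality of the twisted tensor product: the morphism `φ ⊗ ψ`, sending
`ε(f; g_1, …, g_n)` to `ε(φ f; ψ g_1, …, ψ g_n)` and `id ⊗ g` to `id ⊗ ψ g`. -/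
def twistMap (φ : DGHom C C') (ψ : DGHom D D') : DGHom (twist C D) (twist C' D') :=
  presentLift (twistRel_homog C D) (twist C' D') (twistMapGen φ ψ)
    (by
      rintro (g | ⟨f, gs⟩)
      · exact (idTensor C' (ψ.mapH g)).2.2
      · have h := (eps (φ.mapH f) (gs.map ψ.mapH)).2.2
        have e : (eps (φ.mapH f) (gs.map ψ.mapH)).1 = f.1 + H.sdegs gs := by
          change f.1 + H.sdegs (gs.map ψ.mapH) = _
          rw [DGHom.sdegs_mapH]
        have e' : ∀ {m n : ℤ} {a : (twist C' D').carrier}, a ∈ (twist C' D').gr m → m = n →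
            a ∈ (twist C' D').gr n := fun ha hmn => hmn ▸ ha
        exact e' h e)
    (twistMap_rel φ ψ)

lemma twistMap_eps (φ : DGHom C C') (ψ : DGHom D D') (f : C.H) (gs : List D.H) :
    twistMap φ ψ (eps f gs).val = (eps (φ.mapH f) (gs.map ψ.mapH)).val :=
  (presentLift_mk _ _ _ _ _ _).trans (evalFree_gen _ _ _)

lemma twistMap_idTensor (φ : DGHom C C') (ψ : DGHom D D') (g : D.H) :
    twistMap φ ψ (idTensor C g).val = (idTensor C' (ψ.mapH g)).val :=
  (presentLift_mk _ _ _ _ _ _).trans (evalFree_gen _ _ _)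

/-! ### The associator, monoids, and brace algebras -/

/-- `α` is the associator of the skew-monoidal structure given by the twisted tensor product: it is
the morphism with the prescribed values on the algebra generators. -/
structure IsAssociator (C : DGAlg.{u, v} k) (D : DGAlg.{u, w} k) (E : DGAlg.{u, x} k)
    (α : DGHom (twist (twist C D) E) (twist C (twist D E))) : Prop where
  /-- `α(ε(ε(f; g_1, …, g_m); h_1, …, h_n)) = ∑ ± ε(f; h_1, …, ε(g_1; h_{i_1+1}, …), …)`; this
  includes the values on `(f ⊗ id) ⊗ id`, on `ε(f; g_1, …, g_m) ⊗ id` and on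
  `ε(f ⊗ id; h_1, …, h_n)`. -/
  eps_eps (f : C.H) (gs : List D.H) (hs : List E.H) :
    α (eps (eps f gs) hs).val = insertSum (D := D) (E := E) (P := twist D E)
      (fun g l => eps g l) (fun h => idTensor D h)
      (fun l => (eps f l).val) gs hs
  /-- `α(ε(id ⊗ g; h_1, …, h_n)) = id ⊗ ε(g; h_1, …, h_n)`. -/
  eps_idTensor (g : D.H) (hs : List E.H) :
    α (eps (idTensor C g) hs).val = (idTensor C (eps g hs)).val
  /-- `α((id ⊗ id) ⊗ h) = id ⊗ (id ⊗ h)`. -/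
  idTensor (h : E.H) :
    α (idTensor (twist C D) h).val = (idTensor C (idTensor D h)).val

/-- `m` makes the dg algebra `B` a monoid for the twisted tensor product, with the unit of `B` as
its unit. -/
structure IsTwistedMonoid (B : DGAlg.{u, v} k) (m : DGHom (twist B B) B) : Prop where
  /-- `m ∘ (m ⊗ id) = m ∘ (id ⊗ m) ∘ α`, where `α` is the associator. -/
  assoc : ∃ α : DGHom (twist (twist B B) B) (twist B (twist B B)), IsAssociator B B B α ∧
    m.comp (twistMap m (DGHom.id B)) = (m.comp (twistMap (DGHom.id B) m)).comp α
  /-- `m(b ⊗ 1) = b`. -/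
  mul_one (b : B.H) : m (eps b []).val = b.val
  /-- `m(1 ⊗ b) = b`. -/
  one_mul (b : B.H) : m (idTensor B b).val = b.val

/-- A family of multilinear operations `x{y_1, …, y_n}`, `n ≥ 0`, on `B`, of degree `-n`. -/
@[ext] structure BraceOps (B : DGAlg.{u, v} k) where
  op : B.H → List B.H → B.carrier
  op_mem : ∀ (x : B.H) (ys : List B.H), op x ys ∈ B.gr (x.1 + H.sdegs ys)
  op_add : ∀ (i : ℤ) (a b : B.gr i) (ys : List B.H),
    op ⟨i, a + b⟩ ys = op ⟨i, a⟩ ys + op ⟨i, b⟩ ys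
  op_smul : ∀ (c : k) (i : ℤ) (a : B.gr i) (ys : List B.H), op ⟨i, c • a⟩ ys = c • op ⟨i, a⟩ ys
  op_arg_add : ∀ (x : B.H) (l r : List B.H) (i : ℤ) (a b : B.gr i),
    op x (l ++ ⟨i, a + b⟩ :: r) = op x (l ++ ⟨i, a⟩ :: r) + op x (l ++ ⟨i, b⟩ :: r)
  op_arg_smul : ∀ (x : B.H) (l r : List B.H) (c : k) (i : ℤ) (a : B.gr i),
    op x (l ++ ⟨i, c • a⟩ :: r) = c • op x (l ++ ⟨i, a⟩ :: r)

/-- `x{y_1, …, y_n}` as a homogeneous element. -/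
def BraceOps.opH {B : DGAlg.{u, v} k} (br : BraceOps B) (x : B.H) (ys : List B.H) : B.H :=
  ⟨x.1 + H.sdegs ys, br.op x ys, br.op_mem x ys⟩

/-- The operations `br` make the dg algebra `B` a unital brace algebra, with cup product the product
of `B` (which is associative and has unit `1`) and with no higher operations `p_n`, `n ≥ 3`. -/
structure IsUnitalBrace (B : DGAlg.{u, v} k) (br : BraceOps B) : Prop where
  /-- `x{} = x`. -/
  brace_nil (x : B.H) : br.op x [] = x.val
  /-- `(x x'){y_1, …, y_n} = ∑ ± x{y_1, …, y_m} x'{y_{m+1}, …, y_n}`. -/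
  mul_brace (x x' : B.H) (ys : List B.H) :
    br.op (x.mul x') ys = splitSum x'.1 (br.op x) (br.op x') ys
  /-- `x{y_1, …, y_m}{z_1, …, z_n} = ∑ ± x{z_1, …, y_1{z_{i_1+1}, …, z_{j_1}}, …}`. -/
  brace_brace (x : B.H) (ys zs : List B.H) :
    br.op (br.opH x ys) zs = insertSum br.opH (fun z => z) (br.op x) ys zs
  /-- The compatibility of the braces with the differential and the product. -/
  d_brace (x : B.H) (ys : List B.H) (h : ys ≠ []) :
    B.d (br.op x ys) = diffFormula x.1 (br.op x.d ys) (br.op x) H.val ys h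
  /-- `1{y_1, …, y_n} = 0` for `n ≥ 1`. -/
  one_brace (ys : List B.H) (h : ys ≠ []) : br.op (H.one B) ys = 0
  /-- `x{…, 1, …} = 0`. -/
  brace_one (x : B.H) (l r : List B.H) : br.op x (l ++ H.one B :: r) = 0

end Twist

end DGAlg

end

/-! A dg algebra map out of a twisted tensor product is an assignment of its generators that
respects the relations. For a map `m` from `twist B B` to `B` with `m(id ⊗ b) = b`, write `b{b_1, …,
b_n}` for the value on `ε(b; b_1, …, b_n)`. The relations then become the axioms of a unital brace
algebra, all except the formula for iterated braces. That formula is the associativity of `m`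
evaluated at `ε(ε(x; ys); zs)`. This gives `IsTwistedMonoid.isUnitalBrace` in one direction and
`braceGen_rel`, `braceMul` in the other.

Two points need work. First, associativity is an equation of maps on `(B ⊗ B) ⊗ B`, whose generators
`ε(F; zs)` involve an arbitrary `F` in `B ⊗ B`. The relation for `ε(FF'; …)` and the formula for `d
ε(F; …)` propagate an equality of two maps from `F` and `F'` to products and differentials, so that
checking generators `F` suffices (`twist_twist_hom_ext`). This also shows that there is at most one
associator.

Second, the associator must exist, and this is the bulk of the proof. Fix `C`, `D`, `E` and put `T =
C ⊗ (D ⊗ E)`. A candidate `α` is encoded by `F ↦ (hs ↦ α(ε(F; hs)))`, a map from `C ⊗ D` to cochains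
on words in `E[1]` with values in `T`. The relations of `(C ⊗ D) ⊗ E` say that this map is
multiplicative for the cup product, takes values in normalized multilinear cochains, and intertwines
`d` with the Hochschild differential `Coch.δ` of the `E`-bimodule `T`. Such a map on `C ⊗ D` is in
turn given on generators: `id ⊗ g` goes to `hs ↦ id ⊗ ε(g; hs)`, and `ε(f; gs)` goes to the signed
sum over insertions (`rightCoch`, `epsCoch`).

The relations of `C ⊗ D` for these cochains follow from properties of the insertion operator `ins`.
Dually, insertion is a map from the tensor product of the bar coalgebras of `D` and `E` to the bar
coalgebra of `D ⊗ E`. It is compatible with deconcatenation (`ins_splitAll`), which gives the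
relation for `ε(ff'; …)`, and with the bar differentials (`ins_barD`), which gives the formula for
the differential. -/

noncomputable section

namespace DGAlg

variable {k : Type u} [Field k]

/-! ### Homogeneous elements, linear extension, parity automorphisms -/

section Basics

variable {A : DGAlg.{u, v} k} {M : Type x} [AddCommGroup M] [Module k M]

lemma H.val_mem (a : A.H) : a.val ∈ A.gr a.1 := a.2.2

/-- The degree is part of the data of an element of `A.H`, so the zeros of different degrees are
distinct and both components must be compared. -/
lemma H.ext' {a b : A.H} (h : a.1 = b.1) (h' : a.val = b.val) : a = b := by
  obtain ⟨i, a, ha⟩ := a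
  obtain ⟨j, b, hb⟩ := b
  obtain rfl : i = j := h
  obtain rfl : a = b := h'
  rfl

lemma H.val_mul (a b : A.H) : (a.mul b).val = a.val * b.val := rfl

lemma H.val_d (a : A.H) : a.d.val = A.d a.val := rfl

lemma H.val_one : (H.one A).val = 1 := rfl

lemma H.val_mk {i : ℤ} (a : A.gr i) : H.val (⟨i, a⟩ : A.H) = a := rfl

/-- A function on homogeneous elements which is linear in each degree. -/
def IsLinearH (Θ : A.H → M) : Prop :=
  ∀ (c : k) {i : ℤ} (a b : A.gr i), Θ ⟨i, c • a + b⟩ = c • Θ ⟨i, a⟩ + Θ ⟨i, b⟩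

lemma IsLinearH.map_zero {Θ : A.H → M} (h : IsLinearH Θ) (i : ℤ) : Θ ⟨i, 0⟩ = 0 := by
  have := h 1 (0 : A.gr i) 0
  simpa using this

/-- The restriction to a homogeneous component. -/
def IsLinearH.toLin {Θ : A.H → M} (h : IsLinearH Θ) (i : ℤ) : A.gr i →ₗ[k] M where
  toFun a := Θ ⟨i, a⟩
  map_add' a b := by simpa using h 1 a b
  map_smul' c a := by simpa [h.map_zero] using h c a 0

/-- The linear map with prescribed values on homogeneous elements. -/
def linExt {Θ : A.H → M} (h : IsLinearH Θ) : A.carrier →ₗ[k] M :=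
  DirectSum.toModule k ℤ M h.toLin ∘ₗ (DirectSum.decomposeLinearEquiv A.gr).toLinearMap

lemma linExt_val {Θ : A.H → M} (h : IsLinearH Θ) (a : A.H) : linExt h a.val = Θ a := by
  obtain ⟨i, a⟩ := a
  simp [linExt, H.val]
  rfl

lemma hom_induction {p : A.carrier → Prop} (h0 : p 0) (hH : ∀ a : A.H, p a.val)
    (hadd : ∀ a b, p a → p b → p (a + b)) (a : A.carrier) : p a :=
  DirectSum.Decomposition.inductionOn A.gr h0 (fun {i} m => hH ⟨i, m⟩) (fun m m' => hadd m m') a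

/-- The algebra map with prescribed values on homogeneous elements. -/
def algExt {S : Type x} [Ring S] [Algebra k S] {Θ : A.H → S} (h : IsLinearH Θ)
    (h1 : Θ (H.one A) = 1) (hm : ∀ a b : A.H, Θ (a.mul b) = Θ a * Θ b) : A.carrier →ₐ[k] S :=
  AlgHom.ofLinearMap (linExt h) ((linExt_val h _).trans h1) (by
    intro a b
    induction a using hom_induction with
    | h0 => simp
    | hadd a a' ha ha' => simp [add_mul, ha, ha']
    | hH a =>
      induction b using hom_induction with
      | h0 => simp
      | hadd b b' hb hb' => simp [mul_add, hb, hb']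
      | hH b => rw [← H.val_mul, linExt_val, linExt_val, linExt_val, hm])

lemma algExt_val {S : Type x} [Ring S] [Algebra k S] {Θ : A.H → S} (h : IsLinearH Θ)
    (h1 : Θ (H.one A) = 1) (hm : ∀ a b : A.H, Θ (a.mul b) = Θ a * Θ b) (a : A.H) :
    algExt h h1 hm a.val = Θ a := linExt_val h a

/-- The automorphism acting on the component of degree `i` by `(-1)^{n i}`. -/
def parity (A : DGAlg.{u, v} k) (n : ℤ) : A.carrier →ₐ[k] A.carrier :=
  algExt (Θ := fun a => (-1 : k) ^ (n * a.1) • a.val)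
    (by
      intro c i a b
      simp [H.val_mk, smul_comm c])
    (by simp [H.one, H.val_mk])
    (by
      intro a b
      rw [H.val_mul, smul_mul_smul_comm, ← zpow_add₀ (by simp), ← mul_add]
      rfl)

lemma parity_of_mem {n i : ℤ} {a : A.carrier} (h : a ∈ A.gr i) :
    A.parity n a = (-1 : k) ^ (n * i) • a :=
  algExt_val _ _ _ (⟨i, a, h⟩ : A.H)

lemma parity_parity (m n : ℤ) (a : A.carrier) :
    A.parity m (A.parity n a) = A.parity (m + n) a := by
  induction a using hom_induction with
  | h0 => simp
  | hadd a b ha hb => simp [ha, hb]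
  | hH a =>
    rw [parity_of_mem a.val_mem, parity_of_mem a.val_mem, map_smul, parity_of_mem a.val_mem,
      smul_smul, ← zpow_add₀ (by simp)]
    congr 2
    ring

lemma parity_zero (a : A.carrier) : A.parity 0 a = a := by
  induction a using hom_induction with
  | h0 => simp
  | hadd a b ha hb => simp [ha, hb]
  | hH a => simp [parity_of_mem a.val_mem]

end Basics

/-! ### The relations of the twisted tensor product, read in the quotient -/

section TwistBasics

variable {C : DGAlg.{u, v} k} {D : DGAlg.{u, w} k}

lemma eps_deg (f : C.H) (gs : List D.H) : (eps f gs).1 = f.1 + H.sdegs gs := rfl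

lemma idTensor_deg (g : D.H) : (idTensor C g).1 = g.1 := rfl

lemma eps_val (f : C.H) (gs : List D.H) : (eps f gs).val = twistMk (TwistGen.E f gs) := rfl

lemma idTensor_val (g : D.H) : (idTensor C g).val = twistMk (TwistGen.R C g) := rfl

lemma eps_lin (c : k) {i : ℤ} (a b : C.gr i) (gs : List D.H) :
    (eps ⟨i, c • a + b⟩ gs).val = c • (eps ⟨i, a⟩ gs).val + (eps ⟨i, b⟩ gs).val := by
  simp only [eps_val]
  rw [twistMk_rel (TwistRel.eps_add _ _ _ _), map_add, twistMk_rel (TwistRel.eps_smul _ _ _ _),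
    map_smul]

lemma eps_arg_lin (f : C.H) (l r : List D.H) (c : k) {i : ℤ} (a b : D.gr i) :
    (eps f (l ++ ⟨i, c • a + b⟩ :: r)).val
      = c • (eps f (l ++ ⟨i, a⟩ :: r)).val + (eps f (l ++ ⟨i, b⟩ :: r)).val := by
  simp only [eps_val]
  rw [twistMk_rel (TwistRel.eps_arg_add _ _ _ _ _ _), map_add,
    twistMk_rel (TwistRel.eps_arg_smul _ _ _ _ _ _), map_smul]

lemma eps_one_nil : (eps (H.one C) ([] : List D.H)).val = 1 := by
  rw [eps_val, twistMk_rel TwistRel.eps_one, map_one]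

lemma eps_one_of_ne {gs : List D.H} (h : gs ≠ []) : (eps (H.one C) gs).val = 0 := by
  rw [eps_val, twistMk_rel (TwistRel.eps_one_left _ h), map_zero]

lemma eps_one_arg (f : C.H) (l r : List D.H) : (eps f (l ++ H.one D :: r)).val = 0 := by
  rw [eps_val, twistMk_rel (TwistRel.eps_one_arg _ _ _), map_zero]

lemma map_splitSum {A : DGAlg.{u, v} k} {M : Type*} {N : Type*} [Ring M] [Algebra k M] [Ring N]
    [Algebra k N] (φ : M →ₐ[k] N) (q : ℤ) (F G : List A.H → M) (l : List A.H) :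
    φ (splitSum q F G l) = splitSum q (fun t => φ (F t)) (fun t => φ (G t)) l := by
  simp [splitSum]

lemma map_diffFormula {A : DGAlg.{u, v} k} {M : Type*} {N : Type*} [Ring M] [Algebra k M] [Ring N]
    [Algebra k N] (φ : M →ₐ[k] N) (p : ℤ) (F₀ : M) (F : List A.H → M) (I : A.H → M)
    (l : List A.H) (hl : l ≠ []) :
    φ (diffFormula p F₀ F I l hl)
      = diffFormula p (φ F₀) (fun t => φ (F t)) (fun a => φ (I a)) l hl := by
  -- The lemmas `map_dSum` and `map_mulSum` also change the letters along a morphism; the identity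
  -- morphism leaves only the change of values by `φ`.
  have hid : ∀ t : List A.H, t.map (DGHom.id A).mapH = t := fun t => List.map_id _
  have h1 := map_dSum (DGHom.id A) φ.toLinearMap F (fun t => φ (F t)) (by simp [hid]) l
  have h2 := map_mulSum (DGHom.id A) φ.toLinearMap F (fun t => φ (F t)) (by simp [hid]) l
  rw [hid] at h1 h2
  simp only [AlgHom.toLinearMap_apply] at h1 h2
  simp [diffFormula, h1, h2]

lemma eps_mul_val (f f' : C.H) (gs : List D.H) :
    (eps (f.mul f') gs).val = splitSum f'.1 (fun t => (eps f t).val) (fun t => (eps f' t).val) gs := by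
  rw [eps_val, twistMk_rel (TwistRel.eps_mul _ _ _), map_splitSum]
  rfl

lemma d_idTensor_val (g : D.H) : (twist C D).d (idTensor C g).val = (idTensor C g.d).val := by
  rw [idTensor_val, twistMk_D, FreeDG.D_gen]
  exact twistMk_rel (TwistRel.d_right g)

lemma d_eps_nil_val (f : C.H) :
    (twist C D).d (eps f ([] : List D.H)).val = (eps f.d ([] : List D.H)).val := by
  rw [eps_val, twistMk_D, FreeDG.D_gen]
  exact twistMk_rel (TwistRel.d_eps_nil f)

lemma d_eps_val (f : C.H) (gs : List D.H) (h : gs ≠ []) :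
    (twist C D).d (eps f gs).val = diffFormula f.1 (eps f.d gs).val (fun t => (eps f t).val)
      (fun g => (idTensor C g).val) gs h := by
  rw [eps_val, twistMk_D, FreeDG.D_gen]
  refine (twistMk_rel (TwistRel.d_eps f gs h)).trans ?_
  rw [map_diffFormula]
  rfl

lemma idTensor_lin (c : k) {i : ℤ} (a b : D.gr i) :
    (idTensor C ⟨i, c • a + b⟩).val = c • (idTensor C ⟨i, a⟩).val + (idTensor C ⟨i, b⟩).val := by
  simp only [idTensor_val]
  rw [twistMk_rel (TwistRel.right_add _ _ _), map_add, twistMk_rel (TwistRel.right_smul _ _ _),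
    map_smul]

lemma idTensor_one : (idTensor C (H.one D)).val = 1 :=
  (twistMk_rel TwistRel.right_one).trans (map_one _)

lemma idTensor_mul (a b : D.H) :
    (idTensor C (a.mul b)).val = (idTensor C a).val * (idTensor C b).val :=
  (twistMk_rel (TwistRel.right_mul a b)).trans (map_mul _ _ _)

/-- The algebra map `g ↦ id ⊗ g`. -/
def idTensorAlg (C : DGAlg.{u, v} k) (D : DGAlg.{u, w} k) : D.carrier →ₐ[k] (twist C D).carrier :=
  algExt (Θ := fun a => (idTensor C a).val) (fun c _ a b => idTensor_lin c a b) idTensor_one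
    idTensor_mul

lemma idTensorAlg_val (g : D.H) : idTensorAlg C D g.val = (idTensor C g).val :=
  algExt_val _ _ _ g

/-- The morphism `g ↦ id ⊗ g`. -/
def idTensorHom (C : DGAlg.{u, v} k) (D : DGAlg.{u, w} k) : DGHom D (twist C D) where
  toAlgHom := idTensorAlg C D
  map_mem := by
    intro i a ha
    exact (idTensorAlg_val ⟨i, a, ha⟩).symm ▸ (idTensor C ⟨i, a, ha⟩).2.2
  map_d := by
    intro a
    induction a using hom_induction with
    | h0 => simp
    | hadd a b ha hb => simp only [map_add, ha, hb]
    | hH a => rw [← H.val_d, idTensorAlg_val, idTensorAlg_val, d_idTensor_val]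

lemma idTensorHom_val (g : D.H) : idTensorHom C D g.val = (idTensor C g).val :=
  idTensorAlg_val g

lemma idTensorHom_mapH (g : D.H) : (idTensorHom C D).mapH g = idTensor C g :=
  H.ext' rfl (idTensorHom_val g)

end TwistBasics

/-! ### Deconcatenation of words -/

section ListSums

variable {X : Type v} {M : Type x} [AddCommGroup M]

/-- The sum of `K a b` over all ways to write a list as a concatenation `a ++ b`. -/
def splitAll : (List X → List X → M) → List X → M
  | K, [] => K [] []
  | K, z :: l => K [] (z :: l) + splitAll (fun a b => K (z :: a) b) l

/-- The function with value `m` at the empty list and `0` elsewhere. -/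
def onNil (m : M) : List X → M
  | [] => m
  | _ :: _ => 0

/-- The function `z :: l ↦ G z l`, extended by `0`. -/
def onHead (G : X → List X → M) : List X → M
  | [] => 0
  | z :: l => G z l

/-- The function `l ++ [z] ↦ G l z`, extended by `0`. -/
def onLast : (List X → X → M) → List X → M
  | _, [] => 0
  | G, z :: l => onNil (G [] z) l + onLast (fun t => G (z :: t)) l

@[simp] lemma splitAll_nil (K : List X → List X → M) : splitAll K [] = K [] [] := rfl

lemma splitAll_cons (K : List X → List X → M) (z : X) (l : List X) :
    splitAll K (z :: l) = K [] (z :: l) + splitAll (fun a b => K (z :: a) b) l := rfl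

@[simp] lemma onNil_nil (m : M) : onNil m ([] : List X) = m := rfl

@[simp] lemma onNil_cons (m : M) (z : X) (l : List X) : onNil m (z :: l) = 0 := rfl

@[simp] lemma onHead_nil (G : X → List X → M) : onHead G [] = 0 := rfl

@[simp] lemma onHead_cons (G : X → List X → M) (z : X) (l : List X) :
    onHead G (z :: l) = G z l := rfl

@[simp] lemma onLast_nil (G : List X → X → M) : onLast G [] = 0 := rfl

lemma onLast_cons (G : List X → X → M) (z : X) (l : List X) :
    onLast G (z :: l) = onNil (G [] z) l + onLast (fun t => G (z :: t)) l := rfl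

lemma onLast_zero (l : List X) : onLast (fun _ _ => (0 : M)) l = 0 := by
  induction l with
  | nil => rfl
  | cons z l ih => cases l <;> simp_all [onLast_cons]

/-- This links the recursive form, suited to induction on words, with the indexed sums in the
definitions of the relations. -/
lemma splitAll_eq_sum (K : List X → List X → M) (l : List X) :
    splitAll K l = ∑ m ∈ Finset.range (l.length + 1), K (l.take m) (l.drop m) := by
  induction l generalizing K with
  | nil => simp
  | cons z l ih =>
    rw [splitAll_cons, ih, List.length_cons, Finset.sum_range_succ' _ (l.length + 1), add_comm]
    simp

lemma splitAll_congr {K K' : List X → List X → M} {l : List X}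
    (h : ∀ a b, a ++ b = l → K a b = K' a b) : splitAll K l = splitAll K' l := by
  induction l generalizing K K' with
  | nil => exact h [] [] rfl
  | cons z l ih =>
    rw [splitAll_cons, splitAll_cons, h [] (z :: l) rfl,
      ih fun a b hab => h (z :: a) b (by simp [hab])]

lemma map_splitAll {N : Type*} [AddCommGroup N] {Φ : Type*} [FunLike Φ M N]
    [AddMonoidHomClass Φ M N] (φ : Φ) (K : List X → List X → M) (l : List X) :
    φ (splitAll K l) = splitAll (fun a b => φ (K a b)) l := by
  simp [splitAll_eq_sum]

lemma splitAll_add (K K' : List X → List X → M) (l : List X) :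
    splitAll (fun a b => K a b + K' a b) l = splitAll K l + splitAll K' l := by
  simp [splitAll_eq_sum, Finset.sum_add_distrib]

lemma splitAll_sub (K K' : List X → List X → M) (l : List X) :
    splitAll (fun a b => K a b - K' a b) l = splitAll K l - splitAll K' l := by
  simp [splitAll_eq_sum]

lemma splitAll_zero (l : List X) : splitAll (fun _ _ => (0 : M)) l = 0 := by
  simp [splitAll_eq_sum]

lemma splitAll_smul [Module k M] (c : k) (K : List X → List X → M) (l : List X) :
    splitAll (fun a b => c • K a b) l = c • splitAll K l := by
  simp [splitAll_eq_sum, Finset.smul_sum]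

/-- Coassociativity of deconcatenation: both sides run over all ways to cut the word into three
pieces. -/
lemma splitAll_assoc (K : List X → List X → List X → M) (l : List X) :
    splitAll (fun a b => splitAll (fun a₁ a₂ => K a₁ a₂ b) a) l
      = splitAll (fun a b => splitAll (fun b₁ b₂ => K a b₁ b₂) b) l := by
  induction l generalizing K with
  | nil => rfl
  | cons z l ih =>
    simp only [splitAll_cons, splitAll_nil, splitAll_add, ih]
    abel

lemma splitAll_comm {Y : Type w} (K : List X → List X → List Y → List Y → M) (l : List X)
    (t : List Y) :
    splitAll (fun a b => splitAll (fun c d => K a b c d) t) l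
      = splitAll (fun c d => splitAll (fun a b => K a b c d) l) t := by
  simp only [splitAll_eq_sum]
  exact Finset.sum_comm

lemma splitAll_onNil_left (K : List X → M) (l : List X) :
    splitAll (fun a b => onNil (K b) a) l = K l := by
  cases l with
  | nil => rfl
  | cons z l => simp [splitAll_cons, splitAll_zero]

lemma splitAll_onNil_right (K : List X → M) (l : List X) :
    splitAll (fun a b => onNil (K a) b) l = K l := by
  induction l generalizing K with
  | nil => rfl
  | cons z l ih => simp [splitAll_cons, ih (fun a => K (z :: a))]

lemma splitAll_onHead_left (K : X → List X → List X → M) (l : List X) :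
    splitAll (fun a b => onHead (fun z a' => K z a' b) a) l
      = onHead (fun z l' => splitAll (K z) l') l := by
  cases l with
  | nil => rfl
  | cons z l => simp [splitAll_cons]

/-- A cut together with the last letter of its left piece is the same as an earlier cut together
with the first letter of its right piece. -/
lemma splitAll_onLast_left (K : List X → X → List X → M) (l : List X) :
    splitAll (fun a b => onLast (fun a' z => K a' z b) a) l
      = splitAll (fun a b => onHead (K a) b) l := by
  induction l generalizing K with
  | nil => rfl
  | cons z l ih =>
    simp only [splitAll_cons, onLast_nil, onLast_cons, splitAll_add, zero_add, onHead_cons, ih]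
    rw [splitAll_onNil_left (fun b => K [] z b)]

lemma onLast_eq (G : List X → X → M) {l : List X} (h : l ≠ []) :
    onLast G l = G l.dropLast (l.getLast h) := by
  induction l generalizing G with
  | nil => exact absurd rfl h
  | cons z l ih =>
    cases l with
    | nil => simp [onLast_cons]
    | cons z' l => rw [onLast_cons, ih _ (by simp)]; simp

lemma onHead_eq (G : X → List X → M) {l : List X} (h : l ≠ []) :
    onHead G l = G (l.head h) l.tail := by
  cases l with
  | nil => exact absurd rfl h
  | cons z l => rfl

lemma onLast_congr {G G' : List X → X → M} {l : List X}
    (h : ∀ a z, a ++ [z] = l → G a z = G' a z) : onLast G l = onLast G' l := by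
  by_cases hl : l = []
  · subst hl; rfl
  · rw [onLast_eq _ hl, onLast_eq _ hl, h _ _ (List.dropLast_append_getLast hl)]

lemma map_onHead {N : Type*} [AddCommGroup N] {Φ : Type*} [FunLike Φ M N]
    [AddMonoidHomClass Φ M N] (φ : Φ) (G : X → List X → M) (l : List X) :
    φ (onHead G l) = onHead (fun z t => φ (G z t)) l := by
  cases l <;> simp

lemma map_onLast {N : Type*} [AddCommGroup N] {Φ : Type*} [FunLike Φ M N]
    [AddMonoidHomClass Φ M N] (φ : Φ) (G : List X → X → M) (l : List X) :
    φ (onLast G l) = onLast (fun t z => φ (G t z)) l := by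
  by_cases hl : l = []
  · subst hl; simp
  · rw [onLast_eq _ hl, onLast_eq _ hl]

lemma onHead_add (G G' : X → List X → M) (l : List X) :
    onHead (fun z t => G z t + G' z t) l = onHead G l + onHead G' l := by
  cases l <;> simp

lemma onHead_congr {G G' : X → List X → M} {l : List X}
    (h : ∀ z t, z :: t = l → G z t = G' z t) : onHead G l = onHead G' l := by
  cases l with
  | nil => rfl
  | cons z t => exact h z t rfl

/-- The word stays a variable in the goal, so statements about `zs` can be rewritten as a whole and
the induction hypothesis used only where a first letter has been split off. -/
lemma tail_induction {p : List X → Prop} (h : ∀ l, (∀ z t, z :: t = l → p t) → p l)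
    (l : List X) : p l := by
  induction l with
  | nil => exact h [] fun _ _ e => nomatch e
  | cons z t ih =>
    refine h (z :: t) fun z' t' e => ?_
    obtain ⟨rfl, rfl⟩ := List.cons.inj e
    exact ih

lemma splitAll_onHead_comm {Y : Type w} (K : List X → List X → Y → List Y → M) (l : List X)
    (t : List Y) :
    splitAll (fun a b => onHead (K a b) t) l
      = onHead (fun z t' => splitAll (fun a b => K a b z t') l) t := by
  cases t <;> simp [splitAll_zero]

lemma smul_onHead [Module k M] (c : k) (G : X → List X → M) (l : List X) :
    c • onHead G l = onHead (fun z t => c • G z t) l := by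
  cases l <;> simp

lemma smul_onLast [Module k M] (c : k) (G : List X → X → M) (l : List X) :
    c • onLast G l = onLast (fun t z => c • G t z) l :=
  map_onLast (LinearMap.lsmul k M c) G l

lemma splitAll_map {Y : Type w} (f : Y → X) (K : List X → List X → M) (l : List Y) :
    splitAll K (l.map f) = splitAll (fun a b => K (a.map f) (b.map f)) l := by
  induction l generalizing K with
  | nil => rfl
  | cons z l ih => simp only [List.map_cons, splitAll_cons, ih, List.map_nil]

end ListSums

/-! ### The bar differential on words -/

section BarDifferential

lemma neg_one_zpow_add (m n : ℤ) : (-1 : k) ^ (m + n) = (-1) ^ m * (-1) ^ n :=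
  zpow_add₀ (by simp) _ _

lemma neg_one_zpow_sub (m n : ℤ) : (-1 : k) ^ (m - n) = (-1) ^ m * (-1) ^ n := by
  rw [sub_eq_add_neg, neg_one_zpow_add, zpow_neg, ← inv_zpow, inv_neg, inv_one]

lemma neg_one_zpow_mul_self (n : ℤ) : (-1 : k) ^ n * (-1) ^ n = 1 := by
  rw [← mul_zpow]; simp

variable {A : DGAlg.{u, v} k} {M : Type x} [AddCommGroup M] [Module k M]

/-- The composition of a function on words in `A[1]` with the bar differential. -/
def barD (F : List A.H → M) (l : List A.H) : M := dSum F l - mulSum F l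

@[simp] lemma barD_nil (F : List A.H → M) : barD F [] = 0 := by simp [barD, dSum, mulSum]

lemma barD_cons (F : List A.H → M) (a : A.H) (l : List A.H) :
    barD F (a :: l) = F (a.d :: l) + (-1 : k) ^ a.sdeg • barD (fun t => F (a :: t)) l
      - (-1 : k) ^ a.sdeg • onHead (fun b t => F (a.mul b :: t)) l := by
  cases l with
  | nil => simp [barD, dSum, mulSum]
  | cons b l => simp only [barD, dSum, mulSum, onHead_cons, smul_sub]; abel

lemma map_barD {N : Type*} [AddCommGroup N] [Module k N] (φ : M →ₗ[k] N) (F : List A.H → M)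
    (l : List A.H) : φ (barD F l) = barD (fun t => φ (F t)) l := by
  have hid : ∀ t : List A.H, t.map (DGHom.id A).mapH = t := fun t => List.map_id _
  have h1 := map_dSum (DGHom.id A) φ F (fun t => φ (F t)) (by simp [hid]) l
  have h2 := map_mulSum (DGHom.id A) φ F (fun t => φ (F t)) (by simp [hid]) l
  rw [hid] at h1 h2
  rw [barD, map_sub, h1, h2, barD]

lemma barD_map {B : DGAlg.{u, w} k} (ψ : DGHom A B) (F : List B.H → M) (l : List A.H) :
    barD F (l.map ψ.mapH) = barD (fun t => F (t.map ψ.mapH)) l := by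
  have h1 := map_dSum ψ LinearMap.id (fun t => F (t.map ψ.mapH)) F (by simp) l
  have h2 := map_mulSum ψ LinearMap.id (fun t => F (t.map ψ.mapH)) F (by simp) l
  simp only [LinearMap.id_apply] at h1 h2
  rw [barD, barD, h1, h2]

/-- Additivity comes from naturality in the values: `map_barD` is applied to the sum map and the two
projections of the pair-valued function `t ↦ (F t, G t)`. -/
lemma barD_add (F G : List A.H → M) (l : List A.H) :
    barD (fun t => F t + G t) l = barD F l + barD G l := by
  have h := map_barD (A := A) (LinearMap.coprod LinearMap.id LinearMap.id : M × M →ₗ[k] M)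
    (fun t => (F t, G t)) l
  have h1 := map_barD (A := A) (LinearMap.fst k M M) (fun t => (F t, G t)) l
  have h2 := map_barD (A := A) (LinearMap.snd k M M) (fun t => (F t, G t)) l
  simp only [LinearMap.coprod_apply, LinearMap.id_apply, LinearMap.fst_apply,
    LinearMap.snd_apply] at h h1 h2
  rw [← h, h1, h2]

lemma barD_smul (c : k) (F : List A.H → M) (l : List A.H) :
    barD (fun t => c • F t) l = c • barD F l :=
  (map_barD (A := A) (LinearMap.lsmul k M c) F l).symm

lemma barD_neg (F : List A.H → M) (l : List A.H) : barD (fun t => - F t) l = - barD F l := by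
  simpa using barD_smul (-1 : k) F l

lemma barD_sub (F G : List A.H → M) (l : List A.H) :
    barD (fun t => F t - G t) l = barD F l - barD G l := by
  simp only [sub_eq_add_neg, barD_add, barD_neg]

lemma barD_zero (l : List A.H) : barD (fun _ => (0 : M)) l = 0 := by
  simpa using barD_smul (0 : k) (fun _ => (0 : M)) l

lemma barD_splitAll_param {X : Type w} (K : List A.H → List X → List X → M) (t : List X)
    (l : List A.H) :
    barD (fun l' => splitAll (K l') t) l
      = splitAll (fun a b => barD (fun l' => K l' a b) l) t := by
  induction t generalizing K with
  | nil => rfl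
  | cons z t ih => simp only [splitAll_cons, barD_add, ih]

lemma barD_onHead_param {X : Type w} (K : List A.H → X → List X → M) (t : List X) (l : List A.H) :
    barD (fun l' => onHead (K l') t) l = onHead (fun a b => barD (fun l' => K l' a b) l) t := by
  cases t with
  | nil => exact barD_zero _
  | cons z t => rfl

/-- The bar differential raises the total degree by one. -/
lemma barD_sign (c : ℤ) (F : List A.H → M) (l : List A.H) :
    barD (fun t => (-1 : k) ^ (c * H.sdegs t) • F t) l
      = (-1 : k) ^ (c * (H.sdegs l + 1)) • barD F l := by
  induction l generalizing F with
  | nil => simp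
  | cons a l ih =>
    simp only [barD_cons, H.sdegs_cons, H.d, H.mul, smul_sub, smul_add]
    congr 1
    · congr 1
      · congr 2; ring
      · have := ih (fun t => (-1 : k) ^ (c * (a.1 - 1)) • F (a :: t))
        simp only [smul_smul, barD_smul] at this ⊢
        have e : ∀ t : List A.H, (-1 : k) ^ (c * (a.1 - 1 + H.sdegs t))
            = (-1 : k) ^ (c * H.sdegs t) * (-1 : k) ^ (c * (a.1 - 1)) := fun t => by
          rw [← zpow_add₀ (by simp)]; congr 1; ring
        simp only [e, this, smul_smul]
        congr 1
        rw [← zpow_add₀ (by simp), mul_comm]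
        congr 2; ring
    · cases l with
      | nil => simp
      | cons b l =>
        simp only [onHead_cons, smul_smul, H.sdegs_cons]
        rw [mul_comm]
        congr 3; ring

/-- The bar differential of a word never contains the empty word. -/
lemma barD_onNil (m : M) (l : List A.H) : barD (onNil m) l = 0 := by
  cases l with
  | nil => simp
  | cons a l =>
    rw [barD_cons]
    cases l <;> simp [barD_zero]

/-- The bar differential is a coderivation. -/
lemma barD_splitAll (K : List A.H → List A.H → M) (l : List A.H) :
    barD (splitAll K) l = splitAll (fun a b => barD (fun a' => K a' b) a
      + (-1 : k) ^ H.sdegs a • barD (fun b' => K a b') b) l := by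
  induction l generalizing K with
  | nil => simp
  | cons z l ih =>
    rw [barD_cons]
    simp only [splitAll_cons, barD_add, barD_nil, H.sdegs_nil, zpow_zero, one_smul, zero_add,
      splitAll_add, ih, H.sdegs_cons]
    simp only [barD_cons, splitAll_add, splitAll_sub, smul_add, splitAll_smul]
    rw [show splitAll (fun a b => onHead (fun c t => K (z.mul c :: t) b) a) l
      = onHead (fun c t => splitAll (fun a b => K (z.mul c :: a) b) t) l from
      splitAll_onHead_left (fun c t b => K (z.mul c :: t) b) l]
    have e : ∀ a : List A.H, (-1 : k) ^ (z.1 - 1 + H.sdegs a) = (-1 : k) ^ z.sdeg * (-1) ^ H.sdegs a :=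
      fun a => zpow_add₀ (by simp) _ _
    simp only [e, mul_smul, splitAll_smul]
    have e2 : onHead (fun b t => K [] (z.mul b :: t) + splitAll (fun a b_1 => K (z.mul b :: a) b_1) t) l
      = onHead (fun b t => K [] (z.mul b :: t)) l
        + onHead (fun b t => splitAll (fun a b_1 => K (z.mul b :: a) b_1) t) l := by
      cases l <;> simp
    rw [e2, smul_add]
    abel

lemma barD_onHead (G : A.H → List A.H → M) (z : A.H) (l : List A.H) :
    barD (onHead G) (z :: l) = G z.d l + (-1 : k) ^ z.sdeg • barD (G z) l
      - (-1 : k) ^ z.sdeg • onHead (fun b t => G (z.mul b) t) l := by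
  rw [barD_cons]
  rfl

/-- In this form the right-hand side makes sense for the empty word too, where only `F₀` survives,
and it is built from operations with good recursions. -/
lemma diffFormula_eq {S : Type x} [Ring S] [Algebra k S] (p : ℤ) (F₀ : S) (F : List A.H → S)
    (I : A.H → S) (l : List A.H) (hl : l ≠ []) :
    diffFormula p F₀ F I l hl = F₀ - (-1 : k) ^ p • barD F l
      + onHead (fun z t => (-1 : k) ^ (p * z.sdeg) • (I z * F t)) l
      - onLast (fun t z => (-1 : k) ^ (p + H.sdegs t) • (F t * I z)) l := by
  rw [onLast_eq _ hl, onHead_eq _ hl, diffFormula, barD, smul_sub]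
  abel

lemma splitSum_eq {S : Type x} [Ring S] [Algebra k S] (q : ℤ) (F G : List A.H → S)
    (l : List A.H) :
    splitSum q F G l = splitAll (fun a b => (-1 : k) ^ (q * H.sdegs a) • (F a * G b)) l := by
  rw [splitAll_eq_sum, splitSum]

/-- A function on words in `A[1]` which is multilinear and vanishes if some argument is `1`. -/
structure IsCochain (F : List A.H → M) : Prop where
  lin : ∀ (l r : List A.H) (c : k) {i : ℤ} (a b : A.gr i),
    F (l ++ ⟨i, c • a + b⟩ :: r) = c • F (l ++ ⟨i, a⟩ :: r) + F (l ++ ⟨i, b⟩ :: r)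
  one : ∀ l r : List A.H, F (l ++ H.one A :: r) = 0

lemma IsCochain.cons {F : List A.H → M} (h : IsCochain F) (a : A.H) :
    IsCochain fun t => F (a :: t) :=
  ⟨fun l r => h.lin (a :: l) r, fun l r => h.one (a :: l) r⟩

lemma IsCochain.head {F : List A.H → M} (h : IsCochain F) (r : List A.H) :
    IsLinearH fun a => F (a :: r) := fun c _ a b => h.lin [] r c a b

lemma H.d_d (a : A.H) : a.d.d = ⟨a.1 + 1 + 1, 0⟩ := by
  refine H.ext' rfl ?_
  rw [H.val_d, H.val_d, A.d_d]
  rfl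

lemma H.mul_assoc (a b c : A.H) : (a.mul b).mul c = a.mul (b.mul c) :=
  H.ext' (add_assoc _ _ _) (_root_.mul_assoc a.val b.val c.val)

lemma IsCochain.mul_d {F : List A.H → M} (h : IsCochain F) (a b : A.H) (r : List A.H) :
    F ((a.mul b).d :: r) = F (a.d.mul b :: r) + (-1 : k) ^ a.1 • F (a.mul b.d :: r) := by
  -- The three elements carry degree labels that agree only up to associativity and commutativity of
  -- addition; the linear extension depends on the underlying elements alone.
  rw [← linExt_val (h.head r), ← linExt_val (h.head r), ← linExt_val (h.head r), ← map_smul,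
    ← map_add]
  congr 1
  exact A.leibniz a.2.2 b.val

/-- The bar differential squares to zero. -/
lemma barD_barD {F : List A.H → M} (h : IsCochain F) (l : List A.H) : barD (barD F) l = 0 := by
  induction l generalizing F with
  | nil => simp
  | cons a l ih =>
    -- By the induction hypothesis the part that applies the bar differential twice behind `a`
    -- vanishes; what is left differentiates `a` or multiplies it with its right neighbour.
    have e : (barD fun t => barD F (a :: t)) l = barD (fun t => F (a.d :: t)) l
        - (-1 : k) ^ a.sdeg • barD (onHead fun b t => F (a.mul b :: t)) l := by
      simp only [barD_cons F, barD_add, barD_sub, barD_smul, ih (h.cons a)]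
      simp
    rw [barD_cons, e]
    cases l with
    | nil => simp [barD_cons, H.d_d, (h.head _).map_zero]
    | cons b l =>
      -- The remaining terms cancel by `d² = 0`, the Leibniz rule for `d(ab)` and the associativity
      -- of the product.
      rw [barD_onHead, onHead_cons, barD_cons _ a.d, H.d_d, (h.head _).map_zero,
        barD_cons _ (a.mul b), h.mul_d, onHead_cons]
      simp only [H.mul_assoc, H.sdeg, neg_one_zpow_sub]
      simp only [H.mul, H.d, neg_one_zpow_add, zpow_one]
      -- All coefficients are now products of the signs of the individual degrees, whose squares are
      -- `1`; this is all that comparing them requires.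
      have h1 := neg_one_zpow_mul_self (k := k) a.1
      have h2 := neg_one_zpow_mul_self (k := k) b.1
      match_scalars <;> grind

end BarDifferential

/-! ### The convolution algebra of cochains and its Hochschild differential -/

section Cochains

/-- Functions on words in `E[1]` with values in `T`. -/
structure Coch (E : DGAlg.{u, v} k) (T : DGAlg.{u, w} k) : Type (max v w) where
  toFun : List E.H → T.carrier

variable {E : DGAlg.{u, v} k} {T : DGAlg.{u, w} k}

namespace Coch

instance : CoeFun (Coch E T) fun _ => List E.H → T.carrier := ⟨toFun⟩

@[ext] lemma ext {F G : Coch E T} (h : ∀ l, F l = G l) : F = G := by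
  obtain ⟨F⟩ := F
  obtain ⟨G⟩ := G
  obtain rfl : F = G := funext h
  rfl

instance : Zero (Coch E T) := ⟨⟨0⟩⟩
instance : Add (Coch E T) := ⟨fun F G => ⟨F.toFun + G.toFun⟩⟩
instance : Neg (Coch E T) := ⟨fun F => ⟨-F.toFun⟩⟩
instance : Sub (Coch E T) := ⟨fun F G => ⟨F.toFun - G.toFun⟩⟩
instance {R : Type*} [SMul R T.carrier] : SMul R (Coch E T) := ⟨fun c F => ⟨c • F.toFun⟩⟩

lemma toFun_injective : Function.Injective (toFun : Coch E T → _) := fun _ _ h => ext (congrFun h)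

instance : AddCommGroup (Coch E T) := toFun_injective.addCommGroup _ rfl (fun _ _ => rfl)
  (fun _ => rfl) (fun _ _ => rfl) (fun _ _ => rfl) (fun _ _ => rfl)

instance : Module k (Coch E T) := toFun_injective.module k
  { toFun := toFun, map_zero' := rfl, map_add' := fun _ _ => rfl } (fun _ _ => rfl)

@[simp] lemma mk_apply (F : List E.H → T.carrier) (l : List E.H) : (mk F : Coch E T) l = F l := rfl

@[simp] lemma add_apply (F G : Coch E T) (l : List E.H) : (F + G) l = F l + G l := rfl

@[simp] lemma sub_apply (F G : Coch E T) (l : List E.H) : (F - G) l = F l - G l := rfl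

@[simp] lemma neg_apply (F : Coch E T) (l : List E.H) : (-F) l = -F l := rfl

@[simp] lemma zero_apply (l : List E.H) : (0 : Coch E T) l = 0 := rfl

@[simp] lemma smul_apply (c : k) (F : Coch E T) (l : List E.H) : (c • F) l = c • F l := rfl

/-- The cup product. -/
instance : Mul (Coch E T) := ⟨fun F G => ⟨splitAll fun a b =>
  (-1 : k) ^ (H.sdegs a * H.sdegs b) • (F a * T.parity (H.sdegs a) (G b))⟩⟩

instance : One (Coch E T) := ⟨⟨onNil 1⟩⟩

lemma one_apply (l : List E.H) : (1 : Coch E T) l = onNil 1 l := rfl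

lemma mul_apply (F G : Coch E T) (l : List E.H) : (F * G) l = splitAll (fun a b =>
    (-1 : k) ^ (H.sdegs a * H.sdegs b) • (F a * T.parity (H.sdegs a) (G b))) l := rfl

/-- Both bracketings expand into sums over cuts of the word into three pieces with the same Koszul
sign, and `splitAll_assoc` identifies the sums. The parity automorphism in the product keeps it
defined for cochains with inhomogeneous values. -/
protected lemma mul_assoc (F G K : Coch E T) : F * G * K = F * (G * K) := by
  ext l
  simp only [mul_apply]
  have h1 : ∀ a b : List E.H, (-1 : k) ^ (H.sdegs a * H.sdegs b) •
      (splitAll (fun a₁ a₂ => (-1 : k) ^ (H.sdegs a₁ * H.sdegs a₂) •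
        (F a₁ * T.parity (H.sdegs a₁) (G a₂))) a * T.parity (H.sdegs a) (K b))
      = splitAll (fun a₁ a₂ => (-1 : k) ^ (H.sdegs a₁ * H.sdegs a₂ + H.sdegs a₁ * H.sdegs b
        + H.sdegs a₂ * H.sdegs b) • (F a₁ * T.parity (H.sdegs a₁) (G a₂)
          * T.parity (H.sdegs a₁ + H.sdegs a₂) (K b))) a := by
    intro a b
    rw [← LinearMap.mulRight_apply (R := k) (A := T.carrier), map_splitAll, ← splitAll_smul (k := k) (M := T.carrier)]
    refine splitAll_congr fun a₁ a₂ h => ?_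
    subst h
    rw [map_smul, smul_smul, LinearMap.mulRight_apply, ← neg_one_zpow_add, H.sdegs_append]
    congr 2; ring
  have h2 : ∀ a b : List E.H, (-1 : k) ^ (H.sdegs a * H.sdegs b) • (F a * T.parity (H.sdegs a)
      (splitAll (fun b₁ b₂ => (-1 : k) ^ (H.sdegs b₁ * H.sdegs b₂) •
        (G b₁ * T.parity (H.sdegs b₁) (K b₂))) b))
      = splitAll (fun b₁ b₂ => (-1 : k) ^ (H.sdegs a * H.sdegs b₁ + H.sdegs a * H.sdegs b₂
        + H.sdegs b₁ * H.sdegs b₂) • (F a * T.parity (H.sdegs a) (G b₁)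
          * T.parity (H.sdegs a + H.sdegs b₁) (K b₂))) b := by
    intro a b
    rw [map_splitAll, ← LinearMap.mulLeft_apply (R := k) (A := T.carrier), map_splitAll, ← splitAll_smul (k := k) (M := T.carrier)]
    refine splitAll_congr fun b₁ b₂ h => ?_
    subst h
    rw [map_smul, map_mul, parity_parity, map_smul, smul_smul, LinearMap.mulLeft_apply,
      ← neg_one_zpow_add, H.sdegs_append, mul_assoc]
    congr 2; ring
  simp only [h1, h2]
  rw [splitAll_assoc (fun a b c => (-1 : k) ^ (H.sdegs a * H.sdegs b + H.sdegs a * H.sdegs c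
        + H.sdegs b * H.sdegs c) • (F a * T.parity (H.sdegs a) (G b)
          * T.parity (H.sdegs a + H.sdegs b) (K c)))]

protected lemma one_mul (F : Coch E T) : 1 * F = F := by
  ext l
  rw [mul_apply, ← splitAll_onNil_left F l]
  refine splitAll_congr fun a b _ => ?_
  cases a with
  | nil => simp [one_apply, parity_zero]
  | cons z a => simp [one_apply]

protected lemma mul_one (F : Coch E T) : F * 1 = F := by
  ext l
  rw [mul_apply, ← splitAll_onNil_right F l]
  refine splitAll_congr fun a b _ => ?_
  cases b with
  | nil => simp [one_apply]
  | cons z b => simp [one_apply]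

instance : Ring (Coch E T) where
  __ := (inferInstance : AddCommGroup (Coch E T))
  mul_assoc := Coch.mul_assoc
  one_mul := Coch.one_mul
  mul_one := Coch.mul_one
  left_distrib F G K := by
    ext l
    simp only [mul_apply, add_apply, ← splitAll_add, map_add, mul_add, smul_add]
  right_distrib F G K := by
    ext l
    simp only [mul_apply, add_apply, ← splitAll_add, add_mul, smul_add]
  zero_mul F := by
    ext l
    simp [mul_apply, splitAll_zero]
  mul_zero F := by
    ext l
    simp [mul_apply, splitAll_zero]

instance : Algebra k (Coch E T) := Algebra.ofModule
  (by
    intro c F G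
    ext l
    simp only [mul_apply, smul_apply, ← splitAll_smul (k := k) (M := T.carrier), smul_mul_assoc,
      smul_comm _ c])
  (by
    intro c F G
    ext l
    simp only [mul_apply, smul_apply, ← splitAll_smul (k := k) (M := T.carrier), map_smul, mul_smul_comm,
      smul_comm _ c])

/-- The cochains of degree `n`. -/
def gr (E : DGAlg.{u, v} k) (T : DGAlg.{u, w} k) (n : ℤ) : Submodule k (Coch E T) where
  carrier := {F | ∀ l, F l ∈ T.gr (n + H.sdegs l)}
  add_mem' ha hb l := add_mem (ha l) (hb l)
  zero_mem' _ := zero_mem _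
  smul_mem' c _ ha l := Submodule.smul_mem _ c (ha l)

/-- The value `G b` has degree `q + s(b)`, so the parity automorphism contributes `(-1)^{s(a)(q +
s(b))}` and cancels the prefactor up to `(-1)^{q s(a)}`, the sign in `splitSum`. -/
lemma mul_apply_of_mem (F : Coch E T) {G : Coch E T} {q : ℤ} (hG : G ∈ gr E T q) (l : List E.H) :
    (F * G) l = splitAll (fun a b => (-1 : k) ^ (q * H.sdegs a) • (F a * G b)) l := by
  rw [mul_apply]
  refine splitAll_congr fun a b _ => ?_
  rw [parity_of_mem (hG b), mul_smul_comm, smul_smul, ← neg_one_zpow_add]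
  rw [mul_add, ← add_assoc, add_right_comm, neg_one_zpow_add, neg_one_zpow_add,
    neg_one_zpow_mul_self, one_mul, mul_comm]

lemma mem_of_eq {A : DGAlg.{u, v} k} {m n : ℤ} {a : A.carrier} (h : a ∈ A.gr m) (e : m = n) :
    a ∈ A.gr n := e ▸ h

lemma splitAll_mem {X : Type v} {M : Type x} [AddCommGroup M] [Module k M] (p : Submodule k M)
    (K : List X → List X → M) (l : List X) (h : ∀ a b, a ++ b = l → K a b ∈ p) :
    splitAll K l ∈ p := by
  induction l generalizing K with
  | nil => exact h [] [] rfl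
  | cons z l ih => exact add_mem (h [] _ rfl) (ih _ fun a b hab => h _ _ (by simp [hab]))

/-- Only a graded monoid is claimed: a cochain may be nonzero in infinitely many degrees, so in
general the cochains are not the direct sum of these pieces. -/
instance : SetLike.GradedMonoid (gr E T) where
  one_mem l := by
    cases l with
    | nil => exact (SetLike.GradedOne.one_mem : (1 : T.carrier) ∈ T.gr 0)
    | cons z l => exact zero_mem _
  mul_mem := by
    intro m n F G hF hG l
    rw [mul_apply_of_mem F hG]
    refine splitAll_mem _ _ _ fun a b hab => Submodule.smul_mem _ _ ?_
    refine mem_of_eq (SetLike.GradedMul.mul_mem (hF a) (hG b)) ?_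
    rw [← hab, H.sdegs_append]; ring

/-- The endomorphism acting on cochains of degree `n` by `(-1)^n`. -/
def sign (E : DGAlg.{u, v} k) (T : DGAlg.{u, w} k) : Coch E T →ₗ[k] Coch E T where
  toFun F := ⟨fun l => (-1 : k) ^ H.sdegs l • T.parity 1 (F l)⟩
  map_add' F G := by ext l; simp
  map_smul' c F := by ext l; simp [smul_comm c]

lemma sign_of_mem {F : Coch E T} {p : ℤ} (hF : F ∈ gr E T p) : sign E T F = (-1 : k) ^ p • F := by
  ext l
  change (-1 : k) ^ H.sdegs l • T.parity 1 (F l) = (-1 : k) ^ p • F l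
  rw [parity_of_mem (hF l), smul_smul, one_mul, neg_one_zpow_add, mul_left_comm,
    neg_one_zpow_mul_self, mul_one]

/-- The composition of a cochain with the bar differential. -/
def bar (E : DGAlg.{u, v} k) (T : DGAlg.{u, w} k) : Coch E T →ₗ[k] Coch E T where
  toFun F := ⟨barD F⟩
  map_add' F G := ext (barD_add F G)
  map_smul' c F := ext (barD_smul c F)

/-- The composition of a cochain with the differential of `T`. -/
def post (E : DGAlg.{u, v} k) (T : DGAlg.{u, w} k) : Coch E T →ₗ[k] Coch E T where
  toFun F := ⟨fun l => T.d (F l)⟩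
  map_add' F G := by ext l; simp
  map_smul' c F := by ext l; simp

/-- The differential of cochains induced by those of `E` and `T`, disregarding the module structure
of `T`: `F ↦ d ∘ F + (-1)^|F| F ∘ d`. -/
def d₀ (E : DGAlg.{u, v} k) (T : DGAlg.{u, w} k) : Coch E T →ₗ[k] Coch E T :=
  post E T + bar E T ∘ₗ sign E T

lemma d₀_of_mem {F : Coch E T} {p : ℤ} (hF : F ∈ gr E T p) (l : List E.H) :
    d₀ E T F l = T.d (F l) + (-1 : k) ^ p • barD F l := by
  simp only [d₀, LinearMap.add_apply, LinearMap.comp_apply, sign_of_mem hF, map_smul]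
  rfl

lemma bar_mem {F : Coch E T} {p : ℤ} (hF : F ∈ gr E T p) : bar E T F ∈ gr E T (p + 1) := by
  intro l
  rw [add_right_comm]
  exact sub_mem (dSum_mem _ _ _ hF l) (mulSum_mem _ _ _ hF l)

lemma d₀_mem {F : Coch E T} {p : ℤ} (hF : F ∈ gr E T p) : d₀ E T F ∈ gr E T (p + 1) := by
  intro l
  rw [d₀_of_mem hF]
  refine add_mem (mem_of_eq (T.d_mem (hF l)) (by ring)) (Submodule.smul_mem _ _ (bar_mem hF l))

/-- This combines the Leibniz rule in `T` for the values with the coderivation property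
`barD_splitAll` for the arguments. -/
lemma d₀_mul {F G : Coch E T} {p q : ℤ} (hF : F ∈ gr E T p) (hG : G ∈ gr E T q) :
    d₀ E T (F * G) = d₀ E T F * G + (-1 : k) ^ p • (F * d₀ E T G) := by
  ext l
  rw [d₀_of_mem (SetLike.GradedMul.mul_mem hF hG), add_apply, smul_apply, mul_apply_of_mem _ hG,
    mul_apply_of_mem _ hG, mul_apply_of_mem _ (d₀_mem hG)]
  rw [show (F * G).toFun = splitAll (fun a b => (-1 : k) ^ (q * H.sdegs a) • (F a * G b)) from
    funext fun l => mul_apply_of_mem _ hG l]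
  rw [barD_splitAll, map_splitAll, ← splitAll_smul (k := k) (M := T.carrier), ← splitAll_smul (k := k) (M := T.carrier), ← splitAll_add, ← splitAll_add]
  refine splitAll_congr fun a b _ => ?_
  rw [map_smul, T.leibniz (hF a), barD_sign q (fun a' => F a' * G b), barD_smul]
  rw [d₀_of_mem hF, d₀_of_mem hG]
  have e1 : barD (fun a' => F a' * G b) a = barD F a * G b :=
    (map_barD (LinearMap.mulRight k (G b)) F a).symm
  have e2 : barD (fun b' => F a * G b') b = F a * barD G b :=
    (map_barD (LinearMap.mulLeft k (F a)) G b).symm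
  rw [e1, e2]
  simp only [neg_one_zpow_add, mul_add, add_mul, mul_one, one_mul, smul_add, mul_smul_comm,
    smul_mul_assoc, smul_smul]
  have h1 := neg_one_zpow_mul_self (k := k) q
  have h2 := neg_one_zpow_mul_self (k := k) p
  have h3 := neg_one_zpow_mul_self (k := k) (H.sdegs a)
  match_scalars <;> grind

lemma d₀_d₀ {F : Coch E T} {p : ℤ} (hF : F ∈ gr E T p) (h : IsCochain F.toFun) :
    d₀ E T (d₀ E T F) = 0 := by
  ext l
  rw [d₀_of_mem (d₀_mem hF), d₀_of_mem hF]
  rw [show (d₀ E T F).toFun = fun l => T.d (F l) + (-1 : k) ^ p • barD F l from funext (d₀_of_mem hF)]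
  have e : barD (fun t => T.d (F t)) l = T.d (barD F l) := (map_barD T.d F l).symm
  have e2 : barD (fun l => barD F l) l = 0 := barD_barD h l
  simp only [map_add, map_smul, T.d_d, barD_add, barD_smul, e2, e, zero_add, smul_zero,
    add_zero, neg_one_zpow_add, zpow_one]
  simp

/-- The cochain of length one given by a morphism. -/
def ofHom (ψ : DGHom E T) : Coch E T := ⟨onHead fun z l => onNil (ψ z.val) l⟩

variable (ψ : DGHom E T)

lemma ofHom_mem : ofHom ψ ∈ gr E T 1 := by
  intro l
  rcases l with _ | ⟨z, _ | ⟨z', l⟩⟩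
  · exact zero_mem _
  · exact mem_of_eq (ψ.map_mem z.val_mem) (by simp)
  · exact zero_mem _

lemma ofHom_mul_apply {F : Coch E T} {p : ℤ} (hF : F ∈ gr E T p) (l : List E.H) :
    (ofHom ψ * F) l = onHead (fun z t => (-1 : k) ^ (p * z.sdeg) • (ψ z.val * F t)) l := by
  rw [mul_apply_of_mem _ hF]
  cases l with
  | nil => simp [ofHom]
  | cons z l =>
    simp only [splitAll_cons, ofHom, onHead_nil, onHead_cons, zero_mul, smul_zero, zero_add]
    rw [← splitAll_onNil_left (fun b => (-1 : k) ^ (p * z.sdeg) • (ψ z.val * F b)) l]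
    refine splitAll_congr fun a b _ => ?_
    cases a <;> simp [H.sdeg]

lemma mul_ofHom_apply (F : Coch E T) (l : List E.H) :
    (F * ofHom ψ) l = onLast (fun t z => (-1 : k) ^ H.sdegs t • (F t * ψ z.val)) l := by
  rw [mul_apply_of_mem _ (ofHom_mem ψ)]
  have h := splitAll_onLast_left
    (fun a z b => onNil ((-1 : k) ^ H.sdegs a • (F a * ψ z.val)) b) l
  refine Eq.trans ?_ (h.symm.trans ?_)
  · refine splitAll_congr fun a b _ => ?_
    rcases b with _ | ⟨z, _ | ⟨z', b⟩⟩ <;> simp [ofHom]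
  · rw [← splitAll_onNil_right (onLast fun t z => (-1 : k) ^ H.sdegs t • (F t * ψ z.val)) l]
    refine splitAll_congr fun a b _ => ?_
    cases b with
    | nil => simp
    | cons z b => simp only [onNil_cons, onLast_zero]

/-- The Maurer–Cartan equation of a twisting cochain: on words of length one it says that `ψ`
commutes with the differentials, on words of length two that `ψ` is multiplicative. -/
lemma d₀_ofHom : d₀ E T (ofHom ψ) = ofHom ψ * ofHom ψ := by
  ext l
  rw [d₀_of_mem (ofHom_mem ψ), ofHom_mul_apply ψ (ofHom_mem ψ)]
  rcases l with _ | ⟨z, l⟩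
  · simp [ofHom]
  · rw [ofHom, barD_onHead]
    rw [show barD (onNil (ψ z.val)) l = 0 from barD_onNil _ _]
    rcases l with _ | ⟨z', _ | ⟨z'', l⟩⟩
    · simp [H.val_d, ψ.map_d]
    · simp [H.val_mul, H.sdeg]
    · simp

/-- The differential of cochains with values in `T`, regarded as a bimodule along `ψ`. -/
def δ : Coch E T →ₗ[k] Coch E T :=
  d₀ E T - LinearMap.mulLeft k (ofHom ψ) + LinearMap.mulRight k (ofHom ψ) ∘ₗ sign E T

lemma δ_of_mem {F : Coch E T} {p : ℤ} (hF : F ∈ gr E T p) :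
    δ ψ F = d₀ E T F - ofHom ψ * F + (-1 : k) ^ p • (F * ofHom ψ) := by
  simp [δ, sign_of_mem hF]

lemma δ_apply {F : Coch E T} {p : ℤ} (hF : F ∈ gr E T p) (l : List E.H) :
    δ ψ F l = T.d (F l) + (-1 : k) ^ p • barD F l
      - onHead (fun z t => (-1 : k) ^ (p * z.sdeg) • (ψ z.val * F t)) l
      + (-1 : k) ^ p • onLast (fun t z => (-1 : k) ^ H.sdegs t • (F t * ψ z.val)) l := by
  rw [δ_of_mem ψ hF, add_apply, sub_apply, smul_apply, d₀_of_mem hF, ofHom_mul_apply ψ hF,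
    mul_ofHom_apply]

lemma δ_mem {F : Coch E T} {p : ℤ} (hF : F ∈ gr E T p) : δ ψ F ∈ gr E T (p + 1) := by
  rw [δ_of_mem ψ hF]
  refine add_mem (sub_mem (d₀_mem hF) ?_) (Submodule.smul_mem _ _ ?_)
  · exact add_comm 1 p ▸ SetLike.GradedMul.mul_mem (A := gr E T) (ofHom_mem ψ) hF
  · exact SetLike.GradedMul.mul_mem hF (ofHom_mem ψ)

/-- The operator `δ` is `d₀` minus the graded commutator with `ofHom ψ`; the terms with `ofHom ψ`
between `F` and `G` cancel. -/
lemma δ_mul {F G : Coch E T} {p q : ℤ} (hF : F ∈ gr E T p) (hG : G ∈ gr E T q) :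
    δ ψ (F * G) = δ ψ F * G + (-1 : k) ^ p • (F * δ ψ G) := by
  rw [δ_of_mem ψ hF, δ_of_mem ψ hG, δ_of_mem ψ (SetLike.GradedMul.mul_mem hF hG), d₀_mul hF hG]
  simp only [mul_add, mul_sub, add_mul, sub_mul, smul_mul_assoc, mul_smul_comm, smul_add, smul_sub,
    mul_assoc, smul_smul, neg_one_zpow_add]
  abel

/-- Twisting `d₀` by a Maurer–Cartan element again gives a differential. Multilinearity of `F`
enters through `d₀_d₀`. -/
lemma δ_δ {F : Coch E T} {p : ℤ} (hF : F ∈ gr E T p) (h : IsCochain F.toFun) : δ ψ (δ ψ F) = 0 := by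
  have hV := ofHom_mem ψ
  rw [δ_of_mem ψ (δ_mem ψ hF), δ_of_mem ψ hF]
  simp only [map_add, map_sub, map_smul, d₀_d₀ hF h, d₀_mul hV hF, d₀_mul hF hV, d₀_ofHom]
  simp only [mul_add, mul_sub, add_mul, sub_mul, smul_mul_assoc, mul_smul_comm, smul_add, smul_sub,
    mul_assoc, smul_smul, neg_one_zpow_add, zpow_one]
  have h2 := neg_one_zpow_mul_self (k := k) p
  match_scalars <;> grind

end Coch

end Cochains

/-! ### Insertion sums and deconcatenation -/

section Insertions

variable {D : DGAlg.{u, v} k} {E : DGAlg.{u, w} k} {P : DGAlg.{u, v'} k}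
  {M : Type x} [AddCommGroup M] [Module k M]

/-- The recursion for `insertSum` according to the first argument of `F`. -/
lemma insertSum_cons (act : D.H → List E.H → P.H) (inj : E.H → P.H) (F : List P.H → M) (y : D.H)
    (ys : List D.H) (zs : List E.H) :
    insertSum act inj F (y :: ys) zs
      = splitAll (fun a b => (-1 : k) ^ (H.sdegs ys * H.sdegs a) •
          insertSum act inj (fun t => F (act y a :: t)) ys b) zs
        + onHead (fun z l => (-1 : k) ^ (z.sdeg * H.sdegs (y :: ys)) •
          insertSum act inj (fun t => F (inj z :: t)) (y :: ys) l) zs := by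
  rw [insertSum]
  cases zs with
  | nil => simp
  | cons z l =>
    -- The index `i_1 = 0` makes `act y a` the first argument of `F`; for `i_1 ≥ 1` the first
    -- argument is `inj z`, and shifting `i_1` by one gives the insertion sum for the shorter word.
    rw [List.length_cons, Finset.sum_range_succ', add_comm]
    congr 1
    · rw [splitAll_eq_sum]
      simp
    · rw [onHead_cons, insertSum, Finset.smul_sum]
      refine Finset.sum_congr rfl fun i _ => ?_
      rw [Finset.smul_sum]
      refine Finset.sum_congr (by congr 1; omega) fun j _ => ?_
      rw [smul_smul, ← neg_one_zpow_add]
      have e : i + 1 + j = (i + j) + 1 := by omega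
      simp only [e, List.take_succ_cons, List.drop_succ_cons, List.map_cons, List.cons_append,
        H.sdegs_cons, H.sdeg]
      congr 2
      ring

lemma map_insertSum {N : Type*} [AddCommGroup N] [Module k N] (φ : M →ₗ[k] N)
    (act : D.H → List E.H → P.H) (inj : E.H → P.H) (F : List P.H → M) (ys : List D.H)
    (zs : List E.H) :
    φ (insertSum act inj F ys zs) = insertSum act inj (fun t => φ (F t)) ys zs := by
  induction ys generalizing F zs with
  | nil => rfl
  | cons y ys ih => simp only [insertSum, map_sum, map_smul, ih]

lemma insertSum_map {P' : DGAlg.{u, w'} k} (χ : P.H → P'.H) (act : D.H → List E.H → P.H)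
    (inj : E.H → P.H) (F : List P'.H → M) (ys : List D.H) (zs : List E.H) :
    insertSum act inj (fun t => F (t.map χ)) ys zs
      = insertSum (fun y l => χ (act y l)) (fun z => χ (inj z)) F ys zs := by
  induction ys generalizing F zs with
  | nil => simp [insertSum, Function.comp_def]
  | cons y ys ih =>
    simp only [insertSum]
    refine Finset.sum_congr rfl fun i _ => Finset.sum_congr rfl fun j _ => ?_
    rw [← ih]
    simp [Function.comp_def]

/-- The sum over all insertions for the twisted tensor product of `D` and `E`. -/
def ins (F : List (twist D E).H → M) (ys : List D.H) (zs : List E.H) : M :=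
  insertSum (P := twist D E) (fun g l => eps g l) (fun h => idTensor D h) F ys zs

lemma ins_nil (F : List (twist D E).H → M) (zs : List E.H) :
    ins F [] zs = F (zs.map (idTensor D)) := rfl

/-- This puts the case without letters from `D` into the shape of the recursion `ins_cons`, so that
both can be treated uniformly. -/
lemma ins_nil_eq (F : List (twist D E).H → M) (zs : List E.H) :
    ins F [] zs = onNil (F []) zs
      + onHead (fun z l => (-1 : k) ^ (z.sdeg * H.sdegs ([] : List D.H)) •
        ins (fun t => F (idTensor D z :: t)) [] l) zs := by
  cases zs <;> simp [ins_nil]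

lemma ins_cons (F : List (twist D E).H → M) (y : D.H) (ys : List D.H) (zs : List E.H) :
    ins F (y :: ys) zs
      = splitAll (fun a b => (-1 : k) ^ (H.sdegs ys * H.sdegs a) •
          ins (fun t => F (eps y a :: t)) ys b) zs
        + onHead (fun z l => (-1 : k) ^ (z.sdeg * H.sdegs (y :: ys)) •
          ins (fun t => F (idTensor D z :: t)) (y :: ys) l) zs :=
  insertSum_cons _ _ _ _ _ _

lemma map_ins {N : Type*} [AddCommGroup N] [Module k N] (φ : M →ₗ[k] N)
    (F : List (twist D E).H → M) (ys : List D.H) (zs : List E.H) :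
    φ (ins F ys zs) = ins (fun t => φ (F t)) ys zs := map_insertSum _ _ _ _ _ _

lemma ins_add (F G : List (twist D E).H → M) (ys : List D.H) (zs : List E.H) :
    ins (fun t => F t + G t) ys zs = ins F ys zs + ins G ys zs := by
  have h := map_ins (LinearMap.coprod LinearMap.id LinearMap.id : M × M →ₗ[k] M)
    (fun t => (F t, G t)) ys zs
  have h1 := map_ins (LinearMap.fst k M M) (fun t => (F t, G t)) ys zs
  have h2 := map_ins (LinearMap.snd k M M) (fun t => (F t, G t)) ys zs
  simp only [LinearMap.coprod_apply, LinearMap.id_apply, LinearMap.fst_apply,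
    LinearMap.snd_apply] at h h1 h2
  rw [← h, h1, h2]

lemma ins_smul (c : k) (F : List (twist D E).H → M) (ys : List D.H) (zs : List E.H) :
    ins (fun t => c • F t) ys zs = c • ins F ys zs :=
  (map_ins (LinearMap.lsmul k M c) F ys zs).symm

lemma ins_sub (F G : List (twist D E).H → M) (ys : List D.H) (zs : List E.H) :
    ins (fun t => F t - G t) ys zs = ins F ys zs - ins G ys zs := by
  have h := ins_smul (-1 : k) G ys zs
  simp only [neg_smul, one_smul] at h
  simp only [sub_eq_add_neg, ins_add, h]

lemma ins_zero (ys : List D.H) (zs : List E.H) :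
    ins (fun _ : List (twist D E).H => (0 : M)) ys zs = 0 := by
  simpa using ins_smul (0 : k) (fun _ : List (twist D E).H => (0 : M)) ys zs

lemma ins_onNil (m : M) (ys : List D.H) (zs : List E.H) :
    ins (onNil m) ys zs = onNil (onNil m zs) ys := by
  cases ys with
  | nil => cases zs <;> rfl
  | cons y ys =>
    rw [ins_cons]
    simp only [onNil_cons, ins_zero, smul_zero, splitAll_zero, zero_add]
    cases zs <;> simp

/-- Insertion is compatible with deconcatenation. -/
lemma ins_splitAll (G : List (twist D E).H → List (twist D E).H → M) (ys : List D.H)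
    (zs : List E.H) :
    ins (splitAll G) ys zs = splitAll (fun a a' => splitAll (fun b b' =>
      (-1 : k) ^ (H.sdegs a' * H.sdegs b) • ins (fun p => ins (G p) a' b') a b) zs) ys := by
  induction ys generalizing G zs with
  | nil =>
    simp only [splitAll_nil, H.sdegs_nil, zero_mul, zpow_zero, one_smul, ins_nil]
    exact splitAll_map _ _ _
  | cons y ys ih =>
    induction zs using tail_induction generalizing G with
    | h zs ihz =>
    -- The cut in front of the whole inserted word is separated; the other cuts are sorted by the
    -- first letter, which is `ε(y; b)` or `id ⊗ z`.
    have hL : ins (splitAll G) (y :: ys) zs = ins (G []) (y :: ys) zs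
        + splitAll (fun b b' => (-1 : k) ^ (H.sdegs ys * H.sdegs b) •
          ins (splitAll fun a => G (eps y b :: a)) ys b') zs
        + onHead (fun z l => (-1 : k) ^ (z.sdeg * H.sdegs (y :: ys)) •
          ins (splitAll fun a => G (idTensor D z :: a)) (y :: ys) l) zs := by
      rw [ins_cons (splitAll G), ins_cons (G [])]
      simp only [splitAll_cons, ins_add, smul_add, splitAll_add, onHead_add]
      abel
    -- The cuts whose left half contains no letter of `D`: the left half is empty or begins with `id
    -- ⊗ z`.
    have hN : splitAll (fun b b' => (-1 : k) ^ (H.sdegs (y :: ys) * H.sdegs b) •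
        ins (fun p => ins (G p) (y :: ys) b') [] b) zs = ins (G []) (y :: ys) zs
        + onHead (fun z l => (-1 : k) ^ (z.sdeg * H.sdegs (y :: ys)) • splitAll (fun b b' =>
          (-1 : k) ^ (H.sdegs (y :: ys) * H.sdegs b) •
            ins (fun p => ins (G (idTensor D z :: p)) (y :: ys) b') [] b) l) zs := by
      simp only [← splitAll_smul]
      rw [← splitAll_onHead_left (fun z b b' => (-1 : k) ^ (z.sdeg * H.sdegs (y :: ys)) •
        (-1 : k) ^ (H.sdegs (y :: ys) * H.sdegs b) •
            ins (fun p => ins (G (idTensor D z :: p)) (y :: ys) b') [] b),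
        ← splitAll_onNil_left (fun b' => ins (G []) (y :: ys) b') zs, ← splitAll_add]
      refine splitAll_congr fun b b' _ => ?_
      cases b with
      | nil => simp [ins_nil]
      | cons z b =>
        simp only [onNil_cons, onHead_cons, zero_add, ins_nil, List.map_cons, smul_smul,
          ← neg_one_zpow_add]
        congr 2
        simp only [H.sdegs_cons, H.sdeg]
        ring
    -- The cuts whose left half involves `y :: a`, again sorted by the first letter.
    have hA : ∀ a a' : List D.H, splitAll (fun b b' => (-1 : k) ^ (H.sdegs a' * H.sdegs b) •
          ins (fun p => ins (G p) a' b') (y :: a) b) zs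
          = splitAll (fun b b' => (-1 : k) ^ ((H.sdegs a + H.sdegs a') * H.sdegs b) •
            splitAll (fun c c' => (-1 : k) ^ (H.sdegs a' * H.sdegs c) •
              ins (fun p => ins (G (eps y b :: p)) a' c') a c) b') zs
          + onHead (fun z l => (-1 : k) ^ (z.sdeg * (y.sdeg + H.sdegs a + H.sdegs a')) •
            splitAll (fun b b' => (-1 : k) ^ (H.sdegs a' * H.sdegs b) •
            ins (fun p => ins (G (idTensor D z :: p)) a' b') (y :: a) b) l) zs := by
      intro a a'
      simp only [← splitAll_smul]
      rw [← splitAll_assoc (fun b c c' => (-1 : k) ^ ((H.sdegs a + H.sdegs a') * H.sdegs b) •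
          (-1 : k) ^ (H.sdegs a' * H.sdegs c) • ins (fun p => ins (G (eps y b :: p)) a' c') a c),
        ← splitAll_onHead_left (fun z b b' =>
          (-1 : k) ^ (z.sdeg * (y.sdeg + H.sdegs a + H.sdegs a')) •
          (-1 : k) ^ (H.sdegs a' * H.sdegs b) •
            ins (fun p => ins (G (idTensor D z :: p)) a' b') (y :: a) b), ← splitAll_add]
      refine splitAll_congr fun b b' _ => ?_
      rw [ins_cons, smul_add, ← splitAll_smul, smul_onHead]
      congr 1
      · refine splitAll_congr fun c c' h => ?_
        rw [← h, smul_smul, smul_smul, ← neg_one_zpow_add, ← neg_one_zpow_add, H.sdegs_append]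
        congr 2; ring
      · refine onHead_congr fun z c h => ?_
        rw [← h, smul_smul, smul_smul, ← neg_one_zpow_add, ← neg_one_zpow_add, H.sdegs_cons,
          H.sdegs_cons]
        congr 2
        simp only [H.sdeg]
        ring
    -- Behind a first letter `ε(y; b)` the induction hypothesis for `ys` applies.
    have h1 : splitAll (fun b b' => (-1 : k) ^ (H.sdegs ys * H.sdegs b) •
          ins (splitAll fun a => G (eps y b :: a)) ys b') zs
        = splitAll (fun a a' => splitAll (fun b b' =>
            (-1 : k) ^ ((H.sdegs a + H.sdegs a') * H.sdegs b) •
            splitAll (fun c c' => (-1 : k) ^ (H.sdegs a' * H.sdegs c) •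
              ins (fun p => ins (G (eps y b :: p)) a' c') a c) b') zs) ys := by
      rw [splitAll_comm]
      refine splitAll_congr fun b b' _ => ?_
      rw [ih, ← splitAll_smul]
      refine splitAll_congr fun a a' h => ?_
      rw [← h, H.sdegs_append]
    -- Behind a first letter `id ⊗ z` the inner induction on `zs` applies; its two parts match the
    -- remaining sums in `hN` and `hA`.
    have h2 : onHead (fun z l => (-1 : k) ^ (z.sdeg * H.sdegs (y :: ys)) •
          ins (splitAll fun a => G (idTensor D z :: a)) (y :: ys) l) zs
        = onHead (fun z l => (-1 : k) ^ (z.sdeg * H.sdegs (y :: ys)) • splitAll (fun b b' =>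
          (-1 : k) ^ (H.sdegs (y :: ys) * H.sdegs b) •
            ins (fun p => ins (G (idTensor D z :: p)) (y :: ys) b') [] b) l) zs
        + splitAll (fun a a' => onHead (fun z l =>
            (-1 : k) ^ (z.sdeg * (y.sdeg + H.sdegs a + H.sdegs a')) •
            splitAll (fun b b' => (-1 : k) ^ (H.sdegs a' * H.sdegs b) •
            ins (fun p => ins (G (idTensor D z :: p)) a' b') (y :: a) b) l) zs) ys := by
      rw [splitAll_onHead_comm, ← onHead_add]
      refine onHead_congr fun z l h => ?_
      rw [ihz z l h, splitAll_cons, smul_add, ← splitAll_smul _ _ ys]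
      congr 1
      refine splitAll_congr fun a a' h => ?_
      rw [← h, H.sdegs_cons, H.sdegs_append, add_assoc]
      rfl
    rw [hL, h1, h2, splitAll_cons, hN]
    simp only [hA, splitAll_add]
    abel

end Insertions

/-! ### Insertion and the bar differentials -/

section InsertionsDifferential

variable {D : DGAlg.{u, v} k} {E : DGAlg.{u, w} k} {M : Type x} [AddCommGroup M] [Module k M]

/-- The formula for the differential of `ε(f; g_1, …, g_n)`, `n ≥ 0`. -/
lemma d_eps (f : D.H) (gs : List E.H) :
    (twist D E).d (eps f gs).val = (eps f.d gs).val
      - (-1 : k) ^ f.1 • barD (fun t => (eps f t).val) gs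
      + onHead (fun z t => (-1 : k) ^ (f.1 * z.sdeg) • ((idTensor D z).val * (eps f t).val)) gs
      - onLast (fun t z => (-1 : k) ^ (f.1 + H.sdegs t) • ((eps f t).val * (idTensor D z).val))
        gs := by
  by_cases h : gs = []
  · subst h
    simp [d_eps_nil_val]
  · rw [d_eps_val f gs h, diffFormula_eq]

/-- This allows a sum such as the formula for `d ε(y; a)`, whose summands carry different degree
labels, to be substituted in the first slot by way of `insHead`. -/
lemma ins_head_linear {F : List (twist D E).H → M} (hF : IsCochain F) (ys : List D.H)
    (zs : List E.H) : IsLinearH fun x => ins (fun t => F (x :: t)) ys zs := by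
  intro c i a b
  simp only [← ins_smul, ← ins_add]
  congr 1
  funext t
  exact hF.head t c a b

/-- The linear extension of `x ↦ ins (F (x, …)) ys zs`. -/
def insHead {F : List (twist D E).H → M} (hF : IsCochain F) (ys : List D.H) (zs : List E.H) :
    (twist D E).carrier →ₗ[k] M := linExt (ins_head_linear hF ys zs)

lemma insHead_val {F : List (twist D E).H → M} (hF : IsCochain F) (ys : List D.H) (zs : List E.H)
    (x : (twist D E).H) : insHead hF ys zs x.val = ins (fun t => F (x :: t)) ys zs :=
  linExt_val _ x

/-- The first letter of an inserted word is either `ε(y; a)` with `y` the first letter from `D`, or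
`id ⊗ z` with `z` the first letter from `E`. -/
lemma ins_onHead (G : (twist D E).H → List (twist D E).H → M) (ys : List D.H) (zs : List E.H) :
    ins (onHead G) ys zs
      = onHead (fun y t => splitAll (fun a b => (-1 : k) ^ (H.sdegs t * H.sdegs a) •
          ins (G (eps y a)) t b) zs) ys
        + onHead (fun z l => (-1 : k) ^ (z.sdeg * H.sdegs ys) • ins (G (idTensor D z)) ys l) zs := by
  cases ys with
  | nil => rw [ins_nil_eq]; cases zs <;> simp
  | cons y ys => rw [ins_cons]; rfl

lemma ins_barD_cons (F : List (twist D E).H → M) (x : (twist D E).H) (ys : List D.H)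
    (zs : List E.H) :
    ins (fun t => barD F (x :: t)) ys zs = ins (fun t => F (x.d :: t)) ys zs
      + (-1 : k) ^ x.sdeg • ins (barD fun t => F (x :: t)) ys zs
      - (-1 : k) ^ x.sdeg • ins (onHead fun p t => F (x.mul p :: t)) ys zs := by
  simp only [barD_cons, ins_sub, ins_add, ins_smul]

/-- The part of the recursion for `ins` where the first argument is `ε(y; …)`. -/
def insEps (F : List (twist D E).H → M) (y : D.H) (ys : List D.H) (zs : List E.H) : M :=
  splitAll (fun a b => (-1 : k) ^ (H.sdegs ys * H.sdegs a) •
    ins (fun t => F (eps y a :: t)) ys b) zs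

lemma ins_eq (F : List (twist D E).H → M) (ys : List D.H) (zs : List E.H) :
    ins F ys zs = onNil (onNil (F []) zs) ys + onHead (fun y t => insEps F y t zs) ys
      + onHead (fun z l => (-1 : k) ^ (z.sdeg * H.sdegs ys) •
        ins (fun t => F (idTensor D z :: t)) ys l) zs := by
  cases ys with
  | nil => rw [ins_nil_eq]; simp
  | cons y ys => rw [ins_cons]; simp [insEps]

/-- The bar differential in the `D`-variables is sorted into `d y`, the differential behind `ε(y;
a)`, the product of `y` with its neighbour, and the words beginning with `id ⊗ z`. The proof of
`ins_barD` matches these groups one by one. -/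
lemma barD_ins_left (F : List (twist D E).H → M) (y : D.H) (ys : List D.H) (zs : List E.H) :
    barD (fun t => ins F t zs) (y :: ys) = insEps F y.d ys zs
      + (-1 : k) ^ y.sdeg • splitAll (fun a b => (-1 : k) ^ (H.sdegs a * (H.sdegs ys + 1)) •
        barD (fun t => ins (fun l => F (eps y a :: l)) t b) ys) zs
      - (-1 : k) ^ y.sdeg • onHead (fun y' t => insEps F (y.mul y') t zs) ys
      + onHead (fun z l => (-1 : k) ^ (z.sdeg * (H.sdegs (y :: ys) + 1)) •
        barD (fun t => ins (fun l => F (idTensor D z :: l)) t l) (y :: ys)) zs := by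
  simp only [ins_eq F, barD_add]
  rw [show barD (fun t => onNil (onNil (F []) zs) t) (y :: ys) = 0 from barD_onNil _ _,
    show barD (fun t => onHead (fun y t => insEps F y t zs) t) (y :: ys) = _ from
    barD_onHead _ _ _, barD_onHead_param, zero_add]
  simp only [barD_sign, insEps]
  rw [barD_splitAll_param]
  congr 4
  refine splitAll_congr fun a b _ => ?_
  simp only [mul_comm _ (H.sdegs a)]
  rw [barD_sign]

/-- In the `E`-variables the words beginning with `ε(y; a)` form a sum over cuts, so the
coderivation property lets the differential act either inside the braces or behind them. -/
lemma barD_ins_right (F : List (twist D E).H → M) (y : D.H) (ys : List D.H) (zs : List E.H) :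
    barD (fun t => ins F (y :: ys) t) zs
      = splitAll (fun a b => (-1 : k) ^ (H.sdegs ys * (H.sdegs a + 1)) •
          barD (fun a' => ins (fun l => F (eps y a' :: l)) ys b) a
        + (-1 : k) ^ H.sdegs a • (-1 : k) ^ (H.sdegs ys * H.sdegs a) •
          barD (fun b' => ins (fun l => F (eps y a :: l)) ys b') b) zs
        + barD (onHead fun z l => (-1 : k) ^ (z.sdeg * H.sdegs (y :: ys)) •
          ins (fun t => F (idTensor D z :: t)) (y :: ys) l) zs := by
  simp only [ins_cons F y, barD_add]
  congr 1
  refine (barD_splitAll _ _).trans (splitAll_congr fun a b _ => ?_)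
  rw [barD_sign, barD_smul]

lemma idTensor_d (z : E.H) : (idTensor D z).d = idTensor D z.d := H.ext' rfl (d_idTensor_val z)

lemma idTensor_mulH (z z' : E.H) :
    (idTensor D z).mul (idTensor D z') = idTensor D (z.mul z') := H.ext' rfl (idTensor_mul z z').symm

/-- Insertion is compatible with the bar differentials. -/
lemma ins_barD {F : List (twist D E).H → M} (hF : IsCochain F) (ys : List D.H) (zs : List E.H) :
    ins (barD F) ys zs = barD (fun t => ins F t zs) ys
      + (-1 : k) ^ H.sdegs ys • barD (fun t => ins F ys t) zs := by
  induction ys generalizing F zs with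
  | nil =>
    simp only [barD_nil, H.sdegs_nil, zpow_zero, one_smul, zero_add, ins_nil]
    -- Without letters from `D`, insertion applies the morphism `z ↦ id ⊗ z` to every letter, and
    -- such maps commute with the bar differential.
    have h := barD_map (idTensorHom D E) F zs
    simp only [show (idTensorHom D E).mapH = idTensor D from funext idTensorHom_mapH] at h
    exact h
  | cons y ys ih =>
    induction zs using tail_induction generalizing F with
    | h zs ihz =>
    set s := H.sdegs ys with hs
    -- the terms in which the first argument comes from `E`
    have hH : onHead (fun z l => (-1 : k) ^ (z.sdeg * H.sdegs (y :: ys)) •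
          ins (fun t => barD F (idTensor D z :: t)) (y :: ys) l) zs
        = onHead (fun z l => (-1 : k) ^ (z.sdeg * (H.sdegs (y :: ys) + 1)) •
            barD (fun t => ins (fun l => F (idTensor D z :: l)) t l) (y :: ys)) zs
          + (-1 : k) ^ H.sdegs (y :: ys) •
            barD (onHead fun z l => (-1 : k) ^ (z.sdeg * H.sdegs (y :: ys)) •
              ins (fun t => F (idTensor D z :: t)) (y :: ys) l) zs
          - onHead (fun z l => (-1 : k) ^ (z.sdeg * (H.sdegs (y :: ys) + 1)) •
              splitAll (fun a b => (-1 : k) ^ (s * H.sdegs a) •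
                ins (fun t => F ((idTensor D z).mul (eps y a) :: t)) ys b) l) zs := by
      cases zs with
      | nil => simp
      | cons z l =>
        simp only [onHead_cons]
        rw [ins_barD_cons, ihz z l rfl (hF.cons _), barD_onHead, ins_onHead, onHead_cons,
          barD_smul, idTensor_d]
        have e : onHead (fun z' t => (-1 : k) ^ ((z.mul z').sdeg * H.sdegs (y :: ys)) •
            ins (fun t => F (idTensor D (z.mul z') :: t)) (y :: ys) t) l
            = (-1 : k) ^ ((z.sdeg + 1) * H.sdegs (y :: ys)) • onHead (fun z' t =>
              (-1 : k) ^ (z'.sdeg * H.sdegs (y :: ys)) •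
              ins (fun t => F ((idTensor D z).mul (idTensor D z') :: t)) (y :: ys) t) l := by
          rw [smul_onHead]
          refine onHead_congr fun z' t _ => ?_
          rw [smul_smul, ← neg_one_zpow_add, idTensor_mulH]
          congr 2
          simp only [H.sdeg, H.mul]
          ring
        rw [e]
        simp only [show (idTensor D z).sdeg = z.sdeg from rfl, show z.d.sdeg = z.sdeg + 1 by
          simp only [H.sdeg, H.d]; ring]
        change _ • (_ + _ - _ • (splitAll (fun a b => (-1 : k) ^ (s * H.sdegs a) •
          ins (fun t => F ((idTensor D z).mul (eps y a) :: t)) ys b) l + _)) = _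
        simp only [neg_one_zpow_add, mul_add, add_mul, mul_one, one_mul]
        have h1 := neg_one_zpow_mul_self (k := k) z.sdeg
        have h2 := neg_one_zpow_mul_self (k := k) (H.sdegs (y :: ys))
        match_scalars <;> grind
    -- The terms whose first argument is `ε(y; a)`. The last sum, the products of `id ⊗ z` with
    -- `ε(y; a)`, is what `hH` carries with the opposite sign.
    have hS : splitAll (fun a b => (-1 : k) ^ (s * H.sdegs a) •
          ins (fun t => barD F (eps y a :: t)) ys b) zs
        = insEps F y.d ys zs
          + (-1 : k) ^ y.sdeg • splitAll (fun a b => (-1 : k) ^ (H.sdegs a * (s + 1)) •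
              barD (fun t => ins (fun l => F (eps y a :: l)) t b) ys) zs
          - (-1 : k) ^ y.sdeg • onHead (fun y' t => insEps F (y.mul y') t zs) ys
          + (-1 : k) ^ H.sdegs (y :: ys) • splitAll (fun a b => (-1 : k) ^ (s * (H.sdegs a + 1)) •
              barD (fun a' => ins (fun l => F (eps y a' :: l)) ys b) a
              + (-1 : k) ^ H.sdegs a • (-1 : k) ^ (s * H.sdegs a) •
              barD (fun b' => ins (fun l => F (eps y a :: l)) ys b') b) zs
          + onHead (fun z l => (-1 : k) ^ (z.sdeg * (H.sdegs (y :: ys) + 1)) •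
              splitAll (fun a b => (-1 : k) ^ (s * H.sdegs a) •
                ins (fun t => F ((idTensor D z).mul (eps y a) :: t)) ys b) l) zs := by
      -- Multiplying neighbours `ε(y; a)` and `ε(y'; c)` and summing over all cuts gives `ε(yy';
      -- …)`, by the multiplication relation; these are the terms where the differential in the
      -- `D`-variables multiplies `y` and `y'`.
      have hP : splitAll (fun a b => (-1 : k) ^ (s * H.sdegs a) • (-1 : k) ^ (y.sdeg + H.sdegs a) •
            onHead (fun y' t => splitAll (fun c c' => (-1 : k) ^ (H.sdegs t * H.sdegs c) •
              ins (fun l => F ((eps y a).mul (eps y' c) :: l)) t c') b) ys) zs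
          = (-1 : k) ^ y.sdeg • onHead (fun y' t => insEps F (y.mul y') t zs) ys := by
        cases hys : ys with
        | nil => simp [splitAll_zero]
        | cons y' t =>
          simp only [onHead_cons, insEps, ← splitAll_smul]
          rw [← splitAll_assoc (fun a c c' => (-1 : k) ^ (s * H.sdegs a) •
            (-1 : k) ^ (y.sdeg + H.sdegs a) • (-1 : k) ^ (H.sdegs t * H.sdegs c) •
              ins (fun l => F ((eps y a).mul (eps y' c) :: l)) t c')]
          refine splitAll_congr fun a b _ => ?_
          rw [← insHead_val hF, eps_mul_val, splitSum_eq, map_splitAll, ← splitAll_smul,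
            ← splitAll_smul]
          refine splitAll_congr fun c c' hc => ?_
          rw [← hc, map_smul, ← H.val_mul, insHead_val, smul_smul, smul_smul, smul_smul, smul_smul,
            ← neg_one_zpow_add, ← neg_one_zpow_add, ← neg_one_zpow_add, ← neg_one_zpow_add,
            H.sdegs_append, hs, hys, H.sdegs_cons]
          congr 1
          simp only [neg_one_zpow_add, neg_one_zpow_sub, mul_add, add_mul, one_mul, sub_mul]
          have h1 := neg_one_zpow_mul_self (k := k) (H.sdegs c)
          grind
      -- The terms `ε(y; a')(id ⊗ z)` of `d ε(y; a)` cancel those in which the bar differential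
      -- multiplies `ε(y; a)` with a following `id ⊗ z`. The opposite sign arises because one
      -- exponent contains `|y|` and the other `|y| - 1`.
      have hL : splitAll (fun a b => (-1 : k) ^ (s * H.sdegs a) • onLast (fun a' z =>
            (-1 : k) ^ (y.1 + H.sdegs a') • insHead hF ys b ((eps y a').val * (idTensor D z).val))
              a) zs
          = - splitAll (fun a b => (-1 : k) ^ (s * H.sdegs a) • (-1 : k) ^ (y.sdeg + H.sdegs a) •
            onHead (fun z l => (-1 : k) ^ (z.sdeg * s) •
              ins (fun t => F ((eps y a).mul (idTensor D z) :: t)) ys l) b) zs := by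
        rw [← neg_one_smul k (splitAll _ zs), ← splitAll_smul]
        simp only [smul_onHead]
        rw [← splitAll_onLast_left (fun a z l => (-1 : k) • (-1 : k) ^ (s * H.sdegs a) •
          (-1 : k) ^ (y.sdeg + H.sdegs a) • (-1 : k) ^ (z.sdeg * s) •
              ins (fun t => F ((eps y a).mul (idTensor D z) :: t)) ys l)]
        refine splitAll_congr fun a b _ => ?_
        rw [smul_onLast]
        refine onLast_congr fun a' z h => ?_
        rw [← h, ← H.val_mul, insHead_val]
        simp only [H.sdegs_append, H.sdegs_cons, H.sdegs_nil, H.sdeg, smul_smul]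
        congr 1
        simp only [neg_one_zpow_add, neg_one_zpow_sub, mul_add, mul_sub, sub_mul, mul_one, one_mul,
          zpow_one, add_zero, mul_comm z.1 s]
        ring
      -- The terms `(id ⊗ z) ε(y; a')` of `d ε(y; a)` are the products of a first letter `id ⊗ z`
      -- with the `ε(y; a)` following it.
      have hT : onHead (fun z l => (-1 : k) ^ (z.sdeg * (H.sdegs (y :: ys) + 1)) •
              splitAll (fun a b => (-1 : k) ^ (s * H.sdegs a) •
                ins (fun t => F ((idTensor D z).mul (eps y a) :: t)) ys b) l) zs
          = splitAll (fun a b => (-1 : k) ^ (s * H.sdegs a) • onHead (fun z a' =>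
            (-1 : k) ^ (y.1 * z.sdeg) • insHead hF ys b ((idTensor D z).val * (eps y a').val)) a)
              zs := by
        simp only [← splitAll_smul]
        rw [← splitAll_onHead_left (fun z a b => (-1 : k) ^ (z.sdeg * (H.sdegs (y :: ys) + 1)) •
          (-1 : k) ^ (s * H.sdegs a) • ins (fun t => F ((idTensor D z).mul (eps y a) :: t)) ys b)]
        refine splitAll_congr fun a b _ => ?_
        rw [smul_onHead]
        refine onHead_congr fun z a' h => ?_
        rw [← h, ← H.val_mul, insHead_val]
        simp only [H.sdegs_cons, H.sdeg, smul_smul]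
        rw [← neg_one_zpow_add, ← neg_one_zpow_add]
        congr 2
        ring
      -- For fixed `a` and `b`: the formula for `d ε(y; a)` is used in the first slot, and the
      -- induction hypothesis for `ys` behind it.
      have key : ∀ a b, (-1 : k) ^ (s * H.sdegs a) • ins (fun t => barD F (eps y a :: t)) ys b
          = (-1 : k) ^ (s * H.sdegs a) • ins (fun t => F (eps y.d a :: t)) ys b
          + (-1 : k) ^ y.sdeg • (-1 : k) ^ (H.sdegs a * (s + 1)) •
              barD (fun t => ins (fun l => F (eps y a :: l)) t b) ys
          + (-1 : k) ^ H.sdegs (y :: ys) • ((-1 : k) ^ (s * (H.sdegs a + 1)) •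
              barD (fun a' => ins (fun l => F (eps y a' :: l)) ys b) a
              + (-1 : k) ^ H.sdegs a • (-1 : k) ^ (s * H.sdegs a) •
              barD (fun b' => ins (fun l => F (eps y a :: l)) ys b') b)
          + (-1 : k) ^ (s * H.sdegs a) • onHead (fun z a' =>
            (-1 : k) ^ (y.1 * z.sdeg) • insHead hF ys b ((idTensor D z).val * (eps y a').val)) a
          - (-1 : k) ^ (s * H.sdegs a) • onLast (fun a' z => (-1 : k) ^ (y.1 + H.sdegs a') •
              insHead hF ys b ((eps y a').val * (idTensor D z).val)) a
          - (-1 : k) ^ (s * H.sdegs a) • (-1 : k) ^ (y.sdeg + H.sdegs a) •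
            onHead (fun y' t => splitAll (fun c c' => (-1 : k) ^ (H.sdegs t * H.sdegs c) •
              ins (fun l => F ((eps y a).mul (eps y' c) :: l)) t c') b) ys
          - (-1 : k) ^ (s * H.sdegs a) • (-1 : k) ^ (y.sdeg + H.sdegs a) •
            onHead (fun z l => (-1 : k) ^ (z.sdeg * s) •
              ins (fun t => F ((eps y a).mul (idTensor D z) :: t)) ys l) b := by
        intro a b
        rw [ins_barD_cons, ih (hF.cons _), ins_onHead, ← insHead_val hF, H.val_d, d_eps, map_sub,
          map_add, map_sub, map_smul, map_barD, map_onHead, map_onLast, insHead_val]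
        simp only [map_smul, insHead_val]
        rw [show (eps y a).sdeg = y.sdeg + H.sdegs a by
          simp only [H.sdeg, eps_deg]; ring, H.sdegs_cons]
        simp only [H.sdeg, neg_one_zpow_add, neg_one_zpow_sub, mul_add, mul_one,
          zpow_one]
        have h1 := neg_one_zpow_mul_self (k := k) (H.sdegs a)
        have h2 := neg_one_zpow_mul_self (k := k) s
        have h3 := neg_one_zpow_mul_self (k := k) y.1
        rw [mul_comm (H.sdegs a) s]
        match_scalars <;> grind
      simp only [key, splitAll_add, splitAll_sub]
      rw [hP, hL, hT, splitAll_smul, splitAll_smul, splitAll_add, insEps]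
      abel
    rw [ins_cons, hS, hH, barD_ins_left, barD_ins_right, smul_add]
    abel

end InsertionsDifferential

/-! ### Closure properties of normalized multilinear cochains -/

section CochainClosure

variable {A : DGAlg.{u, v} k} {M : Type x} [AddCommGroup M] [Module k M] {N : Type w'}
  [AddCommGroup N] [Module k N]

/-- The linear map may depend on the total degree of the word, which covers the Koszul signs and
parity automorphisms that occur in products. -/
lemma IsCochain.twist {F : List A.H → M} (h : IsCochain F) (L : ℤ → M →ₗ[k] N) :
    IsCochain fun t => L (H.sdegs t) (F t) where
  lin l r c i a b := by
    rw [h.lin, map_add, map_smul]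
    simp only [H.sdegs_append, H.sdegs_cons]
  one l r := by rw [h.one, map_zero]

lemma IsCochain.slot {F : List A.H → M} (h : IsCochain F) (l r : List A.H) :
    IsLinearH fun x => F (l ++ x :: r) := fun c _ a b => h.lin l r c a b

lemma IsCochain.map {F : List A.H → M} (h : IsCochain F) (L : M →ₗ[k] N) :
    IsCochain fun t => L (F t) := h.twist fun _ => L

lemma IsCochain.add {F G : List A.H → M} (h : IsCochain F) (h' : IsCochain G) :
    IsCochain fun t => F t + G t where
  lin l r c i a b := by rw [h.lin, h'.lin, smul_add]; abel
  one l r := by rw [h.one, h'.one, add_zero]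

lemma isCochain_onNil (m : M) : IsCochain (onNil m : List A.H → M) where
  lin l r c i a b := by cases l <;> simp
  one l r := by cases l <;> simp

lemma isCochain_splitAll {K : List A.H → List A.H → M} (h₁ : ∀ b, IsCochain fun a => K a b)
    (h₂ : ∀ a, IsCochain (K a)) : IsCochain (splitAll K) where
  lin l r c i a b := by
    induction l generalizing K with
    | nil =>
      simp only [List.nil_append, splitAll_cons]
      have e' := (h₂ []).lin [] r c a b
      simp only [List.nil_append] at e'
      rw [e']
      have e : splitAll (fun t b' => K (⟨i, c • a + b⟩ :: t) b') r
          = c • splitAll (fun t b' => K (⟨i, a⟩ :: t) b') r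
            + splitAll (fun t b' => K (⟨i, b⟩ :: t) b') r := by
        rw [← splitAll_smul, ← splitAll_add]
        exact splitAll_congr fun t b' _ => (h₁ b').head t c a b
      rw [e, smul_add]
      abel
    | cons z l ih =>
      simp only [List.cons_append, splitAll_cons]
      have e' := (h₂ []).lin (z :: l) r c a b
      simp only [List.cons_append] at e'
      rw [ih (fun b => (h₁ b).cons z) fun a => h₂ (z :: a), e', smul_add]
      abel
  one l r := by
    induction l generalizing K with
    | nil =>
      simp only [List.nil_append, splitAll_cons]
      have e' := (h₂ []).one [] r
      simp only [List.nil_append] at e'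
      rw [e', zero_add]
      rw [splitAll_congr (K' := fun _ _ => (0 : M)) fun t b _ => by
        simpa using (h₁ b).one [] t, splitAll_zero]
    | cons z l ih =>
      simp only [List.cons_append, splitAll_cons]
      rw [ih (fun b => (h₁ b).cons z) fun a => h₂ (z :: a), add_zero]
      exact (h₂ []).one (z :: l) r

lemma eps_isCochain {C : DGAlg.{u, w} k} (f : C.H) :
    IsCochain fun t : List A.H => (eps f t).val where
  lin l r c _ a b := eps_arg_lin f l r c a b
  one l r := eps_one_arg f l r

end CochainClosure

/-! ### Insertion sums: normalization, degrees, last letters -/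

section InsertionProperties

variable {D : DGAlg.{u, v} k} {E : DGAlg.{u, w} k} {M : Type x} [AddCommGroup M] [Module k M]

lemma ins_isCochain_left {F : List (twist D E).H → M} (hF : IsCochain F) (zs : List E.H) :
    IsCochain fun ys => ins F ys zs where
  lin l r c i a b := by
    induction l generalizing F zs with
    | nil =>
      induction zs using tail_induction generalizing F with
      | h zs ih =>
      rw [List.nil_append, List.nil_append, List.nil_append, ins_cons F ⟨i, c • a + b⟩,
        ins_cons F ⟨i, a⟩, ins_cons F ⟨i, b⟩, smul_add, ← splitAll_smul, smul_onHead, add_add_add_comm, ← splitAll_add, ← onHead_add]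
      congr 1
      · refine splitAll_congr fun u v _ => ?_
        rw [← insHead_val hF, ← insHead_val hF, ← insHead_val hF, eps_lin, map_add, map_smul,
          smul_add, smul_comm c]
      · refine onHead_congr fun z t h => ?_
        have := ih z t h (hF.cons (idTensor D z))
        simp only [List.nil_append] at this
        rw [this, smul_add, smul_comm c]
        simp only [H.sdegs_cons]
    | cons y l ihl =>
      induction zs using tail_induction generalizing F with
      | h zs ih =>
      rw [List.cons_append, List.cons_append, List.cons_append, ins_cons F y (l ++ ⟨i, c • a + b⟩ :: r),
        ins_cons F y (l ++ ⟨i, a⟩ :: r), ins_cons F y (l ++ ⟨i, b⟩ :: r), smul_add, ← splitAll_smul, smul_onHead, add_add_add_comm, ← splitAll_add, ← onHead_add]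
      congr 1
      · refine splitAll_congr fun u v _ => ?_
        rw [ihl (hF.cons _), smul_add, smul_comm c]
        simp only [H.sdegs_append, H.sdegs_cons]
      · refine onHead_congr fun z t h => ?_
        have := ih z t h (hF.cons (idTensor D z))
        simp only [List.cons_append] at this
        rw [this, smul_add, smul_comm c]
        simp only [H.sdegs_append, H.sdegs_cons]
  one l r := by
    induction l generalizing F zs with
    | nil =>
      induction zs using tail_induction generalizing F with
      | h zs ih =>
      rw [List.nil_append, ins_cons]
      have e : ∀ u v, ins (fun t => F (eps (H.one D) u :: t)) r v = 0 := by
        intro u v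
        rw [← insHead_val hF]
        -- For empty `u` the inserted letter is the unit of `twist D E`, which `F` kills; otherwise
        -- `ε(1; u)` is already zero.
        cases u with
        | nil =>
          rw [eps_one_nil, ← H.val_one, insHead_val]
          have h : (fun t => F (H.one (twist D E) :: t)) = fun _ => 0 := funext (hF.one [])
          rw [h, ins_zero]
        | cons z u => rw [eps_one_of_ne (by simp), map_zero]
      simp only [e, smul_zero, splitAll_zero, zero_add]
      rw [onHead_congr (G' := fun _ _ => (0 : M)) fun z t h => by
          rw [show H.one D :: r = [] ++ H.one D :: r from rfl, ih z t h (hF.cons _), smul_zero]]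
      cases zs <;> rfl
    | cons y l ihl =>
      induction zs using tail_induction generalizing F with
      | h zs ih =>
      rw [List.cons_append, ins_cons]
      rw [splitAll_congr (K' := fun _ _ => (0 : M)) fun u v _ => by
          rw [ihl (hF.cons _), smul_zero], splitAll_zero, zero_add,
        onHead_congr (G' := fun _ _ => (0 : M)) fun z t h => by
          rw [show y :: (l ++ H.one D :: r) = (y :: l) ++ H.one D :: r from rfl,
            ih z t h (hF.cons _), smul_zero]]
      cases zs <;> rfl

lemma ins_isCochain_right {F : List (twist D E).H → M} (hF : IsCochain F) (ys : List D.H) :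
    IsCochain fun zs => ins F ys zs := by
  induction ys generalizing F with
  | nil =>
    constructor
    · intro l r c i a b
      simp only [ins_nil, List.map_append, List.map_cons]
      have h := hF.slot (l.map (idTensor D)) (r.map (idTensor D))
      rw [← linExt_val h, ← linExt_val h, ← linExt_val h, idTensor_lin, map_add, map_smul]
    · intro l r
      simp only [ins_nil, List.map_append, List.map_cons]
      rw [show idTensor D (H.one E) = H.one _ from H.ext' rfl idTensor_one, hF.one]
  | cons y ys ih =>
    -- The part beginning with `ε(y; a)` is a sum over cuts: multilinearity in `a` comes from `ε(y;
    -- a)`, in `b` from the induction hypothesis.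
    have hS : ∀ {F : List (twist D E).H → M}, IsCochain F →
        IsCochain (splitAll fun a b => (-1 : k) ^ (H.sdegs ys * H.sdegs a) •
          ins (fun t => F (eps y a :: t)) ys b) := by
      intro F hF
      refine isCochain_splitAll (fun b => ?_) fun a => (ih (hF.cons _)).map
        (LinearMap.lsmul k M ((-1 : k) ^ (H.sdegs ys * H.sdegs a)))
      simp only [← insHead_val hF]
      exact (eps_isCochain y).twist fun n => (-1 : k) ^ (H.sdegs ys * n) • insHead hF ys b
    constructor
    · intro l r c i a b
      induction l generalizing F with
      | nil =>
        rw [ins_cons, ins_cons, ins_cons, (hS hF).lin, smul_add, add_add_add_comm]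
        congr 1
        simp only [List.nil_append, onHead_cons, H.sdeg]
        rw [← insHead_val hF, ← insHead_val hF, ← insHead_val hF, idTensor_lin, map_add, map_smul,
          smul_add, smul_comm c]
      | cons z l ihl =>
        rw [ins_cons, ins_cons, ins_cons, (hS hF).lin, smul_add, add_add_add_comm]
        congr 1
        simp only [List.cons_append, onHead_cons]
        rw [ihl (hF.cons _), smul_add, smul_comm c]
    · intro l r
      induction l generalizing F with
      | nil =>
        rw [ins_cons, (hS hF).one, zero_add, List.nil_append, onHead_cons,
          show idTensor D (H.one E) = H.one _ from H.ext' rfl idTensor_one,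
          show (fun t => F (H.one (twist D E) :: t)) = fun _ => 0 from funext (hF.one []), ins_zero,
          smul_zero]
      | cons z l ihl =>
        rw [ins_cons, (hS hF).one, zero_add, List.cons_append, onHead_cons, ihl (hF.cons _),
          smul_zero]

lemma ins_mem (p : ℤ → Submodule k M) {F : List (twist D E).H → M} {n : ℤ}
    (hF : ∀ t, F t ∈ p (n + H.sdegs t)) (ys : List D.H) (zs : List E.H) :
    ins F ys zs ∈ p (n + H.sdegs ys + H.sdegs zs) := by
  induction ys generalizing F zs n with
  | nil =>
    rw [ins_nil, H.sdegs_nil, add_zero]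
    have h := hF (zs.map (idTensor D))
    have e := DGHom.sdegs_mapH (idTensorHom D E) zs
    rw [show (idTensorHom D E).mapH = idTensor D from funext idTensorHom_mapH] at e
    rwa [e] at h
  | cons y ys ih =>
    induction zs using tail_induction generalizing F n with
    | h zs ihz =>
    have hcons : ∀ x : (twist D E).H, ∀ t, F (x :: t) ∈ p (n + x.sdeg + H.sdegs t) := by
      intro x t
      have := hF (x :: t)
      rwa [H.sdegs_cons, ← add_assoc] at this
    rw [ins_cons]
    refine add_mem (Coch.splitAll_mem _ _ _ fun a b h => Submodule.smul_mem _ _ ?_) ?_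
    · have := ih (hcons (eps y a)) b
      rw [H.sdeg, eps_deg] at this
      convert this using 2
      rw [← h, H.sdegs_append, H.sdegs_cons]
      ring
    · cases zs with
      | nil => exact zero_mem _
      | cons z l =>
        have := ihz z l rfl (hcons (idTensor D z))
        rw [H.sdeg, idTensor_deg] at this
        rw [onHead_cons]
        refine Submodule.smul_mem _ _ ?_
        convert this using 2
        rw [H.sdegs_cons z l]
        ring

/-- Insertion preserves the total shifted degree: `ε(y; a)` has shifted degree `s(y) + s(a)`, and
`id ⊗ z` has shifted degree `s(z)`. -/
lemma ins_sign_mul (c : ℤ) (F : List (twist D E).H → M) (ys : List D.H) (zs : List E.H) :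
    ins (fun t => (-1 : k) ^ (c * H.sdegs t) • F t) ys zs
      = (-1 : k) ^ (c * (H.sdegs ys + H.sdegs zs)) • ins F ys zs := by
  have hs : ∀ (F : List (twist D E).H → M) (x : (twist D E).H),
      (fun t => (-1 : k) ^ (c * H.sdegs (x :: t)) • F (x :: t))
        = fun t => (-1 : k) ^ (c * x.sdeg) • ((-1 : k) ^ (c * H.sdegs t) • F (x :: t)) := by
    intro F x
    funext t
    rw [smul_smul, ← neg_one_zpow_add, H.sdegs_cons, mul_add]
    rfl
  induction ys generalizing F zs with
  | nil =>
    have e := DGHom.sdegs_mapH (idTensorHom D E) zs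
    rw [show (idTensorHom D E).mapH = idTensor D from funext idTensorHom_mapH] at e
    rw [ins_nil, ins_nil, e, H.sdegs_nil, zero_add]
  | cons y ys ih =>
    induction zs using tail_induction generalizing F with
    | h zs ihz =>
    rw [ins_cons, ins_cons F, smul_add, ← splitAll_smul, smul_onHead]
    congr 1
    · refine splitAll_congr fun a b h => ?_
      rw [hs, ins_smul, ih, smul_smul, smul_smul, smul_smul, ← neg_one_zpow_add,
        ← neg_one_zpow_add, ← neg_one_zpow_add, ← h]
      congr 2
      simp only [H.sdegs_append, H.sdegs_cons, H.sdeg, eps_deg]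
      ring
    · refine onHead_congr fun z l h => ?_
      rw [hs, ins_smul, ihz z l h, smul_smul, smul_smul, smul_smul, ← neg_one_zpow_add,
        ← neg_one_zpow_add, ← neg_one_zpow_add, ← h]
      congr 2
      simp only [H.sdegs_cons, H.sdeg, idTensor_deg]
      ring

lemma ins_sign (F : List (twist D E).H → M) (ys : List D.H) (zs : List E.H) :
    ins (fun t => (-1 : k) ^ H.sdegs t • F t) ys zs
      = (-1 : k) ^ (H.sdegs ys + H.sdegs zs) • ins F ys zs := by
  simpa using ins_sign_mul 1 F ys zs

/-- Removing the last letter is a cut whose right piece has length one; in this form `ins_splitAll`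
applies. -/
lemma onLast_eq_splitAll {X : Type w'} (G : List X → X → M) (l : List X) :
    onLast G l = splitAll (fun a => onHead fun x t => onNil (G a x) t) l := by
  refine Eq.trans ?_ (splitAll_onLast_left (fun a x t => onNil (G a x) t) l)
  rw [← splitAll_onNil_right (onLast G) l]
  refine splitAll_congr fun a b _ => ?_
  cases b with
  | nil => simp
  | cons z b => simp only [onNil_cons, onLast_zero]

/-- An inserted word of length one is either `ε(y; zs)`, absorbing all of `zs`, or a single `id ⊗ z`
without letters from `D`. -/
lemma ins_single (m : (twist D E).H → M) (ys : List D.H) (zs : List E.H) :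
    ins (onHead fun x t => onNil (m x) t) ys zs
      = onHead (fun y t => onNil (m (eps y zs)) t) ys
        + onHead (fun z l => onNil (onNil (m (idTensor D z)) l) ys) zs := by
  rw [ins_onHead]
  congr 1
  · refine onHead_congr fun y t _ => ?_
    simp only [ins_onNil]
    cases t with
    | nil =>
      simp only [H.sdegs_nil, zero_mul, zpow_zero, one_smul, onNil_nil]
      exact splitAll_onNil_right (fun u => m (eps y u)) zs
    | cons y' t => simp [splitAll_zero]
  · refine onHead_congr fun z l _ => ?_
    simp only [show (fun t => onNil (m (idTensor D z)) t) = onNil (m (idTensor D z)) from rfl,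
      ins_onNil]
    cases ys <;> simp

/-- `insertSum` recurses from the left, so the last letter is reached by writing `onLast` as a sum
over cuts and using compatibility with deconcatenation. -/
lemma ins_onLast (G : List (twist D E).H → (twist D E).H → M) (ys : List D.H) (zs : List E.H) :
    ins (onLast G) ys zs
      = onLast (fun t y => splitAll (fun a b => (-1 : k) ^ (y.sdeg * H.sdegs a) •
          ins (fun p => G p (eps y b)) t a) zs) ys
        + onLast (fun l z => ins (fun p => G p (idTensor D z)) ys l) zs := by
  rw [show onLast G = splitAll fun a => onHead fun x t => onNil (G a x) t from
    funext (onLast_eq_splitAll G), ins_splitAll]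
  simp only [ins_single, ins_add, smul_add, splitAll_add]
  congr 1
  · rw [onLast_eq_splitAll]
    refine splitAll_congr fun a a' _ => ?_
    rcases a' with _ | ⟨y, _ | ⟨y', t⟩⟩
    · simp [ins_zero, splitAll_zero]
    · simp [H.sdeg]
    · simp [ins_zero, splitAll_zero]
  · rw [onLast_eq_splitAll, splitAll_comm]
    refine splitAll_congr fun b b' _ => ?_
    rw [← splitAll_onNil_right (fun a => onHead (fun z l => onNil
      (ins (fun p => G p (idTensor D z)) a b) l) b')]
    refine splitAll_congr fun a a' _ => ?_
    rcases a' with _ | ⟨y, t⟩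
    · rcases b' with _ | ⟨z, _ | ⟨z', t⟩⟩ <;> simp [ins_zero]
    · rcases b' with _ | ⟨z, _ | ⟨z', t⟩⟩ <;> simp [ins_zero]

end InsertionProperties

/-! ### Maps from presented dg algebras to algebras with a derivation -/

section GradedDerivation

variable {X : Type w} {S : Type x} [Ring S] [Algebra k S] (gr : ℤ → Submodule k S)
  [SetLike.GradedMonoid gr] (δ : S →ₗ[k] S) (φ : X → S) (deg : X → ℤ)

/-- The evaluation of formal expressions in an algebra with a differential. -/
def derEval : FreeDG k X →ₐ[k] S := FreeAlgebra.lift k (Sum.elim φ fun x => δ (φ x))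

lemma derEval_gen (x : X) : derEval δ φ (FreeDG.gen k x) = φ x := by simp [derEval, FreeDG.gen]

lemma derEval_dgen (x : X) : derEval δ φ (FreeDG.dgen k x) = δ (φ x) := by
  simp [derEval, FreeDG.dgen]

/-- A linear map of degree `1` satisfying the Leibniz rule, and homogeneous elements on which it
squares to zero. -/
structure IsDerEval : Prop where
  leibniz : ∀ {m n : ℤ} {a b : S}, a ∈ gr m → b ∈ gr n →
    δ (a * b) = δ a * b + (-1 : k) ^ m • (a * δ b)
  d_mem : ∀ {m : ℤ} {a : S}, a ∈ gr m → δ a ∈ gr (m + 1)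
  gen_mem : ∀ x, φ x ∈ gr (deg x)
  d_d : ∀ x, δ (δ (φ x)) = 0

variable {gr δ φ deg}

lemma IsDerEval.word_mem (h : IsDerEval gr δ φ deg) (l : List (X ⊕ X)) :
    derEval δ φ (l.map (FreeAlgebra.ι k)).prod ∈ gr (l.map (FreeDG.wt deg)).sum := by
  induction l with
  | nil =>
    simp only [List.map_nil, List.prod_nil, map_one, List.sum_nil]
    exact SetLike.GradedOne.one_mem
  | cons y l ih =>
    simp only [List.map_cons, List.prod_cons, map_mul, List.sum_cons]
    refine SetLike.GradedMul.mul_mem ?_ ih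
    rcases y with x | x
    · exact (derEval_gen δ φ x).symm ▸ h.gen_mem x
    · exact (derEval_dgen δ φ x).symm ▸ h.d_mem (h.gen_mem x)

lemma IsDerEval.mem (h : IsDerEval gr δ φ deg) {n : ℤ} {a : FreeDG k X} (ha : a ∈ FreeDG.piece deg n) :
    derEval δ φ a ∈ gr n := by
  induction ha using Submodule.span_induction with
  | mem a ha =>
    obtain ⟨l, rfl, rfl⟩ := ha
    exact h.word_mem l
  | zero => simp
  | add a b _ _ ha hb => rw [map_add]; exact Submodule.add_mem _ ha hb
  | smul c a _ ha => rw [map_smul]; exact Submodule.smul_mem _ _ ha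

/-- By the Leibniz rule it suffices to look at single symbols. Only a symbol `d x` needs `δ² = 0`,
and only at the image of `x`, so `δ` need not square to zero on the whole algebra. -/
lemma IsDerEval.map_D (h : IsDerEval gr δ φ deg) (a : FreeDG k X) :
    derEval δ φ (FreeDG.D deg a) = δ (derEval δ φ a) := by
  have one : δ 1 = 0 := by
    have h1 : (1 : S) ∈ gr 0 := SetLike.GradedOne.one_mem
    simpa using h.leibniz h1 h1
  have word : ∀ l : List (X ⊕ X), derEval δ φ (FreeDG.D deg (l.map (FreeAlgebra.ι k)).prod)
      = δ (derEval δ φ (l.map (FreeAlgebra.ι k)).prod) := by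
    intro l
    induction l with
    | nil => simp [FreeDG.D_one, one]
    | cons y l ih =>
      simp only [List.map_cons, List.prod_cons, map_mul, FreeDG.D_mul, map_add, ih]
      rw [h.leibniz (h.mem (FreeDG.ι_mem_piece deg y)) (h.word_mem l), FreeDG.par_ι, FreeDG.D_ι]
      rcases y with x | x
      · simp [derEval, FreeDG.dgen]
      · simp [derEval, h.d_d]
  have hspan : a ∈ Submodule.span k
      {a : FreeDG k X | ∃ l : List (X ⊕ X), a = (l.map (FreeAlgebra.ι k)).prod} := by
    induction a using FreeAlgebra.induction with
    | grade0 c =>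
      rw [Algebra.algebraMap_eq_smul_one]
      exact Submodule.smul_mem _ _ (Submodule.subset_span ⟨[], rfl⟩)
    | grade1 y => exact Submodule.subset_span ⟨[y], by simp⟩
    | mul a b ha hb =>
      have h := Submodule.mul_mem_mul ha hb
      rw [Submodule.span_mul_span] at h
      refine Submodule.span_mono ?_ h
      rintro _ ⟨_, ⟨l, rfl⟩, _, ⟨l', rfl⟩, rfl⟩
      exact ⟨l ++ l', by simp⟩
    | add a b ha hb => exact Submodule.add_mem _ ha hb
  induction hspan using Submodule.span_induction with
  | mem a ha => obtain ⟨l, rfl⟩ := ha; exact word l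
  | zero => simp
  | add a b _ _ ha hb => simp [ha, hb]
  | smul c a _ ha => simp [ha]

/-- The algebra map from a presented dg algebra determined by the values on the generators. -/
def derLift {r : FreeDG k X → FreeDG k X → Prop} (h : IsDerEval gr δ φ deg)
    (hrel : ∀ a b, r a b → derEval δ φ a = derEval δ φ b) : PresentCarrier deg r →ₐ[k] S :=
  RingQuot.liftAlgHom k ⟨derEval δ φ, by
    intro a b hab
    rcases hab with hab | hab
    · exact hrel _ _ hab
    · rw [h.map_D, h.map_D, hrel _ _ hab]⟩

lemma derLift_mk {r : FreeDG k X → FreeDG k X → Prop} (h : IsDerEval gr δ φ deg)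
    (hrel : ∀ a b, r a b → derEval δ φ a = derEval δ φ b) (a : FreeDG k X) :
    derLift h hrel (presentMk deg r a) = derEval δ φ a := by
  simp [derLift, presentMk]

end GradedDerivation

/-! ### The subalgebra of normalized multilinear cochains -/

section CochainAlgebra

variable {E : DGAlg.{u, v} k} {T : DGAlg.{u, w} k}

/-- The subalgebra of normalized multilinear cochains. -/
def cochains (E : DGAlg.{u, v} k) (T : DGAlg.{u, w} k) : Subalgebra k (Coch E T) where
  carrier := {F | IsCochain F.toFun}
  mul_mem' := by
    intro F G hF hG
    refine isCochain_splitAll (fun b => ?_) fun a => ?_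
    · exact IsCochain.twist (F := F.toFun) hF fun n => (-1 : k) ^ (n * H.sdegs b) •
        LinearMap.mulRight k (T.parity n (G b))
    · exact IsCochain.twist (F := G.toFun) hG fun n => (-1 : k) ^ (H.sdegs a * n) •
        (LinearMap.mulLeft k (F a) ∘ₗ (T.parity (H.sdegs a)).toLinearMap)
  add_mem' := by
    intro F G hF hG
    exact IsCochain.add (F := F.toFun) (G := G.toFun) hF hG
  algebraMap_mem' := by
    intro c
    rw [Algebra.algebraMap_eq_smul_one]
    exact IsCochain.map (isCochain_onNil (1 : T.carrier)) (LinearMap.lsmul k T.carrier c)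

end CochainAlgebra

/-! ### The cochains of the generators and their differentials -/

section Associator

variable {C : DGAlg.{u, v} k} {D : DGAlg.{u, w} k} {E : DGAlg.{u, x} k}

/-- The cochain `hs ↦ id ⊗ ε(g; hs)`. -/
def rightCoch (C : DGAlg.{u, v} k) (E : DGAlg.{u, x} k) (g : D.H) :
    Coch E (twist C (twist D E)) :=
  ⟨fun hs => (idTensor C (eps g hs)).val⟩

/-- The cochain `hs ↦ ∑ ± ε(f; …, ε(g_1; …), …)`. -/
def epsCoch (E : DGAlg.{u, x} k) (f : C.H) (gs : List D.H) : Coch E (twist C (twist D E)) :=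
  ⟨fun hs => ins (fun l => (eps f l).val) gs hs⟩

/-- The images of the generators of the twisted tensor product of `C` and `D`. -/
def genCoch (E : DGAlg.{u, x} k) : TwistGen C D → Coch E (twist C (twist D E))
  | .right g => rightCoch C E g
  | .eps f gs => epsCoch E f gs

/-- The morphism `h ↦ id ⊗ (id ⊗ h)`. -/
def idIdTensor (C : DGAlg.{u, v} k) (D : DGAlg.{u, w} k) (E : DGAlg.{u, x} k) :
    DGHom E (twist C (twist D E)) := (idTensorHom C (twist D E)).comp (idTensorHom D E)

lemma idIdTensor_val (h : E.H) :
    idIdTensor C D E h.val = (idTensor C (idTensor D h)).val := by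
  change idTensorHom C (twist D E) (idTensorHom D E h.val) = _
  rw [idTensorHom_val, idTensorHom_val]

lemma rightCoch_mem (g : D.H) : rightCoch C E g ∈ Coch.gr E (twist C (twist D E)) g.1 :=
  fun hs => (idTensor C (eps g hs)).2.2

lemma epsCoch_mem (f : C.H) (gs : List D.H) :
    epsCoch E f gs ∈ Coch.gr E (twist C (twist D E)) (f.1 + H.sdegs gs) :=
  fun hs => ins_mem (twist C (twist D E)).gr (fun l => (eps f l).2.2) gs hs

lemma rightCoch_isCochain (g : D.H) : rightCoch C E g ∈ cochains E (twist C (twist D E)) := by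
  have h := (eps_isCochain (A := E) g).map (idTensorHom C (twist D E)).toAlgHom.toLinearMap
  simp only [AlgHom.toLinearMap_apply, idTensorHom_val] at h
  exact h

lemma epsCoch_isCochain (f : C.H) (gs : List D.H) :
    epsCoch E f gs ∈ cochains E (twist C (twist D E)) :=
  ins_isCochain_right (eps_isCochain f) gs

/-- This is the image under `x ↦ id ⊗ x` of the formula for `d ε(g; hs)`: the bar term and the two
outer terms are exactly those subtracted or added in `δ`. -/
lemma δ_rightCoch (g : D.H) :
    Coch.δ (idIdTensor C D E) (rightCoch C E g) = rightCoch C E g.d := by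
  ext hs
  rw [Coch.δ_apply _ (rightCoch_mem g)]
  have h := congrArg (idTensorHom C (twist D E)).toAlgHom.toLinearMap (d_eps g hs)
  rw [map_sub, map_add, map_sub, map_smul, map_barD, map_onHead, map_onLast] at h
  simp only [map_smul, AlgHom.toLinearMap_apply, (idTensorHom C (twist D E)).map_d, map_mul,
    idTensorHom_val] at h
  rw [smul_onLast (k := k) (M := (twist C (twist D E)).carrier)]
  simp only [rightCoch, h, smul_smul, ← neg_one_zpow_add, idIdTensor_val]
  abel

lemma δ_epsCoch_apply (f : C.H) (gs : List D.H) (hs : List E.H) :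
    Coch.δ (idIdTensor C D E) (epsCoch E f gs) hs = epsCoch E f.d gs hs
      - (-1 : k) ^ f.1 • barD (fun t => epsCoch E f t hs) gs
      + onHead (fun y t => (-1 : k) ^ (f.1 * y.sdeg) • (rightCoch C E y * epsCoch E f t) hs) gs
      - onLast (fun t y => (-1 : k) ^ (f.1 + H.sdegs t) • (epsCoch E f t * rightCoch C E y) hs)
        gs := by
  have hF := eps_isCochain (A := twist D E) f
  -- Each summand `ε(f; l)` is differentiated in the target; the resulting four kinds of terms are
  -- then sums over insertions of operations on `l`.
  have hd : (twist C (twist D E)).d (epsCoch E f gs hs)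
      = epsCoch E f.d gs hs - (-1 : k) ^ f.1 • ins (barD fun l => (eps f l).val) gs hs
        + ins (onHead fun x t => (-1 : k) ^ (f.1 * x.sdeg) •
            ((idTensor C x).val * (eps f t).val)) gs hs
        - ins (onLast fun t x => (-1 : k) ^ (f.1 + H.sdegs t) •
            ((eps f t).val * (idTensor C x).val)) gs hs := by
    refine (map_ins (twist C (twist D E)).d _ gs hs).trans ?_
    simp only [d_eps f, ins_sub, ins_add, ins_smul]
    rfl
  -- A first letter `ε(y; a)` gives the cup product with `rightCoch C E y`; a first letter `id ⊗ z`
  -- gives the left action of `z`, which `δ` removes.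
  have hhead : ins (onHead fun x t => (-1 : k) ^ (f.1 * x.sdeg) •
      ((idTensor C x).val * (eps f t).val)) gs hs
      = onHead (fun y t => (-1 : k) ^ (f.1 * y.sdeg) • (rightCoch C E y * epsCoch E f t) hs) gs
        + onHead (fun z t => (-1 : k) ^ ((f.1 + H.sdegs gs) * z.sdeg) •
          (idIdTensor C D E z.val * epsCoch E f gs t)) hs := by
    have hm : ∀ (c : k) (x : (twist D E).H) (ys : List D.H) (zs : List E.H),
        ins (fun t => c • ((idTensor C x).val * (eps f t).val)) ys zs
          = c • ((idTensor C x).val * epsCoch E f ys zs) := fun c x ys zs =>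
      (map_ins (c • LinearMap.mulLeft k (idTensor C x).val) _ ys zs).symm
    rw [ins_onHead]
    simp only [hm]
    congr 1
    · refine onHead_congr fun y t _ => ?_
      rw [Coch.mul_apply_of_mem _ (epsCoch_mem f t),
        ← splitAll_smul (k := k) (M := (twist C (twist D E)).carrier)]
      refine splitAll_congr fun a b _ => ?_
      rw [smul_smul, smul_smul, ← neg_one_zpow_add, ← neg_one_zpow_add]
      congr 2
      simp only [H.sdeg, eps_deg]
      ring
    · refine onHead_congr fun z t _ => ?_
      rw [smul_smul, ← neg_one_zpow_add, idIdTensor_val]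
      congr 2
      simp only [H.sdeg, idTensor_deg]
      ring
  -- Last letters likewise: `ε(y; b)` gives a cup product on the right, and `id ⊗ z` gives the right
  -- action that cancels in `δ`.
  have hlast : ins (onLast fun t x => (-1 : k) ^ (f.1 + H.sdegs t) •
      ((eps f t).val * (idTensor C x).val)) gs hs
      = onLast (fun t y => (-1 : k) ^ (f.1 + H.sdegs t) • (epsCoch E f t * rightCoch C E y) hs) gs
        + (-1 : k) ^ (f.1 + H.sdegs gs) • onLast (fun t z => (-1 : k) ^ H.sdegs t •
          (epsCoch E f gs t * idIdTensor C D E z.val)) hs := by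
    have hm : ∀ (x : (twist D E).H) (ys : List D.H) (zs : List E.H),
        ins (fun t => (-1 : k) ^ (f.1 + H.sdegs t) • ((eps f t).val * (idTensor C x).val)) ys zs
          = (-1 : k) ^ (f.1 + H.sdegs ys + H.sdegs zs) •
            (epsCoch E f ys zs * (idTensor C x).val) := by
      intro x ys zs
      simp only [neg_one_zpow_add f.1, mul_smul]
      rw [ins_smul, ins_sign (fun t => (eps f t).val * (idTensor C x).val), smul_smul,
        ← neg_one_zpow_add, ← add_assoc]
      congr 1
      exact (map_ins (LinearMap.mulRight k (idTensor C x).val) _ ys zs).symm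
    rw [ins_onLast]
    simp only [hm]
    congr 1
    · refine onLast_congr fun t y _ => ?_
      rw [Coch.mul_apply_of_mem _ (rightCoch_mem y),
        ← splitAll_smul (k := k) (M := (twist C (twist D E)).carrier)]
      refine splitAll_congr fun a b _ => ?_
      rw [smul_smul, smul_smul]
      congr 1
      simp only [H.sdeg, neg_one_zpow_add, sub_mul, neg_one_zpow_sub, one_mul]
      have h1 := neg_one_zpow_mul_self (k := k) (H.sdegs a)
      grind
    · rw [smul_onLast (k := k) (M := (twist C (twist D E)).carrier)]
      refine onLast_congr fun t z _ => ?_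
      rw [smul_smul, ← neg_one_zpow_add, idIdTensor_val]
  -- By `ins_barD` the bar term splits into one in the `D`-variables, which stays, and one in the
  -- `E`-variables, which cancels the bar term of `δ`.
  rw [Coch.δ_apply _ (epsCoch_mem f gs), hd, hhead, hlast, ins_barD hF]
  change _ - _ • (barD (fun t => epsCoch E f t hs) gs + _ • barD (epsCoch E f gs).toFun hs) + _
    - _ + _ - _ + _ = _
  rw [smul_add, smul_smul, ← neg_one_zpow_add]
  abel

end Associator

/-! ### Existence of the associator -/

section AssociatorExistence

variable {C : DGAlg.{u, v} k} {D : DGAlg.{u, w} k} {E : DGAlg.{u, x} k}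

lemma barD_coch_apply {A : DGAlg.{u, v} k} {T : DGAlg.{u, w} k} (F : List A.H → Coch E T)
    (l : List A.H) (hs : List E.H) : (barD F l) hs = barD (fun t => F t hs) l :=
  map_barD (⟨⟨fun G : Coch E T => G hs, fun _ _ => rfl⟩, fun _ _ => rfl⟩ : Coch E T →ₗ[k] T.carrier)
    F l

/-- This is the differential formula of `C ⊗ D` for the cochains of the generators, with the cup
product as multiplication. -/
lemma δ_epsCoch (f : C.H) (gs : List D.H) :
    Coch.δ (idIdTensor C D E) (epsCoch E f gs) = epsCoch E f.d gs
      - (-1 : k) ^ f.1 • barD (epsCoch E f) gs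
      + onHead (fun y t => (-1 : k) ^ (f.1 * y.sdeg) • (rightCoch C E y * epsCoch E f t)) gs
      - onLast (fun t y => (-1 : k) ^ (f.1 + H.sdegs t) • (epsCoch E f t * rightCoch C E y))
        gs := by
  ext hs
  rw [δ_epsCoch_apply, Coch.sub_apply, Coch.add_apply, Coch.sub_apply, Coch.smul_apply,
    barD_coch_apply]
  have ev : ∀ G : Coch E (twist C (twist D E)), G hs = (AddMonoidHom.mk' (fun G : Coch E
    (twist C (twist D E)) => G hs) fun _ _ => rfl) G := fun _ => rfl
  rw [ev (onHead _ _), map_onHead, ev (onLast _ _), map_onLast]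
  rfl

lemma genCoch_mem (y : TwistGen C D) :
    genCoch E y ∈ Coch.gr E (twist C (twist D E)) y.deg := by
  cases y with
  | right g => exact rightCoch_mem g
  | eps f gs => exact epsCoch_mem f gs

lemma genCoch_isCochain (y : TwistGen C D) : genCoch E y ∈ cochains E (twist C (twist D E)) := by
  cases y with
  | right g => exact rightCoch_isCochain g
  | eps f gs => exact epsCoch_isCochain f gs

lemma genCoch_isDerEval : IsDerEval (Coch.gr E (twist C (twist D E)))
    (Coch.δ (idIdTensor C D E)) (genCoch E) (TwistGen.deg (C := C) (D := D)) where
  leibniz := Coch.δ_mul _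
  d_mem := Coch.δ_mem _
  gen_mem := genCoch_mem
  d_d y := Coch.δ_δ _ (genCoch_mem y) (genCoch_isCochain y)

lemma epsCoch_lin (c : k) {i : ℤ} (a b : C.gr i) (gs : List D.H) :
    epsCoch E ⟨i, c • a + b⟩ gs = c • epsCoch E ⟨i, a⟩ gs + epsCoch E ⟨i, b⟩ gs := by
  ext hs
  rw [Coch.add_apply, Coch.smul_apply]
  simp only [epsCoch, eps_lin, ins_add, ins_smul]

lemma rightCoch_lin (c : k) {i : ℤ} (a b : D.gr i) :
    rightCoch C E ⟨i, c • a + b⟩ = c • rightCoch C E ⟨i, a⟩ + rightCoch C E ⟨i, b⟩ := by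
  ext hs
  rw [Coch.add_apply, Coch.smul_apply]
  simp only [rightCoch, ← idTensorHom_val, eps_lin, map_add, map_smul]

lemma epsCoch_arg (f : C.H) : IsCochain (epsCoch E f : List D.H → Coch E (twist C (twist D E))) where
  lin l r c i a b := by
    ext hs
    exact (ins_isCochain_left (eps_isCochain f) hs).lin l r c a b
  one l r := by
    ext hs
    exact (ins_isCochain_left (eps_isCochain f) hs).one l r

lemma rightCoch_one : rightCoch C E (H.one D) = 1 := by
  ext hs
  rw [Coch.one_apply]
  cases hs with
  | nil => exact (idTensorHom_val _).symm.trans ((congrArg _ eps_one_nil).trans (map_one _))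
  | cons z l =>
    exact (idTensorHom_val _).symm.trans ((congrArg _ (eps_one_of_ne (by simp))).trans (map_zero _))

lemma rightCoch_mul (g g' : D.H) :
    rightCoch C E (g.mul g') = rightCoch C E g * rightCoch C E g' := by
  ext hs
  rw [Coch.mul_apply_of_mem _ (rightCoch_mem g'), ← splitSum_eq]
  refine (idTensorHom_val _).symm.trans ((congrArg _ (eps_mul_val g g' hs)).trans ?_)
  refine (map_splitSum (idTensorHom C (twist D E)).toAlgHom _ _ _ _).trans ?_
  simp only [idTensorHom_val]
  rfl

lemma eps_one_eq_onNil :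
    (fun l : List D.H => (eps (H.one C) l).val) = onNil (1 : (twist C D).carrier) := by
  funext l
  cases l with
  | nil => exact eps_one_nil
  | cons z l => exact eps_one_of_ne (by simp)

lemma epsCoch_one (gs : List D.H) :
    epsCoch E (H.one C) gs = onNil (1 : Coch E (twist C (twist D E))) gs := by
  ext hs
  rw [epsCoch, eps_one_eq_onNil, Coch.mk_apply, ins_onNil]
  cases gs <;> rfl

/-- The function `ε(ff'; ·)` is a signed sum over cuts of products of `ε(f; ·)` and `ε(f'; ·)`, and
`ins_splitAll` turns cuts of inserted words into cuts of both arguments, as in the cup product. -/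
lemma epsCoch_mul (f f' : C.H) (gs : List D.H) :
    epsCoch E (f.mul f') gs = splitSum f'.1 (epsCoch E f) (epsCoch E f') gs := by
  have h1 : (fun l : List (twist D E).H => (eps (f.mul f') l).val) = splitAll fun a b =>
      (-1 : k) ^ (f'.1 * H.sdegs a) • ((eps f a).val * (eps f' b).val) := by
    funext l
    rw [eps_mul_val, splitSum_eq]
  ext hs
  have ev : ∀ G : Coch E (twist C (twist D E)), G hs = (AddMonoidHom.mk' (fun G : Coch E
    (twist C (twist D E)) => G hs) fun _ _ => rfl) G := fun _ => rfl
  rw [splitSum_eq, ev (splitAll _ _), map_splitAll]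
  change ins (fun l => (eps (f.mul f') l).val) gs hs = splitAll (fun a a' =>
    (-1 : k) ^ (f'.1 * H.sdegs a) • (epsCoch E f a * epsCoch E f' a') hs) gs
  rw [h1, ins_splitAll]
  refine splitAll_congr fun a a' _ => ?_
  rw [Coch.mul_apply_of_mem _ (epsCoch_mem f' a'),
    ← splitAll_smul (k := k) (M := (twist C (twist D E)).carrier)]
  refine splitAll_congr fun b b' _ => ?_
  have e : ∀ p : List (twist D E).H, ins (fun q => (-1 : k) ^ (f'.1 * H.sdegs p) •
      ((eps f p).val * (eps f' q).val)) a' b'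
      = (-1 : k) ^ (f'.1 * H.sdegs p) • ((eps f p).val * epsCoch E f' a' b') := fun p =>
    (map_ins ((-1 : k) ^ (f'.1 * H.sdegs p) • LinearMap.mulLeft k (eps f p).val) _ a' b').symm
  simp only [e]
  have e2 : ins (fun p => (-1 : k) ^ (f'.1 * H.sdegs p) • ((eps f p).val * epsCoch E f' a' b')) a b
      = (-1 : k) ^ (f'.1 * (H.sdegs a + H.sdegs b)) • (epsCoch E f a b * epsCoch E f' a' b') := by
    rw [ins_sign_mul]
    congr 1
    exact (map_ins (LinearMap.mulRight k (epsCoch E f' a' b')) _ a b).symm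
  rw [e2, smul_smul, smul_smul, ← neg_one_zpow_add, ← neg_one_zpow_add]
  congr 2
  ring

/-- The relations of `C ⊗ D` hold for the chosen cochains, which makes them the values of an algebra
map defined on all of `twist C D`. -/
lemma genCoch_rel (a b : FreeDG k (TwistGen C D)) (h : TwistRel C D a b) :
    derEval (Coch.δ (idIdTensor C D E)) (genCoch E) a
      = derEval (Coch.δ (idIdTensor C D E)) (genCoch E) b := by
  have hR : ∀ g : D.H, derEval (Coch.δ (idIdTensor C D E)) (genCoch E) (TwistGen.R C g)
      = rightCoch C E g := fun g => derEval_gen _ _ _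
  have hE : ∀ (f : C.H) (gs : List D.H),
      derEval (Coch.δ (idIdTensor C D E)) (genCoch E) (TwistGen.E f gs)
      = epsCoch E f gs := fun f gs => derEval_gen _ _ _
  have hdR : ∀ g : D.H, derEval (Coch.δ (idIdTensor C D E)) (genCoch E) (TwistGen.dR C g)
      = Coch.δ (idIdTensor C D E) (rightCoch C E g) := fun g => derEval_dgen _ _ _
  have hdE : ∀ (f : C.H) (gs : List D.H),
      derEval (Coch.δ (idIdTensor C D E)) (genCoch E) (TwistGen.dE f gs)
      = Coch.δ (idIdTensor C D E) (epsCoch E f gs) := fun f gs => derEval_dgen _ _ _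
  cases h with
  | right_add i a b =>
    rw [map_add, hR, hR, hR]
    simpa using rightCoch_lin (C := C) (E := E) 1 a b
  | right_smul c i a =>
    rw [map_smul, hR, hR]
    have h0 : IsLinearH (rightCoch (D := D) C E) := fun c _ a b => rightCoch_lin c a b
    simpa [h0.map_zero] using rightCoch_lin (C := C) (E := E) c a 0
  | right_one => rw [hR, map_one, rightCoch_one]
  | right_mul g g' => rw [map_mul, hR, hR, hR, rightCoch_mul]
  | eps_add i a b gs =>
    rw [map_add, hE, hE, hE]
    simpa using epsCoch_lin (E := E) 1 a b gs
  | eps_smul c i a gs =>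
    rw [map_smul, hE, hE]
    have h0 : IsLinearH (fun f : C.H => epsCoch E f gs) := fun c _ a b => epsCoch_lin c a b gs
    have h1 := epsCoch_lin (E := E) c a 0 gs
    rwa [h0.map_zero, add_zero, add_zero] at h1
  | eps_arg_add f l r i a b =>
    rw [map_add, hE, hE, hE]
    simpa using (epsCoch_arg (E := E) f).lin l r 1 a b
  | eps_arg_smul f l r c i a =>
    rw [map_smul, hE, hE]
    have h1 := (epsCoch_arg (E := E) f).lin l r c a 0
    rwa [((epsCoch_arg (E := E) f).slot l r).map_zero, add_zero, add_zero] at h1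
  | eps_one => rw [hE, map_one, epsCoch_one]; rfl
  | eps_one_left gs h =>
    rw [hE, map_zero, epsCoch_one]
    cases gs with
    | nil => exact absurd rfl h
    | cons g gs => rfl
  | eps_one_arg f l r => rw [hE, map_zero]; exact (epsCoch_arg f).one l r
  | eps_mul f f' gs =>
    rw [hE, map_splitSum, epsCoch_mul]
    simp only [hE]
  | d_right g => rw [hdR, hR, δ_rightCoch]
  | d_eps_nil f =>
    rw [hdE, hE, δ_epsCoch]
    simp
  | d_eps f gs h =>
    rw [hdE, map_diffFormula, diffFormula_eq, δ_epsCoch]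
    simp only [hE, hR]

/-- The algebra map `F ↦ α(ε(F; …))`. -/
def assocCoch (C : DGAlg.{u, v} k) (D : DGAlg.{u, w} k) (E : DGAlg.{u, x} k) :
    (twist C D).carrier →ₐ[k] Coch E (twist C (twist D E)) :=
  derLift genCoch_isDerEval genCoch_rel

lemma assocCoch_mk (a : FreeDG k (TwistGen C D)) : assocCoch C D E (twistMk a)
    = derEval (Coch.δ (idIdTensor C D E)) (genCoch E) a := derLift_mk _ _ a

lemma assocCoch_eps (f : C.H) (gs : List D.H) :
    assocCoch C D E (eps f gs).val = epsCoch E f gs :=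
  (assocCoch_mk _).trans (derEval_gen _ _ _)

lemma assocCoch_idTensor (g : D.H) :
    assocCoch C D E (idTensor C g).val = rightCoch C E g :=
  (assocCoch_mk _).trans (derEval_gen _ _ _)

lemma assocCoch_mem (F : (twist C D).H) :
    assocCoch C D E F.val ∈ Coch.gr E (twist C (twist D E)) F.1 := by
  obtain ⟨i, _, a, ha, rfl⟩ := F
  exact (assocCoch_mk (E := E) a).symm ▸ genCoch_isDerEval.mem ha

lemma assocCoch_d (F : (twist C D).carrier) :
    assocCoch C D E ((twist C D).d F) = Coch.δ (idIdTensor C D E) (assocCoch C D E F) := by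
  obtain ⟨a, rfl⟩ := presentMk_surjective _ _ F
  change assocCoch C D E ((twist C D).d (twistMk a)) = Coch.δ _ (assocCoch C D E (twistMk a))
  rw [twistMk_D, assocCoch_mk, assocCoch_mk, genCoch_isDerEval.map_D]

/-- The subalgebra of normalized cochains is not shown to be stable under `δ`. Instead the symbols
`d x` are handled by the explicit formulas for `δ` on the cochains of the generators. -/
lemma assocCoch_isCochain (F : (twist C D).carrier) :
    assocCoch C D E F ∈ cochains E (twist C (twist D E)) := by
  obtain ⟨a, rfl⟩ := presentMk_surjective _ _ F
  change assocCoch C D E (twistMk a) ∈ _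
  rw [assocCoch_mk]
  induction a using FreeAlgebra.induction with
  | grade0 r => rw [AlgHom.commutes]; exact Subalgebra.algebraMap_mem _ r
  | mul a b ha hb => rw [map_mul]; exact mul_mem ha hb
  | add a b ha hb => rw [map_add]; exact add_mem ha hb
  | grade1 y =>
    rcases y with y | y
    · change derEval _ _ (FreeDG.gen k y) ∈ _
      rw [derEval_gen]
      exact genCoch_isCochain y
    · change derEval _ _ (FreeDG.dgen k y) ∈ _
      rw [derEval_dgen]
      cases y with
      | right g =>
        change Coch.δ _ (rightCoch C E g) ∈ _
        rw [δ_rightCoch]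
        exact rightCoch_isCochain _
      | eps f gs =>
        change Coch.δ _ (epsCoch E f gs) ∈ _
        have hF : ∀ t, epsCoch E f t ∈ (fun _ : ℤ => Subalgebra.toSubmodule
          (cochains E (twist C (twist D E)))) (0 + H.sdegs t) := fun t => epsCoch_isCochain f t
        have hb : barD (epsCoch E f) gs ∈ cochains E (twist C (twist D E)) :=
          sub_mem (S := Subalgebra k (Coch E (twist C (twist D E))))
            (dSum_mem (fun _ => Subalgebra.toSubmodule (cochains E (twist C (twist D E)))) _ 0 hF gs)
            (mulSum_mem (fun _ => Subalgebra.toSubmodule (cochains E (twist C (twist D E)))) _ 0 hF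
              gs)
        rw [δ_epsCoch]
        refine sub_mem (add_mem (sub_mem (epsCoch_isCochain _ _)
          (Subalgebra.smul_mem _ hb _)) ?_) ?_
        · cases gs with
          | nil => exact zero_mem _
          | cons g gs =>
            exact Subalgebra.smul_mem _ (mul_mem (rightCoch_isCochain g) (epsCoch_isCochain f gs)) _
        · by_cases h : gs = []
          · subst h
            exact zero_mem _
          · rw [onLast_eq _ h]
            exact Subalgebra.smul_mem _ (mul_mem (epsCoch_isCochain f _) (rightCoch_isCochain _)) _

/-- The values of the associator on the generators. -/
def assocGen (C : DGAlg.{u, v} k) (D : DGAlg.{u, w} k) (E : DGAlg.{u, x} k) :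
    TwistGen (twist C D) E → (twist C (twist D E)).carrier
  | .right h => idIdTensor C D E h.val
  | .eps F hs => assocCoch C D E F.val hs

/-- Multiplicativity of `assocCoch` gives the product relation, normalization gives linearity and
the unit relations, and the intertwining of `d` with `δ` gives the differential formula. -/
lemma assocGen_rel (a b : FreeDG k (TwistGen (twist C D) E)) (h : TwistRel (twist C D) E a b) :
    evalFree (twist C (twist D E)) (assocGen C D E) a
      = evalFree (twist C (twist D E)) (assocGen C D E) b := by
  have hR : ∀ h : E.H, evalFree (twist C (twist D E)) (assocGen C D E) (TwistGen.R (twist C D) h)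
      = idIdTensor C D E h.val := fun g => evalFree_gen _ _ _
  have hE : ∀ (F : (twist C D).H) (hs : List E.H),
      evalFree (twist C (twist D E)) (assocGen C D E) (TwistGen.E F hs)
      = assocCoch C D E F.val hs := fun f gs => evalFree_gen _ _ _
  have hdR : ∀ h : E.H, evalFree (twist C (twist D E)) (assocGen C D E)
      (TwistGen.dR (twist C D) h) = (twist C (twist D E)).d (idIdTensor C D E h.val) :=
    fun g => evalFree_dgen _ _ _
  have hdE : ∀ (F : (twist C D).H) (hs : List E.H),
      evalFree (twist C (twist D E)) (assocGen C D E) (TwistGen.dE F hs)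
      = (twist C (twist D E)).d (assocCoch C D E F.val hs) := fun f gs => evalFree_dgen _ _ _
  -- Solving the defining formula of `δ` for the differential of the value yields the differential
  -- formula of `(C ⊗ D) ⊗ E`.
  have hδ : ∀ (F : (twist C D).H) (hs : List E.H),
      (twist C (twist D E)).d (assocCoch C D E F.val hs) = assocCoch C D E F.d.val hs
        - (-1 : k) ^ F.1 • barD (assocCoch C D E F.val).toFun hs
        + onHead (fun z t => (-1 : k) ^ (F.1 * z.sdeg) •
          (idIdTensor C D E z.val * assocCoch C D E F.val t)) hs
        - onLast (fun t z => (-1 : k) ^ (F.1 + H.sdegs t) •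
          (assocCoch C D E F.val t * idIdTensor C D E z.val)) hs := by
    intro F hs
    rw [H.val_d, assocCoch_d, Coch.δ_apply _ (assocCoch_mem F),
      smul_onLast (k := k) (M := (twist C (twist D E)).carrier)]
    simp only [smul_smul, ← neg_one_zpow_add]
    abel
  have hc : ∀ F : (twist C D).H, IsCochain (assocCoch C D E F.val).toFun :=
    fun F => assocCoch_isCochain F.val
  cases h with
  | right_add i a b =>
    rw [map_add, hR, hR, hR]
    exact map_add _ _ _
  | right_smul c i a =>
    rw [map_smul, hR, hR]
    exact map_smul _ _ _
  | right_one => rw [hR, map_one]; exact map_one _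
  | right_mul g g' => rw [map_mul, hR, hR, hR]; exact map_mul _ _ _
  | eps_add i a b hs =>
    rw [map_add, hE, hE, hE, ← Coch.add_apply, ← map_add]
    rfl
  | eps_smul c i a hs =>
    rw [map_smul, hE, hE, ← Coch.smul_apply, ← map_smul]
    rfl
  | eps_arg_add F l r i a b =>
    rw [map_add, hE, hE, hE]
    simpa using (hc F).lin l r 1 a b
  | eps_arg_smul F l r c i a =>
    rw [map_smul, hE, hE]
    have h1 := (hc F).lin l r c a 0
    rwa [((hc F).slot l r).map_zero, add_zero, add_zero] at h1
  | eps_one => rw [hE, map_one, H.val_one, map_one]; rfl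
  | eps_one_left hs h =>
    rw [hE, map_zero, H.val_one, map_one]
    cases hs with
    | nil => exact absurd rfl h
    | cons z hs => rfl
  | eps_one_arg F l r => rw [hE, map_zero]; exact (hc F).one l r
  | eps_mul F F' hs =>
    rw [hE, map_splitSum, H.val_mul, map_mul, Coch.mul_apply_of_mem _ (assocCoch_mem F'),
      splitSum_eq]
    simp only [hE]
  | d_right h => rw [hdR, hR, H.val_d, DGHom.map_d]
  | d_eps_nil F =>
    rw [hdE, hE, hδ]
    simp
  | d_eps F hs h =>
    rw [hdE, map_diffFormula, diffFormula_eq, hδ]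
    simp only [hE, hR]

/-- The associator. -/
def associator (C : DGAlg.{u, v} k) (D : DGAlg.{u, w} k) (E : DGAlg.{u, x} k) :
    DGHom (twist (twist C D) E) (twist C (twist D E)) :=
  presentLift (twistRel_homog (twist C D) E) (twist C (twist D E)) (assocGen C D E)
    (by
      rintro (h | ⟨F, hs⟩)
      · exact (idIdTensor C D E).map_mem h.val_mem
      · exact assocCoch_mem F hs)
    assocGen_rel

lemma associator_isAssociator (C : DGAlg.{u, v} k) (D : DGAlg.{u, w} k) (E : DGAlg.{u, x} k) :
    IsAssociator C D E (associator C D E) := by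
  have hR : ∀ h : E.H, associator C D E (idTensor (twist C D) h).val = idIdTensor C D E h.val :=
    fun h => (presentLift_mk _ _ _ _ _ _).trans (evalFree_gen _ _ _)
  have hE : ∀ (F : (twist C D).H) (hs : List E.H),
      associator C D E (eps F hs).val = assocCoch C D E F.val hs :=
    fun F hs => (presentLift_mk _ _ _ _ _ _).trans (evalFree_gen _ _ _)
  constructor
  · intro f gs hs
    rw [hE, assocCoch_eps]
    rfl
  · intro g hs
    rw [hE, assocCoch_idTensor]
    rfl
  · intro h
    rw [hR, idIdTensor_val]

end AssociatorExistence

/-! ### Maps determined by generators; uniqueness of the associator -/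

section HomExt

variable {C : DGAlg.{u, v} k} {D : DGAlg.{u, w} k} {E : DGAlg.{u, x} k} {T : DGAlg.{u, v'} k}

/-- Morphisms from a twisted tensor product are determined by the generators. -/
lemma twist_hom_ext {α β : DGHom (twist C D) T}
    (hR : ∀ g : D.H, α (idTensor C g).val = β (idTensor C g).val)
    (hE : ∀ (f : C.H) (gs : List D.H), α (eps f gs).val = β (eps f gs).val) : α = β := by
  refine DGHom.ext (AlgHom.ext fun a => ?_)
  obtain ⟨a, rfl⟩ := presentMk_surjective _ _ a
  have hgen : ∀ y : TwistGen C D, α (twistMk (FreeDG.gen k y)) = β (twistMk (FreeDG.gen k y)) := by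
    rintro (g | ⟨f, gs⟩)
    · exact hR g
    · exact hE f gs
  change α (twistMk a) = β (twistMk a)
  induction a using FreeAlgebra.induction with
  | grade0 c => simp only [AlgHom.commutes]
  | mul a b ha hb => simp only [map_mul, ha, hb]
  | add a b ha hb => simp only [map_add, ha, hb]
  | grade1 y =>
    rcases y with y | y
    · exact hgen y
    -- The symbols `d y` follow from the generators because both maps commute with the
    -- differentials.
    · have e : (twist C D).d (twistMk (FreeDG.gen k y)) = twistMk (FreeDG.dgen k y) := by
        rw [twistMk_D, FreeDG.D_gen]
      change α (twistMk (FreeDG.dgen k y)) = β (twistMk (FreeDG.dgen k y))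
      rw [← e, DGHom.map_d, DGHom.map_d, hgen]

/-- Morphisms from an iterated twisted tensor product are determined by the iterated generators. -/
lemma twist_twist_hom_ext {α β : DGHom (twist (twist C D) E) T}
    (hR : ∀ h : E.H, α (idTensor (twist C D) h).val = β (idTensor (twist C D) h).val)
    (hER : ∀ (g : D.H) (hs : List E.H),
      α (eps (idTensor C g) hs).val = β (eps (idTensor C g) hs).val)
    (hEE : ∀ (f : C.H) (gs : List D.H) (hs : List E.H),
      α (eps (eps f gs) hs).val = β (eps (eps f gs) hs).val) : α = β := by
  -- In the formula for `d ε(F; hs)` every term except `ε(d F; hs)` involves only `F` and elements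
  -- `id ⊗ z`, so agreement on `F` forces agreement on `d F`.
  have hd : ∀ F : (twist C D).H, (∀ hs : List E.H, α (eps F hs).val = β (eps F hs).val) →
      ∀ hs : List E.H, α (eps F.d hs).val = β (eps F.d hs).val := by
    intro F hF hs
    have key : ∀ γ : DGHom (twist (twist C D) E) T, T.d (γ (eps F hs).val) = γ (eps F.d hs).val
      - (-1 : k) ^ F.1 • barD (fun t => γ (eps F t).val) hs
      + onHead (fun z t => (-1 : k) ^ (F.1 * z.sdeg) •
          (γ (idTensor (twist C D) z).val * γ (eps F t).val)) hs
      - onLast (fun t z => (-1 : k) ^ (F.1 + H.sdegs t) •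
          (γ (eps F t).val * γ (idTensor (twist C D) z).val)) hs := by
      intro γ
      have h := congrArg γ.toAlgHom.toLinearMap (d_eps F hs)
      rw [map_sub, map_add, map_sub, map_smul, map_barD, map_onHead, map_onLast] at h
      simp only [map_smul, AlgHom.toLinearMap_apply, γ.map_d, map_mul] at h
      exact h
    have h1 := key α
    have h2 := key β
    simp only [hF, hR] at h1
    rw [h1] at h2
    simpa using h2
  have hmul : ∀ F F' : (twist C D).H, (∀ hs : List E.H, α (eps F hs).val = β (eps F hs).val) →
      (∀ hs : List E.H, α (eps F' hs).val = β (eps F' hs).val) →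
      ∀ hs : List E.H, α (eps (F.mul F') hs).val = β (eps (F.mul F') hs).val := by
    intro F F' hF hF' hs
    rw [eps_mul_val, map_splitSum, map_splitSum]
    simp only [hF, hF']
  -- Each symbol of the free algebra, including the formal differentials, is represented by a
  -- homogeneous element on which the two maps agree.
  have hgen : ∀ y : TwistGen C D ⊕ TwistGen C D, ∃ F : (twist C D).H, F.1 = FreeDG.wt TwistGen.deg y ∧
      F.val = twistMk (FreeAlgebra.ι k y) ∧
      ∀ hs : List E.H, α (eps F hs).val = β (eps F hs).val := by
    rintro ((g | ⟨f, gs⟩) | (g | ⟨f, gs⟩))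
    · exact ⟨idTensor C g, rfl, rfl, hER g⟩
    · exact ⟨eps f gs, rfl, rfl, hEE f gs⟩
    · refine ⟨(idTensor C g).d, rfl, ?_, hd _ (hER g)⟩
      rw [H.val_d, idTensor_val, twistMk_D, FreeDG.D_gen]
      rfl
    · refine ⟨(eps f gs).d, rfl, ?_, hd _ (hEE f gs)⟩
      rw [H.val_d, eps_val, twistMk_D, FreeDG.D_gen]
      rfl
  have hlin : ∀ (γ : DGHom (twist (twist C D) E) T) (hs : List E.H),
      IsLinearH fun F : (twist C D).H => γ (eps F hs).val := by
    intro γ hs c i a b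
    simp only [eps_lin, map_add, map_smul]
  refine twist_hom_ext hR fun F hs => ?_
  -- The linear extension forgets the degree label of `F`, so that `F` may be replaced by a linear
  -- combination of words, and each word by a product of the elements from `hgen`.
  rw [← linExt_val (hlin α hs), ← linExt_val (hlin β hs)]
  obtain ⟨i, _, a, ha, rfl⟩ := F
  change linExt (hlin α hs) (twistMk a) = linExt (hlin β hs) (twistMk a)
  induction ha using Submodule.span_induction with
  | zero => simp only [map_zero]
  | add a b _ _ ha hb => simp only [map_add, ha, hb]
  | smul c a _ ha => simp only [map_smul, ha]
  | mem a ha =>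
    obtain ⟨l, -, rfl⟩ := ha
    obtain ⟨F, hF, hQ⟩ : ∃ F : (twist C D).H, F.val = twistMk (l.map (FreeAlgebra.ι k)).prod ∧
        ∀ hs : List E.H, α (eps F hs).val = β (eps F hs).val := by
      induction l with
      | nil =>
        refine ⟨H.one _, by simp [H.val_one], fun hs => ?_⟩
        cases hs with
        | nil => rw [eps_one_nil, map_one, map_one]
        | cons z hs => rw [eps_one_of_ne (by simp), map_zero, map_zero]
      | cons y l ih =>
        obtain ⟨F, hF, hQ⟩ := ih
        obtain ⟨G, -, hG, hQ'⟩ := hgen y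
        refine ⟨G.mul F, ?_, hmul G F hQ' hQ⟩
        rw [H.val_mul, hG, hF, List.map_cons, List.prod_cons, map_mul]
    rw [← hF, linExt_val, linExt_val, hQ]

/-- There is exactly one associator. -/
theorem existsUnique_isAssociator (C : DGAlg.{u, v} k) (D : DGAlg.{u, w} k)
    (E : DGAlg.{u, x} k) :
    ∃! α : DGHom (twist (twist C D) E) (twist C (twist D E)), IsAssociator C D E α := by
  refine ⟨associator C D E, associator_isAssociator C D E, fun β hβ => ?_⟩
  have hα := associator_isAssociator C D E
  refine twist_twist_hom_ext (fun h => ?_) (fun g hs => ?_) fun f gs hs => ?_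
  · rw [hβ.idTensor, hα.idTensor]
  · rw [hβ.eps_idTensor, hα.eps_idTensor]
  · rw [hβ.eps_eps, hα.eps_eps]

end HomExt

/-! ### Monoids and brace algebras -/

section Monoids

variable {B : DGAlg.{u, v} k}

lemma mapH_id {A : DGAlg.{u, v} k} : (DGHom.id A).mapH = fun a => a := rfl

/-- The value of `m ∘ (id ⊗ m) ∘ α` on the iterated generators. -/
lemma comp_twistMap_associator {m : DGHom (twist B B) B}
    {α : DGHom (twist (twist B B) B) (twist B (twist B B))} (hα : IsAssociator B B B α)
    (x : B.H) (ys zs : List B.H) :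
    ((m.comp (twistMap (DGHom.id B) m)).comp α) (eps (eps x ys) zs).val
      = insertSum (fun y l => m.mapH (eps y l)) (fun z => m.mapH (idTensor B z))
        (fun l => m (eps x l).val) ys zs := by
  change m (twistMap (DGHom.id B) m (α (eps (eps x ys) zs).val)) = _
  rw [hα.eps_eps]
  rw [← insertSum_map]
  refine (map_insertSum (m.comp (twistMap (DGHom.id B) m)).toAlgHom.toLinearMap _ _ _ ys zs).trans ?_
  congr 1
  funext l
  change m (twistMap (DGHom.id B) m (eps x l).val) = _
  rw [twistMap_eps]
  rfl

/-- The value of `m ∘ (m ⊗ id)` on `ε(F; zs)`. -/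
lemma comp_twistMap_left {m : DGHom (twist B B) B} (F : (twist B B).H) (zs : List B.H) :
    (m.comp (twistMap m (DGHom.id B))) (eps F zs).val = m (eps (m.mapH F) zs).val := by
  change m (twistMap m (DGHom.id B) (eps F zs).val) = _
  rw [twistMap_eps, mapH_id, List.map_id']

/-- The brace operations of a monoid. -/
def braceOps (m : DGHom (twist B B) B) : BraceOps B where
  op x ys := m (eps x ys).val
  op_mem x ys := m.map_mem (eps x ys).2.2
  op_add i a b ys := by simpa using congrArg m (eps_lin 1 a b ys)
  op_smul c i a ys := by
    have h : IsLinearH fun x : B.H => (eps x ys).val := fun c _ a b => eps_lin c a b ys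
    have := eps_lin c a 0 ys
    rw [h.map_zero, add_zero, add_zero] at this
    rw [this, map_smul]
  op_arg_add x l r i a b := by simpa using congrArg m (eps_arg_lin x l r 1 a b)
  op_arg_smul x l r c i a := by
    have := eps_arg_lin x l r c a 0
    rw [((eps_isCochain x).slot l r).map_zero, add_zero, add_zero] at this
    rw [this, map_smul]

/-- Apart from the unit condition `brace_nil` and the iterated brace identity, each axiom is `m`
applied to a relation of `twist B B`. The iterated identity is associativity at `ε(ε(x; ys); zs)`,
where `m(id ⊗ z) = z` turns the uninserted letters into themselves. -/
lemma IsTwistedMonoid.isUnitalBrace {m : DGHom (twist B B) B} (hm : IsTwistedMonoid B m) :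
    IsUnitalBrace B (braceOps m) where
  brace_nil := hm.mul_one
  mul_brace x x' ys := (congrArg m (eps_mul_val x x' ys)).trans (map_splitSum m.toAlgHom _ _ _ _)
  brace_brace x ys zs := by
    obtain ⟨α, hα, h⟩ := hm.assoc
    have h1 := comp_twistMap_left (m := m) (eps x ys) zs
    rw [h, comp_twistMap_associator hα] at h1
    refine h1.symm.trans ?_
    rw [show (fun z => m.mapH (idTensor B z)) = fun z => z from
      funext fun z => H.ext' rfl (hm.one_mul z)]
    rfl
  d_brace x ys h := by
    refine (m.map_d _).symm.trans ?_
    rw [d_eps_val x ys h, map_diffFormula]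
    simp only [hm.one_mul]
    rfl
  one_brace ys h := (congrArg m (eps_one_of_ne h)).trans (map_zero _)
  brace_one x l r := (congrArg m (eps_one_arg x l r)).trans (map_zero _)

/-- The images of the generators under the multiplication determined by brace operations. -/
def braceGen (br : BraceOps B) : TwistGen B B → B.carrier
  | .right b => b.val
  | .eps b bs => br.op b bs

/-- Each relation of `twist B B` becomes a brace axiom, or a property of the dg algebra `B` in the
case of `id ⊗ b`. -/
lemma braceGen_rel {br : BraceOps B} (hbr : IsUnitalBrace B br) (a b : FreeDG k (TwistGen B B))
    (h : TwistRel B B a b) : evalFree B (braceGen br) a = evalFree B (braceGen br) b := by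
  have hR : ∀ b : B.H, evalFree B (braceGen br) (TwistGen.R B b) = b.val :=
    fun _ => evalFree_gen _ _ _
  have hE : ∀ (b : B.H) (bs : List B.H), evalFree B (braceGen br) (TwistGen.E b bs) = br.op b bs :=
    fun _ _ => evalFree_gen _ _ _
  have hdR : ∀ b : B.H, evalFree B (braceGen br) (TwistGen.dR B b) = B.d b.val :=
    fun _ => evalFree_dgen _ _ _
  have hdE : ∀ (b : B.H) (bs : List B.H),
      evalFree B (braceGen br) (TwistGen.dE b bs) = B.d (br.op b bs) :=
    fun _ _ => evalFree_dgen _ _ _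
  cases h with
  | right_add i a b => rw [map_add, hR, hR, hR]; rfl
  | right_smul c i a => rw [map_smul, hR, hR]; rfl
  | right_one => rw [hR, map_one, H.val_one]
  | right_mul g g' => rw [map_mul, hR, hR, hR, H.val_mul]
  | eps_add i a b gs => rw [map_add, hE, hE, hE, br.op_add]
  | eps_smul c i a gs => rw [map_smul, hE, hE, br.op_smul]
  | eps_arg_add f l r i a b => rw [map_add, hE, hE, hE, br.op_arg_add]
  | eps_arg_smul f l r c i a => rw [map_smul, hE, hE, br.op_arg_smul]
  | eps_one => rw [hE, hbr.brace_nil, map_one, H.val_one]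
  | eps_one_left gs h => rw [hE, hbr.one_brace gs h, map_zero]
  | eps_one_arg f l r => rw [hE, hbr.brace_one, map_zero]
  | eps_mul f f' gs =>
    rw [hE, map_splitSum, hbr.mul_brace]
    simp only [hE]
  | d_right g => rw [hdR, hR, H.val_d]
  | d_eps_nil f => rw [hdE, hE, hbr.brace_nil, hbr.brace_nil, H.val_d]
  | d_eps f gs h =>
    rw [hdE, map_diffFormula, hbr.d_brace f gs h]
    simp only [hE, hR]

/-- The multiplication determined by a unital brace algebra structure. -/
def braceMul {br : BraceOps B} (hbr : IsUnitalBrace B br) : DGHom (twist B B) B :=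
  presentLift (twistRel_homog B B) B (braceGen br)
    (by
      rintro (b | ⟨b, bs⟩)
      · exact b.val_mem
      · exact br.op_mem b bs)
    (braceGen_rel hbr)

lemma braceMul_eps {br : BraceOps B} (hbr : IsUnitalBrace B br) (b : B.H) (bs : List B.H) :
    braceMul hbr (eps b bs).val = br.op b bs :=
  (presentLift_mk _ _ _ _ _ _).trans (evalFree_gen _ _ _)

lemma braceMul_idTensor {br : BraceOps B} (hbr : IsUnitalBrace B br) (b : B.H) :
    braceMul hbr (idTensor B b).val = b.val :=
  (presentLift_mk _ _ _ _ _ _).trans (evalFree_gen _ _ _)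

lemma braceMul_isTwistedMonoid {br : BraceOps B} (hbr : IsUnitalBrace B br) :
    IsTwistedMonoid B (braceMul hbr) where
  mul_one b := (braceMul_eps hbr b []).trans (hbr.brace_nil b)
  one_mul := braceMul_idTensor hbr
  assoc := by
    have hα := associator_isAssociator B B B
    refine ⟨associator B B B, hα, ?_⟩
    have hid : ∀ z : B.H, (braceMul hbr).mapH (idTensor B z) = z :=
      fun z => H.ext' rfl (braceMul_idTensor hbr z)
    have heps : ∀ (y : B.H) (l : List B.H), (braceMul hbr).mapH (eps y l) = br.opH y l :=
      fun y l => H.ext' rfl (braceMul_eps hbr y l)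
    -- On `id ⊗ h` and on `ε(id ⊗ g; hs)` both sides reduce to `h` and to `g{hs}`; the third family
    -- is the iterated brace identity.
    refine twist_twist_hom_ext (fun h => ?_) (fun g hs => ?_) fun f gs hs => ?_
    · change braceMul hbr (twistMap (braceMul hbr) (DGHom.id B) _)
        = braceMul hbr (twistMap (DGHom.id B) (braceMul hbr) (associator B B B _))
      rw [hα.idTensor, twistMap_idTensor, twistMap_idTensor, hid, mapH_id]
    · rw [comp_twistMap_left]
      change _ = braceMul hbr (twistMap (DGHom.id B) (braceMul hbr) (associator B B B _))
      rw [hα.eps_idTensor, twistMap_idTensor, hid, heps, braceMul_eps, braceMul_idTensor]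
      rfl
    · rw [comp_twistMap_left, comp_twistMap_associator hα]
      simp only [hid, heps, braceMul_eps]
      exact hbr.brace_brace f gs hs

end Monoids

end DGAlg
end

/-! ### The bijection -/

theorem lemma1p2 {k : Type u} [Field k] (B : DGAlg.{u, v} k) :
    (∃! α : DGAlg.DGHom (DGAlg.twist (DGAlg.twist B B) B) (DGAlg.twist B (DGAlg.twist B B)),
      DGAlg.IsAssociator B B B α) ∧
    (∀ m : DGAlg.DGHom (DGAlg.twist B B) B, DGAlg.IsTwistedMonoid B m →
      ∃! br : DGAlg.BraceOps B, DGAlg.IsUnitalBrace B br ∧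
        ∀ (b : B.H) (bs : List B.H), br.op b bs = m (DGAlg.eps b bs).val) ∧
    (∀ br : DGAlg.BraceOps B, DGAlg.IsUnitalBrace B br →
      ∃! m : DGAlg.DGHom (DGAlg.twist B B) B, DGAlg.IsTwistedMonoid B m ∧
        ∀ (b : B.H) (bs : List B.H), br.op b bs = m (DGAlg.eps b bs).val) := by
  refine ⟨DGAlg.existsUnique_isAssociator B B B, fun m hm => ?_, fun br hbr => ?_⟩
  · refine ⟨DGAlg.braceOps m, ⟨hm.isUnitalBrace, fun _ _ => rfl⟩, fun br h => ?_⟩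
    exact DGAlg.BraceOps.ext (funext fun b => funext fun bs => h.2 b bs)
  · refine ⟨DGAlg.braceMul hbr, ⟨DGAlg.braceMul_isTwistedMonoid hbr,
      fun b bs => (DGAlg.braceMul_eps hbr b bs).symm⟩, fun m h => ?_⟩
    -- A monoid structure is determined by its values on the generators: the unit condition fixes
    -- those on `id ⊗ b`, and the given formula fixes those on `ε(b; bs)`.
    refine DGAlg.twist_hom_ext (fun b => ?_) fun b bs => ?_
    · rw [h.1.one_mul, DGAlg.braceMul_idTensor]
    · rw [← h.2, DGAlg.braceMul_eps]
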